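/- Let $(M,g)$ be a compact connected oriented smooth two-dimensional Riemannian manifold, possibly with boundary ($g$ smooth up to the boundary), with Riemannian area form $dx_g$ and Riemannian distance $d$. Let $\mathbf A$ be a smooth (up to the boundary) real one-form on $M$, and write $d\mathbf A=b\,dx_g$ with $b\in C^\infty(M)$. For $h>0$ let $$H^h=(ih\,d+\mathbf A)^*(ih\,d+\mathbf A),$$ where the adjoint is taken with respect to the $L^2$ scalar products defined by $g$ on smooth functions and one-forms with compact support in the interior of $M$. Put $b_0=\min_M|b|$ and $\gamma=\{x\in M:\ |b(x)|=b_0\}$, and assume that - $b_0>0$; - $\gamma$ is a smooth curve (an embedded one-dimensional submanifold) contained in the interior of $M$; - there are a constant $C>0$ and a neighbourhood of $\gamma$ on which $C^{-1}d(x,\gamma)^2\le |b(x)|-b_0\le C\,d(x,\gamma)^2$. Let $\tilde N$ be a smooth unit vector field on a neighbourhood of $\gamma$ that is orthogonal to $\gamma$ along $\gamma$ and whose integral curves are geodesics. Put $\beta_2(x)=\tilde N^2|b|(x)$ for $x\in\gamma$, and let $R$ be the scalar curvature of $(M,g)$ (twice the Gauss curvature). Then for every $x\in\gamma$ and every integer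 $k\ge 0$ there exist $C$ and $h_0>0$ such that for every $h\in(0,h_0]$ there exists a function $\Phi^h_k\neq 0$, smooth and compactly supported in the interior of $M$, with $$\left\|H^h\Phi^h_k-\lambda^h(k,x)\Phi^h_k\right\|\le C\,h^{17/8}\,\|\Phi^h_k\|,$$ where $\|\cdot\|$ is the norm of $L^2(M,dx_g)$ and $$\lambda^h(k,x)=(2k+1)\,h\,b_0+h^2\left[(2k^2+2k+1)\,\frac{\beta_2(x)}{4b_0}+\frac12\,(k^2+k)\,R(x)\right].$$ -/

import Mathlib

open scoped Manifold ContDiff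
open Bundle MeasureTheory

noncomputable section

namespace MagneticWell

/-- The model vector space `ℝ²`. -/
abbrev E2 : Type := EuclideanSpace ℝ (Fin 2)

/-- The standard basis vectors of `ℝ²`. -/
def stdVec (i : Fin 2) : E2 := EuclideanSpace.single i (1 : ℝ)

/-- The `i`-th partial derivative of a function of two variables (taken inside the half plane on
which the charts of a surface with boundary take their values; at interior points this is the
ordinary partial derivative). -/
def pderivIn (i : Fin 2) (f : E2 → ℝ) (y : E2) : ℝ :=
  fderivWithin ℝ f (Set.range (𝓡∂ 2)) y (stdVec i)

section Surface

/-! Throughout, `M` is a surface, possibly with boundary (possibly empty), modelled on the closed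
half plane.  A point `c : M` is also used as the name of the preferred chart around `c`. -/

variable {M : Type*} [TopologicalSpace M] [ChartedSpace (EuclideanHalfSpace 2) M]

/-- The preferred charts form an oriented atlas: all their coordinate changes have positive
Jacobian determinant. -/
def IsOrientedAtlas (M : Type*) [TopologicalSpace M] [ChartedSpace (EuclideanHalfSpace 2) M]
    [IsManifold (𝓡∂ 2) ∞ M] : Prop :=
  ∀ c c' p : M, p ∈ (extChartAt (𝓡∂ 2) c).source → p ∈ (extChartAt (𝓡∂ 2) c').source →
    0 < (tangentCoordChange (𝓡∂ 2) c c' p).det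

/-- The point with coordinates `y` in the chart at `c`. -/
def pt (c : M) (y : E2) : M := (extChartAt (𝓡∂ 2) c).symm y

/-- The coordinate vector `∂/∂xⁱ` of the chart at `c`, at the point with coordinates `y`. -/
def coordVec (c : M) (i : Fin 2) (y : E2) : TangentSpace (𝓡∂ 2) (pt c y) :=
  mfderivWithin 𝓘(ℝ, E2) (𝓡∂ 2) (extChartAt (𝓡∂ 2) c).symm (Set.range (𝓡∂ 2)) y (stdVec i)

/-- The `i`-th coordinate vector at `p` of the preferred chart around `p`. (By definition of the
tangent bundle, the tangent space at `p` is the model space `ℝ²`, read in that chart.) -/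
def basisVec (p : M) (i : Fin 2) : TangentSpace (𝓡∂ 2) p := stdVec i

/-- The component `A_i` of the real one-form `A` in the chart at `c`. -/
def formCoeff (A : ∀ p : M, TangentSpace (𝓡∂ 2) p →L[ℝ] ℝ) (c : M) (i : Fin 2) (y : E2) : ℝ :=
  A (pt c y) (coordVec c i y)

/-- Smoothness (up to the boundary) of a real one-form, as a section of the cotangent bundle. -/
def IsSmoothForm [IsManifold (𝓡∂ 2) ∞ M] (A : ∀ p : M, TangentSpace (𝓡∂ 2) p →L[ℝ] ℝ) : Prop :=
  ContMDiff (𝓡∂ 2) ((𝓡∂ 2).prod 𝓘(ℝ, E2 →L[ℝ] ℝ)) ∞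
    (fun p ↦ TotalSpace.mk' (E2 →L[ℝ] ℝ)
      (E := fun p : M ↦ TangentSpace (𝓡∂ 2) p →L[ℝ] Bundle.Trivial M ℝ p) p (A p))

/-- The space `C_c^∞(M)`: complex valued smooth functions with compact support contained in the
interior of `M`. -/
structure IsTestFunction (u : M → ℂ) : Prop where
  smooth : ContMDiff (𝓡∂ 2) 𝓘(ℝ, ℂ) ∞ u
  compactSupport : HasCompactSupport u
  support_subset : tsupport u ⊆ (𝓡∂ 2).interior M

/-- `f` is a smooth local defining function, on the open set `U`, for the set `S`: inside `U`, `S`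
is the zero set of `f`, and `df ≠ 0` on it. -/
structure IsLocalDefiningFunction (S U : Set M) (f : M → ℝ) : Prop where
  isOpen : IsOpen U
  smooth : ContMDiffOn (𝓡∂ 2) 𝓘(ℝ, ℝ) ∞ f U
  zero_iff : ∀ q ∈ U, q ∈ S ↔ f q = 0
  regular : ∀ q ∈ U, q ∈ S → mfderiv (𝓡∂ 2) 𝓘(ℝ, ℝ) f q ≠ 0

/-- `S` is a smooth (embedded) curve: locally a regular level set of a smooth function. -/
def IsSmoothCurve (S : Set M) : Prop :=
  ∀ p ∈ S, ∃ (U : Set M) (f : M → ℝ), p ∈ U ∧ IsLocalDefiningFunction S U f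

/-- The map `u ↦ ih du + A u` from functions to (complex) one-forms. -/
def magneticD (h : ℝ) (A : ∀ p : M, TangentSpace (𝓡∂ 2) p →L[ℝ] ℝ) (u : M → ℂ) (p : M) :
    TangentSpace (𝓡∂ 2) p →L[ℝ] ℂ :=
  let du : TangentSpace (𝓡∂ 2) p →L[ℝ] ℂ := mfderiv (𝓡∂ 2) 𝓘(ℝ, ℂ) u p
  (Complex.I * (h : ℂ)) • du + (u p) • Complex.ofRealCLM.comp (A p)

variable [RiemannianBundle (fun p : M ↦ TangentSpace (𝓡∂ 2) p)]

/-- The matrix `(g_ij)` of the Riemannian metric in the chart at `c`, at the point with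
coordinates `y`. -/
def gram (c : M) (y : E2) : Matrix (Fin 2) (Fin 2) ℝ :=
  Matrix.of fun i j ↦ inner ℝ (coordVec c i y) (coordVec c j y)

/-- The Christoffel symbol `Γ^k_ij` of the Levi-Civita connection in the chart at `c`. -/
def christoffel (c : M) (k i j : Fin 2) (y : E2) : ℝ :=
  (1 / 2) * ∑ l, (gram c y)⁻¹ k l *
    (pderivIn i (fun z ↦ gram c z j l) y + pderivIn j (fun z ↦ gram c z i l) y
      - pderivIn l (fun z ↦ gram c z i j) y)

/-- The Ricci tensor `R_jk` in the chart at `c`. -/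
def ricci (c : M) (j k : Fin 2) (y : E2) : ℝ :=
  ∑ i, (pderivIn i (christoffel c i j k) y - pderivIn k (christoffel c i i j) y
    + ∑ l, (christoffel c i i l y * christoffel c l j k y
      - christoffel c i k l y * christoffel c l i j y))

/-- The scalar curvature `R = g^{jk} R_jk` at `p` (twice the Gauss curvature; it is `2` for the
unit sphere), computed in the preferred chart around `p`. -/
def scalarCurvature (p : M) : ℝ :=
  ∑ j, ∑ k, (gram p (extChartAt (𝓡∂ 2) p p))⁻¹ j k * ricci p j k (extChartAt (𝓡∂ 2) p p)

/-- The curve `σ` satisfies the geodesic equation `ÿ^k + Γ^k_ij ẏ^i ẏ^j = 0` at time `t₀`. -/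
def IsGeodesicAt (σ : ℝ → M) (t₀ : ℝ) : Prop :=
  ∀ k : Fin 2,
    deriv (deriv (fun t ↦ extChartAt (𝓡∂ 2) (σ t₀) (σ t) k)) t₀
      + ∑ i, ∑ j, christoffel (σ t₀) k i j (extChartAt (𝓡∂ 2) (σ t₀) (σ t₀))
          * deriv (fun t ↦ extChartAt (𝓡∂ 2) (σ t₀) (σ t) i) t₀
          * deriv (fun t ↦ extChartAt (𝓡∂ 2) (σ t₀) (σ t) j) t₀ = 0

/-- The magnetic field strength `b`, i.e. the function with `dA = b dx_g`, where `dx_g` is the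
Riemannian area form of the oriented surface; in a positively oriented chart
`b = (∂₀A₁ - ∂₁A₀) / √(det g)`. -/
def fieldStrength (A : ∀ p : M, TangentSpace (𝓡∂ 2) p →L[ℝ] ℝ) (p : M) : ℝ :=
  (pderivIn 0 (formCoeff A p 1) (extChartAt (𝓡∂ 2) p p)
    - pderivIn 1 (formCoeff A p 0) (extChartAt (𝓡∂ 2) p p))
    / √(gram p (extChartAt (𝓡∂ 2) p p)).det

/-- `b₀ = min |b|`. -/
def minField (A : ∀ p : M, TangentSpace (𝓡∂ 2) p →L[ℝ] ℝ) : ℝ :=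
  ⨅ p : M, |fieldStrength A p|

/-- The set `γ = {|b| = b₀}`. -/
def well (A : ∀ p : M, TangentSpace (𝓡∂ 2) p →L[ℝ] ℝ) : Set M :=
  {p | |fieldStrength A p| = minField A}

/-- The Riemannian distance `d(p, S)` from a point to a set. -/
def distTo (S : Set M) (p : M) : ℝ :=
  (⨅ q ∈ S, Manifold.riemannianEDist (𝓡∂ 2) p q).toReal

/-- The vector `v` at `p` is orthogonal to the curve `S`, i.e. to the tangent line `ker df` of `S`
at `p`, for local defining functions `f` of `S`. -/
def IsNormalTo (S : Set M) (p : M) (v : TangentSpace (𝓡∂ 2) p) : Prop :=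
  ∀ (U : Set M) (f : M → ℝ), p ∈ U → IsLocalDefiningFunction S U f →
    ∀ w : TangentSpace (𝓡∂ 2) p, mfderiv (𝓡∂ 2) 𝓘(ℝ, ℝ) f p w = 0 → inner ℝ v w = 0

/-- The natural extension of a unit normal field of the curve `S`: a vector field which on a
neighbourhood of `S` is smooth, of length one and has geodesics as its integral curves, and which
is orthogonal to `S` along `S`. (Its values away from `S` are irrelevant.) -/
def IsNormalGeodesicField [IsManifold (𝓡∂ 2) ∞ M] (S : Set M)
    (N : ∀ p : M, TangentSpace (𝓡∂ 2) p) : Prop :=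
  ∃ U : Set M, IsOpen U ∧ S ⊆ U ∧
    ContMDiffOn (𝓡∂ 2) (𝓡∂ 2).tangent ∞
      (fun p ↦ (⟨p, N p⟩ : TangentBundle (𝓡∂ 2) M)) U ∧
    (∀ p ∈ U, ‖N p‖ = 1) ∧
    (∀ p ∈ S, IsNormalTo S p (N p)) ∧
    (∀ (σ : ℝ → M) (t₀ : ℝ), σ t₀ ∈ U → IsMIntegralCurveAt σ N t₀ → IsGeodesicAt σ t₀)

/-- The derivative `N f` of a function along a vector field. -/
def alongField (N : ∀ p : M, TangentSpace (𝓡∂ 2) p) (f : M → ℝ) (p : M) : ℝ :=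
  mfderiv (𝓡∂ 2) 𝓘(ℝ, ℝ) f p (N p)

/-- `β₂ = N² |b|`. -/
def beta2 (A : ∀ p : M, TangentSpace (𝓡∂ 2) p →L[ℝ] ℝ) (N : ∀ p : M, TangentSpace (𝓡∂ 2) p)
    (p : M) : ℝ :=
  alongField N (alongField N (fun q ↦ |fieldStrength A q|)) p

/-- The hermitian scalar product `g^{ij} α_i conj(α'_j)` of complex covectors at `p` (the Gram
matrix may be taken in any basis of the tangent space; here in the coordinate basis). -/
def coInner (p : M) (α α' : TangentSpace (𝓡∂ 2) p →L[ℝ] ℂ) : ℂ :=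
  ∑ i, ∑ j,
    (((Matrix.of fun a b : Fin 2 ↦ (inner ℝ (basisVec p a) (basisVec p b) : ℝ))⁻¹ i j : ℝ) : ℂ)
      * α (basisVec p i) * (starRingEnd ℂ) (α' (basisVec p j))

variable [MeasurableSpace M]

/-- The measure `√(det g) dx⁰dx¹` of the chart at `c`, carried by the domain of that chart. -/
def chartVolume (c : M) : Measure M :=
  Measure.map (extChartAt (𝓡∂ 2) c).symm
    ((volume.restrict (extChartAt (𝓡∂ 2) c).target).withDensity
      fun y ↦ ENNReal.ofReal √(gram c y).det)

/-- The Riemannian volume measure `dx_g`: the measure obtained by gluing the measures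
`√(det g) dx⁰dx¹` of the charts. (They agree on overlaps of charts, so that their supremum
restricts to each of them.) -/
def riemannianVolume (M : Type*) [TopologicalSpace M] [ChartedSpace (EuclideanHalfSpace 2) M]
    [RiemannianBundle (fun p : M ↦ TangentSpace (𝓡∂ 2) p)] [MeasurableSpace M] : Measure M :=
  ⨆ c : M, chartVolume c

/-- `F = (ih d + A)^* α`, where `(ih d + A)^* : Ω¹_c(M) → C_c^∞(M)` is the adjoint of
`u ↦ ih du + A u` for the `L²` scalar products given by the metric. -/
structure IsMagneticAdjoint (h : ℝ) (A : ∀ p : M, TangentSpace (𝓡∂ 2) p →L[ℝ] ℝ)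
    (α : ∀ p : M, TangentSpace (𝓡∂ 2) p →L[ℝ] ℂ) (F : M → ℂ) : Prop where
  isTestFunction : IsTestFunction F
  adjoint : ∀ v : M → ℂ, IsTestFunction v →
    ∫ p, F p * (starRingEnd ℂ) (v p) ∂(riemannianVolume M)
      = ∫ p, coInner p (α p) (magneticD h A v p) ∂(riemannianVolume M)

/-- `F = H^h u` for the magnetic Schrödinger operator `H^h = (ih d + A)^* (ih d + A)`. -/
def IsMagneticLaplacian (h : ℝ) (A : ∀ p : M, TangentSpace (𝓡∂ 2) p →L[ℝ] ℝ)
    (u F : M → ℂ) : Prop :=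
  IsMagneticAdjoint h A (magneticD h A u) F

/-- `λ^h(k, x) = (2k+1) h b₀ + h² [(2k²+2k+1) β₂(x)/(4b₀) + ½ (k²+k) R(x)]`. -/
def quasiEigenvalue (A : ∀ p : M, TangentSpace (𝓡∂ 2) p →L[ℝ] ℝ)
    (N : ∀ p : M, TangentSpace (𝓡∂ 2) p) (h : ℝ) (k : ℕ) (x : M) : ℝ :=
  (2 * (k : ℝ) + 1) * h * minField A
    + h ^ 2 * ((2 * (k : ℝ) ^ 2 + 2 * k + 1) * (beta2 A N x / (4 * minField A))
      + (1 / 2) * ((k : ℝ) ^ 2 + k) * scalarCurvature x)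

end Surface

end MagneticWell

end

/-! The quasimode is written down explicitly near the point x. Put h = ε⁸ and use coordinates (s, t)
centred at x in which ∂_t is N(x) at the centre.

Geometry. Up to cubic terms the metric is (1 - K t²) ds² + dt², where K = R/2 is the Gauss curvature
(`exists_normal_param`), and |b| = b₀ + β₂ t²/2 (`fieldStrength_hasJet`). The latter holds because
|b| is minimal and constant on γ: its gradient vanishes there, its Hessian degenerates along γ, and
N²|b|(x) is that Hessian evaluated on N(x). A gauge transformation turns the potential into (b t + c
t³ + error) ds with b = ±b₀ and c = ±(β₂ - b₀K)/6, both with the same sign (`exists_normalForm`).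
The operator is then (1 + K t²)(ih∂_s + bt + ct³)² - h²∂_t² + h² K t∂_t plus remainders
(`planeH_expand`).

Oscillator. Without ih∂_s, the substitution t = h^{1/2} τ yields h(b²τ² - ∂_τ²) with eigenvalues
(2k+1) b₀ h, perturbed by h²(κτ⁴ + Kτ∂_τ), κ = K b² + 2bc. In the k-th state the mean of τ⁴ is
3(2k²+2k+1)/(4b₀²) and that of τ∂_τ is -1/2; this gives the h² term of λ^h(k, x). The first-order
corrector is polynomial times Gaussian (`exists_perturbed_hermite`).

Localization in s. A cutoff of width ε³ in s makes cubic Taylor remainders O(ε⁹); times the energy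
scale h = ε⁸ this is ε¹⁷ = h^{17/8}, the claimed error. But on such a cutoff ih∂_s has size ε⁵, only
one factor ε below bt, whose size is ε⁴. The remedy is the formal operator exp((ih/b)∂_s∂_t), which
conjugates bt into ih∂_s + bt. Its Taylor polynomial of degree 8, applied to cutoff times Gaussian,
gives `wave`, on which ih∂_s + bt acts like bt up to O(ε¹³) (`modelD_wave`). The trial function is
`wave p + h wave q`, with p a Hermite polynomial and q its corrector.

Bookkeeping. `Bd r` records size ε^r with rapid decay in t/ε⁴, and `Co j n` the vanishing of a
coefficient like |t|^j ‖z‖^n, worth ε^{4j+3n}. Adding up gives `bd_planeH_residual`.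
`Bd.eLpNorm_le_trial` turns this into a relative L² estimate, and `isMagneticLaplacian_push` with
`eLpNorm_magneticLaplacian_push` carries it to the surface. -/

noncomputable section

open scoped Manifold ContDiff Topology
open Bundle MeasureTheory Filter

namespace MagneticWell

set_option linter.unusedSectionVars false

/-! ### Partial derivatives, order of vanishing and 2-jets in the plane. -/

section PlaneCalculus

variable {F : Type*} [NormedAddCommGroup F] [NormedSpace ℝ F]

/-- The `i`-th partial derivative of a function on the plane. -/
def pd (i : Fin 2) (f : E2 → F) (z : E2) : F := fderiv ℝ f z (stdVec i)

lemma pd_contDiffAt {f : E2 → F} {z : E2} (hf : ContDiffAt ℝ ∞ f z) (i : Fin 2) :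
    ContDiffAt ℝ ∞ (pd i f) z :=
  (hf.fderiv_right (m := ∞) le_rfl).clm_apply contDiffAt_const

lemma pd_contDiff {f : E2 → F} (hf : ContDiff ℝ ∞ f) (i : Fin 2) : ContDiff ℝ ∞ (pd i f) :=
  contDiff_iff_contDiffAt.2 fun _ ↦ pd_contDiffAt hf.contDiffAt i

lemma pd_congr {f g : E2 → F} {z : E2} (h : f =ᶠ[𝓝 z] g) (i : Fin 2) : pd i f =ᶠ[𝓝 z] pd i g := by
  filter_upwards [h.fderiv (𝕜 := ℝ)] with y hy
  simp [pd, hy]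

lemma pd_congr_at {f g : E2 → F} {z : E2} (h : f =ᶠ[𝓝 z] g) (i : Fin 2) : pd i f z = pd i g z :=
  (pd_congr h i).eq_of_nhds

lemma eventually_differentiableAt {f : E2 → F} {z : E2} (hf : ContDiffAt ℝ ∞ f z) :
    ∀ᶠ y in 𝓝 z, DifferentiableAt ℝ f y := by
  have h1 : ContDiffAt ℝ 1 f z := hf.of_le (by exact_mod_cast le_top)
  filter_upwards [h1.eventually (by simp)] with y hy
  exact hy.differentiableAt one_ne_zero

lemma smooth_diffAt {f : E2 → F} {z : E2} (hf : ContDiffAt ℝ ∞ f z) :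
    DifferentiableAt ℝ f z := hf.differentiableAt (by simp)

lemma pd_add {f g : E2 → F} {z : E2} (hf : DifferentiableAt ℝ f z) (hg : DifferentiableAt ℝ g z)
    (i : Fin 2) : pd i (fun y ↦ f y + g y) z = pd i f z + pd i g z := by
  simp [pd, fderiv_fun_add hf hg]

lemma pd_sub {f g : E2 → F} {z : E2} (hf : DifferentiableAt ℝ f z) (hg : DifferentiableAt ℝ g z)
    (i : Fin 2) : pd i (fun y ↦ f y - g y) z = pd i f z - pd i g z := by
  simp [pd, fderiv_fun_sub hf hg]

lemma pd_neg {f : E2 → F} {z : E2} (i : Fin 2) : pd i (fun y ↦ -f y) z = -pd i f z := by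
  simp [pd, fderiv_fun_neg]

lemma pd_mul {𝕂 : Type*} [NormedCommRing 𝕂] [NormedAlgebra ℝ 𝕂] {f g : E2 → 𝕂} {z : E2}
    (hf : DifferentiableAt ℝ f z) (hg : DifferentiableAt ℝ g z) (i : Fin 2) :
    pd i (fun y ↦ f y * g y) z = pd i f z * g z + f z * pd i g z := by
  simp only [pd, fderiv_fun_mul hf hg, add_apply, smul_apply, smul_eq_mul]
  ring

@[simp] lemma pd_const (c : F) (i : Fin 2) (z : E2) : pd i (fun _ ↦ c) z = 0 := by simp [pd]

lemma pd_const_mul {𝕂 : Type*} [NormedCommRing 𝕂] [NormedAlgebra ℝ 𝕂] {f : E2 → 𝕂} {z : E2}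
    (c : 𝕂) (hf : DifferentiableAt ℝ f z) (i : Fin 2) :
    pd i (fun y ↦ c * f y) z = c * pd i f z := by
  simp [pd, fderiv_const_mul hf]

lemma pd_sum {ι : Type*} (s : Finset ι) {f : ι → E2 → F} {z : E2}
    (hf : ∀ j ∈ s, DifferentiableAt ℝ (f j) z) (i : Fin 2) :
    pd i (fun y ↦ ∑ j ∈ s, f j y) z = ∑ j ∈ s, pd i (f j) z := by
  simp [pd, fderiv_fun_sum hf]

lemma coord_contDiff (j : Fin 2) : ContDiff ℝ ∞ (fun z : E2 ↦ z j) := by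
  exact (EuclideanSpace.proj (𝕜 := ℝ) j).contDiff

lemma pd_coord (i j : Fin 2) (z : E2) : pd i (fun y : E2 ↦ y j) z = if i = j then 1 else 0 := by
  have : (fun y : E2 ↦ y j) = (EuclideanSpace.proj (𝕜 := ℝ) j : E2 → ℝ) := rfl
  rw [pd, this, ContinuousLinearMap.fderiv]
  simp [stdVec, eq_comm]

lemma eq_sum_stdVec (v : E2) : v = v 0 • stdVec 0 + v 1 • stdVec 1 := by
  ext i; fin_cases i <;> simp [stdVec]

lemma fderiv_apply_eq_pd (f : E2 → F) (z v : E2) :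
    fderiv ℝ f z v = v 0 • pd 0 f z + v 1 • pd 1 f z := by
  conv_lhs => rw [eq_sum_stdVec v]
  simp [pd]

/-- The chain rule for partial derivatives. -/
lemma pd_comp {f : E2 → F} {E : E2 → E2} {z : E2} (hf : DifferentiableAt ℝ f (E z))
    (hE : DifferentiableAt ℝ E z) (i : Fin 2) :
    pd i (fun y ↦ f (E y)) z
      = pd i (fun y ↦ E y 0) z • pd 0 f (E z) + pd i (fun y ↦ E y 1) z • pd 1 f (E z) := by
  have h1 : fderiv ℝ (fun y ↦ f (E y)) z = (fderiv ℝ f (E z)).comp (fderiv ℝ E z) :=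
    fderiv_comp z hf hE
  have h2 (j : Fin 2) : pd i (fun y ↦ E y j) z = (fderiv ℝ E z (stdVec i)) j := by
    have : fderiv ℝ (fun y ↦ EuclideanSpace.proj (𝕜 := ℝ) j (E y)) z
      = (EuclideanSpace.proj (𝕜 := ℝ) j).comp (fderiv ℝ E z) :=

      ((EuclideanSpace.proj (𝕜 := ℝ) j).hasFDerivAt.comp z hE.hasFDerivAt).fderiv
    change fderiv ℝ (fun y ↦ EuclideanSpace.proj (𝕜 := ℝ) j (E y)) z (stdVec i) = _
    rw [this]; rfl
  rw [pd, h1, h2, h2, ContinuousLinearMap.comp_apply, fderiv_apply_eq_pd]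

lemma pd_comm {f : E2 → F} {z : E2} (hf : ContDiffAt ℝ ∞ f z) (i j : Fin 2) :
    pd i (pd j f) z = pd j (pd i f) z := by
  have h := hf.isSymmSndFDerivAt (n := ∞) (by simp; exact WithTop.coe_le_coe.2 le_top)
  have hd : DifferentiableAt ℝ (fderiv ℝ f) z :=
    (hf.fderiv_right (m := ∞) le_rfl).differentiableAt (by simp)
  have key (a b : Fin 2) : pd a (pd b f) z = fderiv ℝ (fderiv ℝ f) z (stdVec a) (stdVec b) := by
    unfold pd
    rw [fderiv_clm_apply hd (differentiableAt_const _)]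
    simp
  rw [key, key, h.eq]

/-- `Van n f`: the function `f` is smooth at the origin and all its derivatives of order less than
`n` vanish there. -/
def Van : ℕ → (E2 → ℝ) → Prop
  | 0, f => ContDiffAt ℝ ∞ f 0
  | n + 1, f => ContDiffAt ℝ ∞ f 0 ∧ f 0 = 0 ∧ ∀ i, Van n (pd i f)

namespace Van

lemma contDiffAt {n : ℕ} {f : E2 → ℝ} (h : Van n f) : ContDiffAt ℝ ∞ f 0 := by
  cases n with
  | zero => exact h
  | succ n => exact h.1

lemma pd {n : ℕ} {f : E2 → ℝ} (h : Van (n + 1) f) (i : Fin 2) : Van n (pd i f) := h.2.2 i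

lemma eq_zero {n : ℕ} {f : E2 → ℝ} (h : Van (n + 1) f) : f 0 = 0 := h.2.1

lemma congr {n : ℕ} {f g : E2 → ℝ} (h : Van n f) (hfg : f =ᶠ[𝓝 0] g) : Van n g := by
  induction n generalizing f g with
  | zero => exact ContDiffAt.congr_of_eventuallyEq h hfg.symm
  | succ n ih =>
    exact ⟨h.1.congr_of_eventuallyEq hfg.symm, hfg.eq_of_nhds ▸ h.2.1,
      fun i ↦ ih (h.2.2 i) (pd_congr hfg i)⟩

lemma of_succ {n : ℕ} {f : E2 → ℝ} (h : Van (n + 1) f) : Van n f := by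
  induction n generalizing f with
  | zero => exact h.1
  | succ n ih => exact ⟨h.1, h.2.1, fun i ↦ ih (h.2.2 i)⟩

lemma mono {m n : ℕ} {f : E2 → ℝ} (h : Van n f) (hmn : m ≤ n) : Van m f := by
  induction n, hmn using Nat.le_induction with
  | base => exact h
  | succ n _ ih => exact ih h.of_succ

lemma add {n : ℕ} {f g : E2 → ℝ} (hf : Van n f) (hg : Van n g) : Van n (fun z ↦ f z + g z) := by
  induction n generalizing f g with
  | zero => exact ContDiffAt.add hf hg
  | succ n ih =>
    refine ⟨hf.1.add hg.1, by simp [hf.2.1, hg.2.1], fun i ↦ (ih (hf.2.2 i) (hg.2.2 i)).congr ?_⟩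
    filter_upwards [eventually_differentiableAt hf.1, eventually_differentiableAt hg.1] with y h1 h2
    rw [pd_add h1 h2]

lemma neg {n : ℕ} {f : E2 → ℝ} (hf : Van n f) : Van n (fun z ↦ -f z) := by
  induction n generalizing f with
  | zero => exact ContDiffAt.neg hf
  | succ n ih =>
    refine ⟨hf.1.neg, by simp [hf.2.1], fun i ↦ (ih (hf.2.2 i)).congr ?_⟩
    exact .of_forall fun y ↦ (pd_neg i).symm

/-- By the Leibniz rule each derivative of the product is a sum of two products of total order one
less, so the induction runs on `m + n`. A factor of order zero stays of order zero when
differentiated, and the other factor then gives up one order instead. -/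
lemma mul {m n : ℕ} {f g : E2 → ℝ} (hf : Van m f) (hg : Van n g) :
    Van (m + n) (fun z ↦ f z * g z) := by
  induction hk : m + n generalizing m n f g with
  | zero => exact hf.contDiffAt.mul hg.contDiffAt
  | succ k ih =>
    refine ⟨hf.contDiffAt.mul hg.contDiffAt, ?_, fun i ↦ ?_⟩
    · rcases m with _ | m
      · rcases n with _ | n
        · omega
        · simp [hg.eq_zero]
      · simp [hf.eq_zero]
    · have e : (fun z ↦ MagneticWell.pd i f z * g z + f z * MagneticWell.pd i g z) =ᶠ[𝓝 0]
          MagneticWell.pd i (fun z ↦ f z * g z) := by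
        filter_upwards [eventually_differentiableAt hf.contDiffAt,
          eventually_differentiableAt hg.contDiffAt] with y h1 h2
        rw [pd_mul h1 h2]
      refine Van.congr (Van.add ?_ ?_) e
      · rcases m with _ | m
        · rcases n with _ | n
          · omega
          · exact ih (m := 0) (pd_contDiffAt hf.contDiffAt i) hg.of_succ (by omega)
        · exact ih (hf.pd i) hg (by omega)
      · rcases n with _ | n
        · rcases m with _ | m
          · omega
          · exact ih (n := 0) hf.of_succ (pd_contDiffAt hg.contDiffAt i) (by omega)
        · exact ih hf (hg.pd i) (by omega)

lemma const_mul {n : ℕ} {f : E2 → ℝ} (c : ℝ) (hf : Van n f) : Van n (fun z ↦ c * f z) := by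
  have : Van 0 (fun _ : E2 ↦ c) := contDiffAt_const
  simpa using this.mul hf

lemma smooth_mul {n : ℕ} {u f : E2 → ℝ} (hu : ContDiffAt ℝ ∞ u 0) (hf : Van n f) :
    Van n (fun z ↦ u z * f z) := by
  simpa using Van.mul (m := 0) hu hf

lemma of_contDiffAt {f : E2 → ℝ} (hf : ContDiffAt ℝ ∞ f 0) (h0 : f 0 = 0) : Van 1 f :=
  ⟨hf, h0, fun i ↦ pd_contDiffAt hf i⟩

lemma coord (j : Fin 2) : Van 1 (fun z : E2 ↦ z j) :=
  of_contDiffAt (coord_contDiff j).contDiffAt (by simp)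

lemma zero (n : ℕ) : Van n (fun _ ↦ 0) := by
  induction n with
  | zero => exact contDiffAt_const
  | succ n ih => exact ⟨contDiffAt_const, rfl, fun i ↦ ih.congr (.of_forall fun y ↦ by simp)⟩

/-- Each order is gained by the mean value inequality on the closed ball of radius `‖z‖`, where the
gradient is bounded by the previous order. -/
lemma bound {n : ℕ} {f : E2 → ℝ} (hf : Van n f) :
    ∃ C : ℝ, 0 ≤ C ∧ ∃ r > 0, ∀ z : E2, ‖z‖ < r → |f z| ≤ C * ‖z‖ ^ n := by
  induction n generalizing f with
  | zero =>
    have hc : ContinuousAt f 0 := hf.contDiffAt.continuousAt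
    obtain ⟨r, hr, h⟩ := Metric.continuousAt_iff.1 hc 1 one_pos
    refine ⟨|f 0| + 1, by positivity, r, hr, fun z hz ↦ ?_⟩
    have := h (x := z) (by simpa using hz)
    rw [Real.dist_eq] at this
    have h2 := abs_sub_abs_le_abs_sub (f z) (f 0)
    simp only [pow_zero, mul_one]; linarith
  | succ n ih =>
    obtain ⟨C0, hC0, r0, hr0, h0⟩ := ih (hf.2.2 0)
    obtain ⟨C1, hC1, r1, hr1, h1⟩ := ih (hf.2.2 1)
    obtain ⟨r2, hr2, h2⟩ := Metric.eventually_nhds_iff.1 (eventually_differentiableAt hf.1)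
    refine ⟨C0 + C1, by positivity, min r2 (min r0 r1), by positivity, fun z hz ↦ ?_⟩
    have hseg : Convex ℝ (Metric.closedBall (0 : E2) ‖z‖) := convex_closedBall _ _
    have hlt (y : E2) (hy : y ∈ Metric.closedBall (0 : E2) ‖z‖) : ‖y‖ < min r2 (min r0 r1) :=
      (mem_closedBall_zero_iff.1 hy).trans_lt hz
    have key := hseg.norm_image_sub_le_of_norm_fderiv_le (𝕜 := ℝ) (f := f)
      (C := (C0 + C1) * ‖z‖ ^ n) (x := 0) (y := z)
      (fun y hy ↦ h2 (by simpa using (hlt y hy).trans_le (min_le_left _ _)))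
      (fun y hy ↦ by
        refine ContinuousLinearMap.opNorm_le_bound _ (by positivity) fun v ↦ ?_
        rw [fderiv_apply_eq_pd]
        have hyz : ‖y‖ ^ n ≤ ‖z‖ ^ n :=
          pow_le_pow_left₀ (norm_nonneg _) (mem_closedBall_zero_iff.1 hy) _
        have e0 := (h0 y ((hlt y hy).trans_le ((min_le_right _ _).trans (min_le_left _ _)))).trans
          (mul_le_mul_of_nonneg_left hyz hC0)
        have e1 := (h1 y ((hlt y hy).trans_le ((min_le_right _ _).trans (min_le_right _ _)))).trans
          (mul_le_mul_of_nonneg_left hyz hC1)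
        have n0 : |v 0| ≤ ‖v‖ := PiLp.norm_apply_le v 0
        have n1 : |v 1| ≤ ‖v‖ := PiLp.norm_apply_le v 1
        calc ‖v 0 • MagneticWell.pd 0 f y + v 1 • MagneticWell.pd 1 f y‖
            ≤ |v 0| * |MagneticWell.pd 0 f y| + |v 1| * |MagneticWell.pd 1 f y| := by
              refine (norm_add_le _ _).trans ?_
              simp
          _ ≤ ‖v‖ * (C0 * ‖z‖ ^ n) + ‖v‖ * (C1 * ‖z‖ ^ n) := by gcongr
          _ = _ := by ring)
      (by simp) (by simp)
    rw [hf.2.1, sub_zero, sub_zero, Real.norm_eq_abs] at key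
    rw [pow_succ, ← mul_assoc]
    exact key

/-- The chain rule writes a derivative of the composition as smooth factors times the composed
derivatives of `f`, which have one order less. -/
lemma comp {n : ℕ} {f : E2 → ℝ} {E : E2 → E2} (hf : Van n f) (hE : ContDiff ℝ ∞ E)
    (hE0 : E 0 = 0) : Van n (fun z ↦ f (E z)) := by
  have hcomp {g : E2 → ℝ} (hg : ContDiffAt ℝ ∞ g 0) : ContDiffAt ℝ ∞ (fun z ↦ g (E z)) 0 :=
    ContDiffAt.comp (0 : E2) (hE0.symm ▸ hg) hE.contDiffAt
  induction n generalizing f with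
  | zero => exact hcomp hf.contDiffAt
  | succ n ih =>
    refine ⟨hcomp hf.1, by simp [hE0, hf.2.1], fun i ↦ ?_⟩
    have hEj (j : Fin 2) : ContDiff ℝ ∞ (fun y ↦ E y j) := (coord_contDiff j).comp hE
    have e : (fun z ↦ MagneticWell.pd i (fun y ↦ E y 0) z * MagneticWell.pd 0 f (E z)
        + MagneticWell.pd i (fun y ↦ E y 1) z * MagneticWell.pd 1 f (E z)) =ᶠ[𝓝 0]
          MagneticWell.pd i (fun z ↦ f (E z)) := by
      have h1 := eventually_differentiableAt hf.1
      have h2 : Tendsto E (𝓝 0) (𝓝 0) := by simpa [hE0] using hE.continuous.tendsto 0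
      filter_upwards [h2.eventually h1] with y h1
      rw [pd_comp h1 (hE.differentiable (by simp) y)]; rfl
    exact Van.congr ((smooth_mul (pd_contDiff (hEj 0) i).contDiffAt (ih (hf.2.2 0))).add
      (smooth_mul (pd_contDiff (hEj 1) i).contDiffAt (ih (hf.2.2 1)))) e

end Van

/-- The polynomial of degree two with the given Taylor coefficients at the origin. -/
def quadPoly (c l0 l1 q00 q01 q11 : ℝ) (z : E2) : ℝ :=
  c + l0 * z 0 + l1 * z 1 + q00 / 2 * (z 0 * z 0) + q01 * (z 0 * z 1) + q11 / 2 * (z 1 * z 1)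

/-- `f` agrees with a polynomial of degree two up to terms of order three at the origin. -/
def HasJet (f : E2 → ℝ) (c l0 l1 q00 q01 q11 : ℝ) : Prop :=
  Van 3 (fun z ↦ f z - quadPoly c l0 l1 q00 q01 q11 z)

lemma quadPoly_contDiff (c l0 l1 q00 q01 q11 : ℝ) : ContDiff ℝ ∞ (quadPoly c l0 l1 q00 q01 q11) := by
  have h0 := coord_contDiff 0
  have h1 := coord_contDiff 1
  unfold quadPoly
  fun_prop

lemma pd_quadPoly (c l0 l1 q00 q01 q11 : ℝ) (z : E2) :
    pd 0 (quadPoly c l0 l1 q00 q01 q11) z = l0 + q00 * z 0 + q01 * z 1 ∧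
    pd 1 (quadPoly c l0 l1 q00 q01 q11) z = l1 + q01 * z 0 + q11 * z 1 := by
  have h0 : DifferentiableAt ℝ (fun z : E2 ↦ z 0) z := (coord_contDiff 0).differentiable (by simp) z
  have h1 : DifferentiableAt ℝ (fun z : E2 ↦ z 1) z := (coord_contDiff 1).differentiable (by simp) z
  unfold quadPoly
  constructor
  all_goals
    rw [pd_add (by fun_prop) (by fun_prop), pd_add (by fun_prop) (by fun_prop),
      pd_add (by fun_prop) (by fun_prop), pd_add (by fun_prop) (by fun_prop),
      pd_add (by fun_prop) (by fun_prop), pd_const,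
      pd_const_mul _ (by fun_prop), pd_const_mul _ (by fun_prop), pd_const_mul _ (by fun_prop),
      pd_const_mul _ (by fun_prop), pd_const_mul _ (by fun_prop), pd_mul (by fun_prop) (by fun_prop),
      pd_mul (by fun_prop) (by fun_prop), pd_mul (by fun_prop) (by fun_prop), pd_coord, pd_coord]
    simp
    ring

lemma pd_pd_quadPoly (c l0 l1 q00 q01 q11 : ℝ) (z : E2) :
    pd 0 (pd 0 (quadPoly c l0 l1 q00 q01 q11)) z = q00 ∧
    pd 1 (pd 0 (quadPoly c l0 l1 q00 q01 q11)) z = q01 ∧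
    pd 0 (pd 1 (quadPoly c l0 l1 q00 q01 q11)) z = q01 ∧
    pd 1 (pd 1 (quadPoly c l0 l1 q00 q01 q11)) z = q11 := by
  have e0 : pd 0 (quadPoly c l0 l1 q00 q01 q11) = quadPoly l0 q00 q01 0 0 0 := by
    funext y; rw [(pd_quadPoly ..).1]; simp [quadPoly]
  have e1 : pd 1 (quadPoly c l0 l1 q00 q01 q11) = quadPoly l1 q01 q11 0 0 0 := by
    funext y; rw [(pd_quadPoly ..).2]; simp [quadPoly]
  rw [e0, e1]
  simp [(pd_quadPoly ..).1, (pd_quadPoly ..).2]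

/-- The parameters of a jet are the partial derivatives themselves; the factors 1/2 sit in
`quadPoly`. This dictionary allows a jet to be computed by differentiation and derivatives to be
read off from jet arithmetic. -/
lemma hasJet_iff {f : E2 → ℝ} {c l0 l1 q00 q01 q11 : ℝ} (hf : ContDiffAt ℝ ∞ f 0) :
    HasJet f c l0 l1 q00 q01 q11 ↔ f 0 = c ∧ pd 0 f 0 = l0 ∧ pd 1 f 0 = l1 ∧
      pd 0 (pd 0 f) 0 = q00 ∧ pd 0 (pd 1 f) 0 = q01 ∧ pd 1 (pd 1 f) 0 = q11 := by
  have hq := (quadPoly_contDiff c l0 l1 q00 q01 q11).contDiffAt (x := 0)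
  have e (i : Fin 2) : pd i (fun z ↦ f z - quadPoly c l0 l1 q00 q01 q11 z) =ᶠ[𝓝 0]
      fun z ↦ pd i f z - pd i (quadPoly c l0 l1 q00 q01 q11) z := by
    filter_upwards [eventually_differentiableAt hf, eventually_differentiableAt hq] with y h1 h2
    rw [pd_sub h1 h2]
  have e2 (i j : Fin 2) : pd j (pd i (fun z ↦ f z - quadPoly c l0 l1 q00 q01 q11 z)) 0 =
      pd j (pd i f) 0 - pd j (pd i (quadPoly c l0 l1 q00 q01 q11)) 0 := by
    rw [pd_congr_at (e i), pd_sub (smooth_diffAt (pd_contDiffAt hf i)) (smooth_diffAt (pd_contDiffAt hq i))]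
  have hs := hf.sub hq
  have c10 : pd 1 (pd 0 f) 0 = pd 0 (pd 1 f) 0 := pd_comm hf 1 0
  have main : HasJet f c l0 l1 q00 q01 q11 ↔ (f 0 - quadPoly c l0 l1 q00 q01 q11 0 = 0 ∧
      ∀ i, pd i f 0 - pd i (quadPoly c l0 l1 q00 q01 q11) 0 = 0 ∧
        ∀ j, pd j (pd i f) 0 - pd j (pd i (quadPoly c l0 l1 q00 q01 q11)) 0 = 0) := by
    constructor
    · intro h
      refine ⟨h.2.1, fun i ↦ ⟨?_, fun j ↦ ?_⟩⟩
      · rw [← (e i).eq_of_nhds]; exact (h.2.2 i).2.1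
      · rw [← e2]; exact ((h.2.2 i).2.2 j).2.1
    · rintro ⟨h0, h⟩
      refine ⟨hs, h0, fun i ↦ ⟨pd_contDiffAt hs i, ?_, fun j ↦ Van.of_contDiffAt
        (pd_contDiffAt (pd_contDiffAt hs i) j) ?_⟩⟩
      · rw [(e i).eq_of_nhds]; exact (h i).1
      · rw [e2]; exact (h i).2 j
  rw [main]
  simp only [Fin.forall_fin_two, (pd_quadPoly ..).1, (pd_quadPoly ..).2, (pd_pd_quadPoly ..).1,
    (pd_pd_quadPoly ..).2.1, (pd_pd_quadPoly ..).2.2.1, (pd_pd_quadPoly ..).2.2.2, c10, sub_eq_zero]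
  simp only [quadPoly, PiLp.zero_apply]
  simp only [mul_zero, add_zero]
  tauto

lemma hasJet_self {f : E2 → ℝ} (hf : ContDiffAt ℝ ∞ f 0) :
    HasJet f (f 0) (pd 0 f 0) (pd 1 f 0) (pd 0 (pd 0 f) 0) (pd 0 (pd 1 f) 0) (pd 1 (pd 1 f) 0) :=
  (hasJet_iff hf).2 ⟨rfl, rfl, rfl, rfl, rfl, rfl⟩

namespace HasJet

lemma contDiffAt {f : E2 → ℝ} {c l0 l1 q00 q01 q11 : ℝ} (h : HasJet f c l0 l1 q00 q01 q11) :
    ContDiffAt ℝ ∞ f 0 := by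
  have := (Van.contDiffAt h).add (quadPoly_contDiff c l0 l1 q00 q01 q11).contDiffAt
  simpa using this

lemma add {f g : E2 → ℝ} {c l0 l1 q00 q01 q11 c' l0' l1' q00' q01' q11' : ℝ}
    (hf : HasJet f c l0 l1 q00 q01 q11) (hg : HasJet g c' l0' l1' q00' q01' q11') :
    HasJet (fun z ↦ f z + g z) (c + c') (l0 + l0') (l1 + l1') (q00 + q00') (q01 + q01')
      (q11 + q11') :=
  (Van.add hf hg).congr (.of_forall fun z ↦ by simp only [quadPoly]; ring)

lemma mul {f g : E2 → ℝ} {c l0 l1 q00 q01 q11 c' l0' l1' q00' q01' q11' : ℝ}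
    (hf : HasJet f c l0 l1 q00 q01 q11) (hg : HasJet g c' l0' l1' q00' q01' q11') :
    HasJet (fun z ↦ f z * g z) (c * c') (l0 * c' + c * l0') (l1 * c' + c * l1')
      (q00 * c' + 2 * l0 * l0' + c * q00') (q01 * c' + l0 * l1' + l1 * l0' + c * q01')
      (q11 * c' + 2 * l1 * l1' + c * q11') := by
  have hf' := hf.contDiffAt
  have hg' := hg.contDiffAt
  have ef := (hasJet_iff hf').1 hf
  have eg := (hasJet_iff hg').1 hg
  have e (i : Fin 2) : pd i (fun z ↦ f z * g z) =ᶠ[𝓝 0]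
      fun z ↦ pd i f z * g z + f z * pd i g z := by
    filter_upwards [eventually_differentiableAt hf', eventually_differentiableAt hg'] with y h1 h2
    rw [pd_mul h1 h2]
  have e2 (i j : Fin 2) : pd j (pd i (fun z ↦ f z * g z)) 0 = pd j (pd i f) 0 * g 0 +
      pd i f 0 * pd j g 0 + (pd j f 0 * pd i g 0 + f 0 * pd j (pd i g) 0) := by
    have a1 := (smooth_diffAt (pd_contDiffAt hf' i))
    have a2 := (smooth_diffAt (pd_contDiffAt hg' i))
    have a3 := smooth_diffAt hf'
    have a4 := smooth_diffAt hg'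
    rw [pd_congr_at (e i), pd_add (by fun_prop) (by fun_prop), pd_mul a1 a4, pd_mul a3 a2]
  rw [hasJet_iff (hf'.mul hg'), (e 0).eq_of_nhds, (e 1).eq_of_nhds, e2, e2, e2, ef.1, ef.2.1,
    ef.2.2.1, ef.2.2.2.1, ef.2.2.2.2.1, ef.2.2.2.2.2, eg.1, eg.2.1, eg.2.2.1, eg.2.2.2.1,
    eg.2.2.2.2.1, eg.2.2.2.2.2]
  refine ⟨by ring, by ring, by ring, by ring, by ring, by ring⟩

lemma congr {f g : E2 → ℝ} {c l0 l1 q00 q01 q11 : ℝ} (h : HasJet f c l0 l1 q00 q01 q11)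
    (hfg : f =ᶠ[𝓝 0] g) : HasJet g c l0 l1 q00 q01 q11 :=
  Van.congr h (hfg.mono fun z hz ↦ by simp only [hz])

/-- The jet of a composition with a map that fixes the origin. -/
lemma comp {f : E2 → ℝ} {c l0 l1 q00 q01 q11 : ℝ} (hf : HasJet f c l0 l1 q00 q01 q11)
    {E : E2 → E2} (hE : ContDiff ℝ ∞ E) {a0 a1 a00 a01 a11 b0 b1 b00 b01 b11 : ℝ}
    (h0 : HasJet (fun z ↦ E z 0) 0 a0 a1 a00 a01 a11)
    (h1 : HasJet (fun z ↦ E z 1) 0 b0 b1 b00 b01 b11) :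
    HasJet (fun z ↦ f (E z)) c (l0 * a0 + l1 * b0) (l0 * a1 + l1 * b1)
      (l0 * a00 + l1 * b00 + q00 * a0 * a0 + 2 * q01 * a0 * b0 + q11 * b0 * b0)
      (l0 * a01 + l1 * b01 + q00 * a0 * a1 + q01 * (a0 * b1 + a1 * b0) + q11 * b0 * b1)
      (l0 * a11 + l1 * b11 + q00 * a1 * a1 + 2 * q01 * a1 * b1 + q11 * b1 * b1) := by
  have z0 : E 0 0 = 0 := ((hasJet_iff h0.contDiffAt).1 h0).1
  have z1 : E 0 1 = 0 := ((hasJet_iff h1.contDiffAt).1 h1).1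
  have hE0 : E 0 = 0 := by ext i; fin_cases i <;> simpa
  have hc (a : ℝ) : HasJet (fun _ ↦ a) a 0 0 0 0 0 :=
    (Van.zero 3).congr (.of_forall fun z ↦ by simp [quadPoly])
  -- Jet arithmetic for the quadratic polynomial evaluated at the components of `E`; the cubic
  -- remainder of `f` is covered by `Van.comp`.
  have hp := (((((hc c).add ((hc l0).mul h0)).add ((hc l1).mul h1)).add
    ((hc (q00 / 2)).mul (h0.mul h0))).add ((hc q01).mul (h0.mul h1))).add
    ((hc (q11 / 2)).mul (h1.mul h1))
  refine ((Van.comp hf hE hE0).add hp).congr (.of_forall fun z ↦ ?_)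
  simp only [quadPoly]
  ring

end HasJet
end PlaneCalculus

/-! ### Forms and metrics in arbitrary local parametrizations of the surface. -/

section Parametrization

variable {M : Type*} [TopologicalSpace M] [ChartedSpace (EuclideanHalfSpace 2) M]

/-- The coordinate vectors of a parametrization `ψ` of a part of the surface. -/
def vec (ψ : E2 → M) (i : Fin 2) (z : E2) : TangentSpace (𝓡∂ 2) (ψ z) :=
  mfderiv 𝓘(ℝ, E2) (𝓡∂ 2) ψ z (stdVec i)

/-- The coefficients of a one-form in a parametrization. -/
def cof (A : ∀ p : M, TangentSpace (𝓡∂ 2) p →L[ℝ] ℝ) (ψ : E2 → M) (i : Fin 2) (z : E2) : ℝ :=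
  A (ψ z) (vec ψ i z)

/-- The coefficients of the metric in a parametrization. -/
def met [RiemannianBundle (fun p : M ↦ TangentSpace (𝓡∂ 2) p)] (ψ : E2 → M) (i j : Fin 2)
    (z : E2) : ℝ :=
  inner ℝ (vec ψ i z) (vec ψ j z)

lemma clm_apply_eq {V : Type*} [AddCommGroup V] [Module ℝ V] [TopologicalSpace V]
    (T : E2 →L[ℝ] V) (v : E2) : T v = v 0 • T (stdVec 0) + v 1 • T (stdVec 1) := by
  conv_lhs => rw [eq_sum_stdVec v]
  rw [map_add, map_smul, map_smul]

lemma vec_comp {ψ : E2 → M} {E : E2 → E2} {z : E2}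
    (hψ : MDifferentiableAt 𝓘(ℝ, E2) (𝓡∂ 2) ψ (E z)) (hE : DifferentiableAt ℝ E z) (i : Fin 2) :
    vec (fun y ↦ ψ (E y)) i z = pd i (fun y ↦ E y 0) z • vec ψ 0 (E z)
      + pd i (fun y ↦ E y 1) z • vec ψ 1 (E z) := by
  have h1 : mfderiv 𝓘(ℝ, E2) (𝓡∂ 2) (ψ ∘ E) z =
      (mfderiv 𝓘(ℝ, E2) (𝓡∂ 2) ψ (E z)).comp (mfderiv 𝓘(ℝ, E2) 𝓘(ℝ, E2) E z) :=
    mfderiv_comp z hψ hE.mdifferentiableAt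
  have h2 (j : Fin 2) : pd i (fun y ↦ E y j) z = (fderiv ℝ E z (stdVec i)) j := by
    have : fderiv ℝ (fun y ↦ EuclideanSpace.proj (𝕜 := ℝ) j (E y)) z
      = (EuclideanSpace.proj (𝕜 := ℝ) j).comp (fderiv ℝ E z) :=
      ((EuclideanSpace.proj (𝕜 := ℝ) j).hasFDerivAt.comp z hE.hasFDerivAt).fderiv
    change fderiv ℝ (fun y ↦ EuclideanSpace.proj (𝕜 := ℝ) j (E y)) z (stdVec i) = _
    rw [this]; rfl
  rw [h2, h2]
  unfold vec
  change mfderiv 𝓘(ℝ, E2) (𝓡∂ 2) (ψ ∘ E) z (stdVec i) = _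
  rw [h1, mfderiv_eq_fderiv]
  exact clm_apply_eq (mfderiv 𝓘(ℝ, E2) (𝓡∂ 2) ψ (E z)) (fderiv ℝ E z (stdVec i))

lemma cof_comp (A : ∀ p : M, TangentSpace (𝓡∂ 2) p →L[ℝ] ℝ) {ψ : E2 → M} {E : E2 → E2} {z : E2}
    (hψ : MDifferentiableAt 𝓘(ℝ, E2) (𝓡∂ 2) ψ (E z)) (hE : DifferentiableAt ℝ E z) (i : Fin 2) :
    cof A (fun y ↦ ψ (E y)) i z = pd i (fun y ↦ E y 0) z * cof A ψ 0 (E z)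
      + pd i (fun y ↦ E y 1) z * cof A ψ 1 (E z) := by
  unfold cof
  rw [vec_comp hψ hE, map_add, map_smul, map_smul]
  rfl

lemma met_comp [RiemannianBundle (fun p : M ↦ TangentSpace (𝓡∂ 2) p)] {ψ : E2 → M} {E : E2 → E2}
    {z : E2} (hψ : MDifferentiableAt 𝓘(ℝ, E2) (𝓡∂ 2) ψ (E z)) (hE : DifferentiableAt ℝ E z)
    (i j : Fin 2) :
    met (fun y ↦ ψ (E y)) i j z
      = pd i (fun y ↦ E y 0) z * pd j (fun y ↦ E y 0) z * met ψ 0 0 (E z)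
      + (pd i (fun y ↦ E y 0) z * pd j (fun y ↦ E y 1) z
        + pd i (fun y ↦ E y 1) z * pd j (fun y ↦ E y 0) z) * met ψ 0 1 (E z)
      + pd i (fun y ↦ E y 1) z * pd j (fun y ↦ E y 1) z * met ψ 1 1 (E z) := by
  unfold met
  rw [vec_comp hψ hE, vec_comp hψ hE]
  simp only [inner_add_left, inner_add_right, real_inner_smul_left, real_inner_smul_right]
  rw [real_inner_comm (vec ψ 0 (E z)) (vec ψ 1 (E z))]
  ring

lemma met_symm [RiemannianBundle (fun p : M ↦ TangentSpace (𝓡∂ 2) p)] (ψ : E2 → M) (i j : Fin 2) :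
    met ψ i j = met ψ j i := by
  funext z; exact real_inner_comm _ _

/-- Away from the boundary the half plane is a neighbourhood, so derivatives within it are ordinary
ones. Thus the chart data of the statement become data of the parametrization `pt c`, to which
changes of coordinates apply. -/
lemma coordVec_eq_vec {c : M} {y : E2} (hy : Set.range (𝓡∂ 2) ∈ 𝓝 y) (i : Fin 2) :
    coordVec c i y = vec (pt c) i y := by
  unfold coordVec vec
  rw [mfderivWithin_of_mem_nhds hy]
  rfl

lemma formCoeff_eq_cof (A : ∀ p : M, TangentSpace (𝓡∂ 2) p →L[ℝ] ℝ) {c : M} {y : E2}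
    (hy : Set.range (𝓡∂ 2) ∈ 𝓝 y) (i : Fin 2) : formCoeff A c i y = cof A (pt c) i y := by
  unfold formCoeff cof
  rw [coordVec_eq_vec hy]

lemma gram_eq_met [RiemannianBundle (fun p : M ↦ TangentSpace (𝓡∂ 2) p)] {c : M} {y : E2}
    (hy : Set.range (𝓡∂ 2) ∈ 𝓝 y) (i j : Fin 2) : gram c y i j = met (pt c) i j y := by
  simp only [gram, Matrix.of_apply, met]
  rw [coordVec_eq_vec hy, coordVec_eq_vec hy]

lemma pderivIn_eq_pd {f : E2 → ℝ} {y : E2} (hy : Set.range (𝓡∂ 2) ∈ 𝓝 y) (i : Fin 2) :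
    pderivIn i f y = pd i f y := by
  unfold pderivIn pd
  rw [fderivWithin_of_mem_nhds hy]

variable [IsManifold (𝓡∂ 2) ∞ M]

/-- The frame is the bundle map dψ applied to a constant field of the plane. Smoothness as a section
along ψ is what makes `cof` and `met` smooth functions. -/
lemma contMDiffAt_vec {ψ : E2 → M} {z : E2} (hψ : ContMDiffAt 𝓘(ℝ, E2) (𝓡∂ 2) ∞ ψ z) (i : Fin 2) :
    ContMDiffAt 𝓘(ℝ, E2) (𝓡∂ 2).tangent ∞
      (fun y ↦ (⟨ψ y, vec ψ i y⟩ : TangentBundle (𝓡∂ 2) M)) z := by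
  have h := hψ.mfderiv_const (m := ∞) le_rfl
  have hv : ContMDiffAt 𝓘(ℝ, E2) 𝓘(ℝ, E2).tangent ∞
      (fun y : E2 ↦ (⟨y, stdVec i⟩ : TangentBundle 𝓘(ℝ, E2) E2)) z :=
    contMDiffAt_vectorSpace_iff_contDiffAt.2 contDiffAt_const
  exact ContMDiffAt.clm_apply_of_inCoordinates (b₁ := fun y : E2 ↦ y) (b₂ := ψ)
    (E₁ := TangentSpace 𝓘(ℝ, E2)) (E₂ := fun p : M ↦ TangentSpace (𝓡∂ 2) p) h hv hψ

lemma cof_contDiffAt {A : ∀ p : M, TangentSpace (𝓡∂ 2) p →L[ℝ] ℝ} (hA : IsSmoothForm A)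
    {ψ : E2 → M} {z : E2} (hψ : ContMDiffAt 𝓘(ℝ, E2) (𝓡∂ 2) ∞ ψ z) (i : Fin 2) :
    ContDiffAt ℝ ∞ (cof A ψ i) z := by
  have h1 := ContMDiffAt.comp z (hA.contMDiffAt (x := ψ z)) hψ
  have h2 := ContMDiffAt.clm_bundle_apply (E₁ := fun p : M ↦ TangentSpace (𝓡∂ 2) p)
    (E₂ := Bundle.Trivial M ℝ) (b := ψ) (ϕ := fun y ↦ A (ψ y)) h1 (contMDiffAt_vec hψ i)
  rw [contMDiffAt_totalSpace] at h2
  exact h2.2.contDiffAt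

lemma met_contDiffAt [RiemannianBundle (fun p : M ↦ TangentSpace (𝓡∂ 2) p)]
    [IsContMDiffRiemannianBundle (𝓡∂ 2) ∞ E2 (fun p : M ↦ TangentSpace (𝓡∂ 2) p)]
    {ψ : E2 → M} {z : E2} (hψ : ContMDiffAt 𝓘(ℝ, E2) (𝓡∂ 2) ∞ ψ z) (i j : Fin 2) :
    ContDiffAt ℝ ∞ (met ψ i j) z :=
  (ContMDiffAt.inner_bundle (IB := 𝓡∂ 2) (F := E2) (E := fun p : M ↦ TangentSpace (𝓡∂ 2) p)
    (b := ψ) (contMDiffAt_vec hψ i) (contMDiffAt_vec hψ j)).contDiffAt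

/-- At interior points, the inverse of the preferred chart is a local diffeomorphism. -/
lemma isLocalDiffeomorphAt_pt {x : M} (hx : x ∈ (𝓡∂ 2).interior M) :
    IsLocalDiffeomorphAt 𝓘(ℝ, E2) (𝓡∂ 2) ∞ (pt x) (extChartAt (𝓡∂ 2) x x) := by
  have hopen : IsOpen (interior (extChartAt (𝓡∂ 2) x).target) := isOpen_interior
  let Φ : PartialDiffeomorph 𝓘(ℝ, E2) (𝓡∂ 2) E2 M ∞ :=
    { toFun := pt x
      invFun := extChartAt (𝓡∂ 2) x
      source := interior (extChartAt (𝓡∂ 2) x).target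
      target := (extChartAt (𝓡∂ 2) x).source ∩
        extChartAt (𝓡∂ 2) x ⁻¹' interior (extChartAt (𝓡∂ 2) x).target
      map_source' := fun (y : E2) hy ↦ ⟨(extChartAt (𝓡∂ 2) x).map_target (interior_subset hy), by
        change extChartAt (𝓡∂ 2) x ((extChartAt (𝓡∂ 2) x).symm y) ∈
          interior (extChartAt (𝓡∂ 2) x).target
        rwa [(extChartAt (𝓡∂ 2) x).right_inv (interior_subset hy)]⟩
      map_target' := fun p hp ↦ hp.2
      left_inv' := fun y hy ↦ (extChartAt (𝓡∂ 2) x).right_inv (interior_subset hy)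
      right_inv' := fun p hp ↦ (extChartAt (𝓡∂ 2) x).left_inv hp.1
      open_source := hopen
      open_target := (continuousOn_extChartAt x).isOpen_inter_preimage
        (isOpen_extChartAt_source x) hopen
      contMDiffOn_toFun := (contMDiffOn_extChartAt_symm x).mono interior_subset
      contMDiffOn_invFun := (contMDiffOn_extChartAt (x := x)).mono
        (by rw [← extChartAt_source (𝓡∂ 2)]; exact Set.inter_subset_left) }
  refine ⟨Φ, ?_, fun _ _ ↦ rfl⟩
  change extChartAt (𝓡∂ 2) x x ∈ interior (extChartAt (𝓡∂ 2) x).target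
  rw [mem_interior_iff_mem_nhds]
  have h1 : Set.range (𝓡∂ 2) ∈ 𝓝 (extChartAt (𝓡∂ 2) x x) := mem_interior_iff_mem_nhds.1 hx
  have h2 := extChartAt_target_mem_nhdsWithin (I := 𝓡∂ 2) x
  rwa [nhdsWithin_eq_nhds.2 h1] at h2

/-- The inverse function theorem. -/
lemma isLocalDiffeomorphAt_of_hasFDerivAt {E : E2 → E2} {z : E2} (hE : ContDiff ℝ ∞ E)
    {L : E2 ≃L[ℝ] E2} (hL : HasFDerivAt E (L : E2 →L[ℝ] E2) z) :
    IsLocalDiffeomorphAt 𝓘(ℝ, E2) 𝓘(ℝ, E2) ∞ E z := by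
  let e := hE.contDiffAt.toOpenPartialHomeomorph E hL (by simp)
  have hez : z ∈ e.source := hE.contDiffAt.mem_toOpenPartialHomeomorph_source hL (by simp)
  -- The inverse is known to be smooth only at images of points where the derivative is invertible;
  -- these form an open set, to which the homeomorphism is restricted.
  let S : Set E2 := fderiv ℝ E ⁻¹' Set.range ((↑) : (E2 ≃L[ℝ] E2) → E2 →L[ℝ] E2)
  have hS : IsOpen S := (hE.continuous_fderiv (by simp)).isOpen_preimage _
    (ContinuousLinearEquiv.isOpen (𝕜 := ℝ) (E := E2) (F := E2))
  let e' := e.restrOpen S hS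
  have hsrc : e'.source = e.source ∩ S := e.restrOpen_source S hS
  let Φ : PartialDiffeomorph 𝓘(ℝ, E2) 𝓘(ℝ, E2) E2 E2 ∞ :=
    { e'.toPartialEquiv with
      open_source := e'.open_source
      open_target := e'.open_target
      contMDiffOn_toFun := hE.contMDiff.contMDiffOn
      contMDiffOn_invFun := by
        suffices h : ContDiffOn ℝ ∞ e'.symm e'.target from h.contMDiffOn
        intro y hy
        have hm : e'.symm y ∈ e.source ∩ S := hsrc ▸ e'.map_target hy
        obtain ⟨L', hL'⟩ := hm.2
        refine (e'.contDiffAt_symm (f₀' := L') hy ?_ hE.contDiffAt).contDiffWithinAt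
        rw [hL']
        exact (hE.differentiable (by simp) _).hasFDerivAt }
  refine ⟨Φ, ?_, fun _ _ ↦ rfl⟩
  change z ∈ e'.source
  rw [hsrc]
  exact ⟨hez, L, hL.fderiv.symm⟩

end Parametrization

/-! ### Frames, Gram matrices and the scalar product of covectors. -/

section Frames

variable {M : Type*} [TopologicalSpace M] [ChartedSpace (EuclideanHalfSpace 2) M]

/-- The two values involve tangent spaces at points that are equal without being identical
expressions; both are read in the model space `E2`, where they can be compared. -/
lemma cof_congr (A : ∀ p : M, TangentSpace (𝓡∂ 2) p →L[ℝ] ℝ) {ψ ψ' : E2 → M} {z : E2}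
    (h : ψ =ᶠ[𝓝 z] ψ') (i : Fin 2) : cof A ψ i z = cof A ψ' i z := by
  have key (p q : M) (hpq : p = q) (v : E2) : (A p : E2 →L[ℝ] ℝ) v = (A q : E2 →L[ℝ] ℝ) v := by
    subst hpq; rfl
  unfold cof vec
  rw [h.mfderiv_eq]
  exact key _ _ h.eq_of_nhds _

/-- The scalar product of the tangent space at `p`. -/
def innerAt [RiemannianBundle (fun p : M ↦ TangentSpace (𝓡∂ 2) p)] (p : M)
    (v w : TangentSpace (𝓡∂ 2) p) : ℝ := inner ℝ v w

lemma met_congr [RiemannianBundle (fun p : M ↦ TangentSpace (𝓡∂ 2) p)] {ψ ψ' : E2 → M} {z : E2}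
    (h : ψ =ᶠ[𝓝 z] ψ') (i j : Fin 2) : met ψ i j z = met ψ' i j z := by
  have key (p q : M) (hpq : p = q) (v w : E2) :
      innerAt p v w = innerAt q v w := by
    subst hpq; rfl
  unfold met vec
  rw [h.mfderiv_eq]
  exact key _ _ h.eq_of_nhds _ _

/-- A linear isomorphism of the plane has invertible matrix. -/
lemma det_of_injective {V : Type*} [AddCommGroup V] [Module ℝ V] [TopologicalSpace V]
    (T : E2 →L[ℝ] V) (hT : Function.Injective T) (b : E2 ≃ₗ[ℝ] V) {m : Matrix (Fin 2) (Fin 2) ℝ}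
    (hm : ∀ i, T (stdVec i) = ∑ j, m i j • b (stdVec j)) : m.det ≠ 0 := by
  intro h0
  obtain ⟨c, hc, hcm⟩ := Matrix.exists_vecMul_eq_zero_iff.2 h0
  apply hc
  have h1 : T (c 0 • stdVec 0 + c 1 • stdVec 1) = 0 := by
    rw [map_add, map_smul, map_smul, hm, hm]
    have e (j : Fin 2) : c 0 * m 0 j + c 1 * m 1 j = 0 := by
      simpa [Matrix.vecMul, dotProduct, Fin.sum_univ_two] using congrFun hcm j
    simp only [Fin.sum_univ_two, smul_add, smul_smul]
    calc _ = (c 0 * m 0 0 + c 1 * m 1 0) • b (stdVec 0)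
        + (c 0 * m 0 1 + c 1 * m 1 1) • b (stdVec 1) := by module
      _ = 0 := by rw [e, e]; simp
  have h2 : c 0 • stdVec 0 + c 1 • stdVec 1 = (0 : E2) := hT (by rw [h1, map_zero])
  funext j
  have := congrArg (fun v : E2 ↦ v j) h2
  fin_cases j <;> simpa [stdVec] using this

lemma clm_det_eq (T : E2 →L[ℝ] E2) :
    T.det = (T (stdVec 0)) 0 * (T (stdVec 1)) 1 - (T (stdVec 1)) 0 * (T (stdVec 0)) 1 := by
  rw [ContinuousLinearMap.det, ← LinearMap.det_toMatrix (EuclideanSpace.basisFun (Fin 2) ℝ).toBasis,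
    Matrix.det_fin_two]
  simp [LinearMap.toMatrix_apply, stdVec, mul_comm]

/-- The Hermitian product of covectors can be computed in any basis. -/
lemma coInner_eq [RiemannianBundle (fun p : M ↦ TangentSpace (𝓡∂ 2) p)] (p : M)
    (α α' : TangentSpace (𝓡∂ 2) p →L[ℝ] ℂ) (v : Fin 2 → TangentSpace (𝓡∂ 2) p)
    (m : Matrix (Fin 2) (Fin 2) ℝ) (hv : ∀ i, v i = ∑ j, m i j • basisVec p j) (hm : m.det ≠ 0) :
    coInner p α α' = ∑ i, ∑ j,
      (((Matrix.of fun a b : Fin 2 ↦ (inner ℝ (v a) (v b) : ℝ))⁻¹ i j : ℝ) : ℂ)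
      * α (v i) * (starRingEnd ℂ) (α' (v j)) := by
  set G : Matrix (Fin 2) (Fin 2) ℝ :=
    Matrix.of fun a b : Fin 2 ↦ (inner ℝ (basisVec p a) (basisVec p b) : ℝ) with hG
  have h1 : (Matrix.of fun a b : Fin 2 ↦ (inner ℝ (v a) (v b) : ℝ)) = m * G * m.transpose := by
    ext a b
    rw [Matrix.of_apply, hv a, hv b]
    simp only [Fin.sum_univ_two, Matrix.mul_apply, Matrix.transpose_apply, hG, Matrix.of_apply,
      inner_add_left, inner_add_right, real_inner_smul_left, real_inner_smul_right]
    ring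
  have hmu : IsUnit m.det := hm.isUnit
  -- The new Gram matrix is m G mᵀ, so the inverse transforms contragrediently and the factors m are
  -- absorbed by the covectors.
  have h2 : G⁻¹ = m.transpose * (m * G * m.transpose)⁻¹ * m := by
    rw [Matrix.mul_inv_rev, Matrix.mul_inv_rev, Matrix.mul_nonsing_inv_cancel_left _ _
      (by rwa [Matrix.det_transpose]), Matrix.mul_assoc, Matrix.nonsing_inv_mul _ hmu,
      Matrix.mul_one]
  unfold coInner
  rw [← hG, h1, h2]
  set B := (m * G * m.transpose)⁻¹
  have hα (β : TangentSpace (𝓡∂ 2) p →L[ℝ] ℂ) (i : Fin 2) :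
      β (v i) = m i 0 * β (basisVec p 0) + m i 1 * β (basisVec p 1) := by
    rw [hv i, Fin.sum_univ_two, map_add, map_smul, map_smul]
    simp
  simp only [hα, Fin.sum_univ_two, Matrix.mul_apply, Matrix.transpose_apply, map_add, map_mul,
    Complex.conj_ofReal]
  push_cast
  ring

/-- A tangent vector as a vector of the model space. -/
def toE2 {p : M} (v : TangentSpace (𝓡∂ 2) p) : E2 := v

lemma vec_eq_sum_basisVec (ψ : E2 → M) (i : Fin 2) (z : E2) :
    vec ψ i z = ∑ j, (Matrix.of fun a b : Fin 2 ↦ toE2 (vec ψ a z) b) i j • basisVec (ψ z) j := by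
  rw [Fin.sum_univ_two]
  exact eq_sum_stdVec (toE2 (vec ψ i z))

/-- The matrix of the metric in a parametrization. -/
def metMat [RiemannianBundle (fun p : M ↦ TangentSpace (𝓡∂ 2) p)] (ψ : E2 → M) (z : E2) :
    Matrix (Fin 2) (Fin 2) ℝ :=
  Matrix.of fun i j ↦ met ψ i j z

lemma mfderiv_injective {ψ : E2 → M} {z : E2}
    (h : IsLocalDiffeomorphAt 𝓘(ℝ, E2) (𝓡∂ 2) ∞ ψ z) :
    Function.Injective (mfderiv 𝓘(ℝ, E2) (𝓡∂ 2) ψ z) :=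
  (h.mfderivToContinuousLinearEquiv (by simp)).injective

lemma frame_det_ne_zero {ψ : E2 → M} {z : E2}
    (h : IsLocalDiffeomorphAt 𝓘(ℝ, E2) (𝓡∂ 2) ∞ ψ z) :
    (Matrix.of fun a b : Fin 2 ↦ toE2 (vec ψ a z) b).det ≠ 0 := by
  refine det_of_injective (V := E2) (mfderiv 𝓘(ℝ, E2) (𝓡∂ 2) ψ z : E2 →L[ℝ] E2)
    (mfderiv_injective h) (LinearEquiv.refl ℝ E2) fun i ↦ ?_
  exact vec_eq_sum_basisVec ψ i z

lemma metMat_det_pos [RiemannianBundle (fun p : M ↦ TangentSpace (𝓡∂ 2) p)] {ψ : E2 → M} {z : E2}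
    (h : IsLocalDiffeomorphAt 𝓘(ℝ, E2) (𝓡∂ 2) ∞ ψ z) : 0 < (metMat ψ z).det := by
  have hli : LinearIndependent ℝ (fun i ↦ vec ψ i z) := by
    have h0 : LinearIndependent ℝ stdVec := by
      have e : stdVec = (EuclideanSpace.basisFun (Fin 2) ℝ).toBasis := by
        funext i
        simp [stdVec]
      rw [e]
      exact (EuclideanSpace.basisFun (Fin 2) ℝ).toBasis.linearIndependent
    exact h0.map' (mfderiv 𝓘(ℝ, E2) (𝓡∂ 2) ψ z).toLinearMap
      (LinearMap.ker_eq_bot.2 (mfderiv_injective h))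
  exact (Matrix.posDef_gram_of_linearIndependent hli).det_pos

variable {F : Type*} [NormedAddCommGroup F] [NormedSpace ℝ F]

/-- Derivatives of functions on the surface, computed in a parametrization. -/
lemma hasMFDerivAt_of_comp {ψ : E2 → M} {z : E2}
    (h : IsLocalDiffeomorphAt 𝓘(ℝ, E2) (𝓡∂ 2) ∞ ψ z) {f : M → F}
    (hf : DifferentiableAt ℝ (fun y ↦ f (ψ y)) z) :
    MDifferentiableAt (𝓡∂ 2) 𝓘(ℝ, F) f (ψ z) ∧
      ∀ i, mfderiv (𝓡∂ 2) 𝓘(ℝ, F) f (ψ z) (vec ψ i z) = pd i (fun y ↦ f (ψ y)) z := by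
  have hψ := h.mdifferentiableAt (by simp)
  have hd : MDifferentiableAt (𝓡∂ 2) 𝓘(ℝ, F) f (ψ z) := by
    have h1 := h.localInverse_mdifferentiableAt (by simp)
    have h0 : h.localInverse (ψ z) = z := h.localInverse_left_inv h.localInverse_mem_target
    have h2 : MDifferentiableAt (𝓡∂ 2) 𝓘(ℝ, F) ((fun y ↦ f (ψ y)) ∘ h.localInverse) (ψ z) :=
      MDifferentiableAt.comp (ψ z) (I' := 𝓘(ℝ, E2)) (by rw [h0]; exact hf.mdifferentiableAt) h1
    refine h2.congr_of_eventuallyEq ?_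
    filter_upwards [h.localInverse_eventuallyEq_right] with p hp
    exact (congrArg f hp).symm
  refine ⟨hd, fun i ↦ ?_⟩
  have h3 : mfderiv 𝓘(ℝ, E2) 𝓘(ℝ, F) (f ∘ ψ) z = _ := mfderiv_comp z hd hψ
  unfold vec pd
  rw [← mfderiv_eq_fderiv]
  exact (congrArg (fun T : E2 →L[ℝ] F ↦ T (stdVec i)) h3).symm

end Frames

/-! ### Transition maps and the field strength in a general parametrization. -/

section ChangeOfChart

variable {M : Type*} [TopologicalSpace M] [ChartedSpace (EuclideanHalfSpace 2) M]
  {ψ : E2 → M} {z : E2}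

/-- The transition map from a parametrization to a chart. -/
def trans (c : M) (ψ : E2 → M) (z : E2) : E2 := extChartAt (𝓡∂ 2) c (ψ z)

lemma interior_of_isLocalDiffeomorphAt (h : IsLocalDiffeomorphAt 𝓘(ℝ, E2) (𝓡∂ 2) ∞ ψ z) :
    ψ z ∈ (𝓡∂ 2).interior M :=
  (h.isInteriorPoint_iff (by simp)).1 (by simp [ModelWithCorners.IsInteriorPoint])

lemma eventuallyEq_pt_trans (h : IsLocalDiffeomorphAt 𝓘(ℝ, E2) (𝓡∂ 2) ∞ ψ z) {c : M}
    (hc : ψ z ∈ (extChartAt (𝓡∂ 2) c).source) : ψ =ᶠ[𝓝 z] fun y ↦ pt c (trans c ψ y) := by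
  have := h.contMDiffAt.continuousAt.preimage_mem_nhds
    ((isOpen_extChartAt_source (I := 𝓡∂ 2) c).mem_nhds hc)
  filter_upwards [this] with y hy
  exact ((extChartAt (𝓡∂ 2) c).left_inv hy).symm

/-- The Jacobian determinant of a map of the plane. -/
def jac (E : E2 → E2) (z : E2) : ℝ :=
  pd 0 (fun y ↦ E y 0) z * pd 1 (fun y ↦ E y 1) z - pd 1 (fun y ↦ E y 0) z * pd 0 (fun y ↦ E y 1) z

lemma det_fderiv_eq_jac {E : E2 → E2} {z : E2} (hE : DifferentiableAt ℝ E z) :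
    (fderiv ℝ E z).det = jac E z := by
  have h2 (i j : Fin 2) : pd i (fun y ↦ E y j) z = (fderiv ℝ E z (stdVec i)) j := by
    have : fderiv ℝ (fun y ↦ EuclideanSpace.proj (𝕜 := ℝ) j (E y)) z
      = (EuclideanSpace.proj (𝕜 := ℝ) j).comp (fderiv ℝ E z) :=
      ((EuclideanSpace.proj (𝕜 := ℝ) j).hasFDerivAt.comp z hE.hasFDerivAt).fderiv
    change fderiv ℝ (fun y ↦ EuclideanSpace.proj (𝕜 := ℝ) j (E y)) z (stdVec i) = _
    rw [this]; rfl
  rw [clm_det_eq, jac, h2, h2, h2, h2]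

lemma metMat_det_comp [RiemannianBundle (fun p : M ↦ TangentSpace (𝓡∂ 2) p)] {E : E2 → E2} (hψ : MDifferentiableAt 𝓘(ℝ, E2) (𝓡∂ 2) ψ (E z))
    (hE : DifferentiableAt ℝ E z) :
    (metMat (fun y ↦ ψ (E y)) z).det = jac E z ^ 2 * (metMat ψ (E z)).det := by
  simp only [Matrix.det_fin_two, metMat, Matrix.of_apply, met_comp hψ hE, jac]
  rw [met_symm ψ 1 0]
  ring

variable [IsManifold (𝓡∂ 2) ∞ M]

lemma mem_interior_target {c p : M} (hp : p ∈ (𝓡∂ 2).interior M)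
    (hc : p ∈ (extChartAt (𝓡∂ 2) c).source) :
    extChartAt (𝓡∂ 2) c p ∈ interior (extChartAt (𝓡∂ 2) c).target := by
  rw [extChartAt_source] at hc
  exact ((𝓡∂ 2).isInteriorPoint_iff_of_mem_atlas (n := ∞) (by simp) (chart_mem_atlas _ c) hc).1 hp

lemma range_mem_nhds {c p : M} (hp : p ∈ (𝓡∂ 2).interior M)
    (hc : p ∈ (extChartAt (𝓡∂ 2) c).source) :
    Set.range (𝓡∂ 2) ∈ 𝓝 (extChartAt (𝓡∂ 2) c p) :=
  mem_of_superset (mem_interior_iff_mem_nhds.1 (mem_interior_target hp hc))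
    (extChartAt_target_subset_range c)

lemma isLocalDiffeomorphAt_pt' {c p : M} (hp : p ∈ (𝓡∂ 2).interior M)
    (hc : p ∈ (extChartAt (𝓡∂ 2) c).source) :
    ContMDiffAt 𝓘(ℝ, E2) (𝓡∂ 2) ∞ (pt c) (extChartAt (𝓡∂ 2) c p) :=
  (contMDiffOn_extChartAt_symm c).contMDiffAt
    (mem_interior_iff_mem_nhds.1 (mem_interior_target hp hc))

lemma trans_contDiffAt (h : IsLocalDiffeomorphAt 𝓘(ℝ, E2) (𝓡∂ 2) ∞ ψ z) {c : M}
    (hc : ψ z ∈ (extChartAt (𝓡∂ 2) c).source) : ContDiffAt ℝ ∞ (trans c ψ) z := by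
  have h1 := contMDiffAt_extChartAt' (I := 𝓡∂ 2) (n := ∞) (x := c) (x' := ψ z)
    (by rwa [extChartAt_source] at hc)
  exact (h1.comp z h.contMDiffAt).contDiffAt

lemma cof_trans (h : IsLocalDiffeomorphAt 𝓘(ℝ, E2) (𝓡∂ 2) ∞ ψ z) {c : M}
    (hc : ψ z ∈ (extChartAt (𝓡∂ 2) c).source)
    (A : ∀ p : M, TangentSpace (𝓡∂ 2) p →L[ℝ] ℝ) (i : Fin 2) :
    cof A ψ i z = pd i (fun y ↦ trans c ψ y 0) z * cof A (pt c) 0 (trans c ψ z)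
      + pd i (fun y ↦ trans c ψ y 1) z * cof A (pt c) 1 (trans c ψ z) := by
  rw [cof_congr A (eventuallyEq_pt_trans h hc)]
  exact cof_comp A ((isLocalDiffeomorphAt_pt' (interior_of_isLocalDiffeomorphAt h)
    hc).mdifferentiableAt (by simp)) (smooth_diffAt (trans_contDiffAt h hc)) i

variable [RiemannianBundle (fun p : M ↦ TangentSpace (𝓡∂ 2) p)]

lemma metMat_det_trans (h : IsLocalDiffeomorphAt 𝓘(ℝ, E2) (𝓡∂ 2) ∞ ψ z) {c : M}
    (hc : ψ z ∈ (extChartAt (𝓡∂ 2) c).source) :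
    (metMat ψ z).det = jac (trans c ψ) z ^ 2 * (gram c (trans c ψ z)).det := by
  have hi := interior_of_isLocalDiffeomorphAt h
  have e1 : metMat ψ z = metMat (fun y ↦ pt c (trans c ψ y)) z := by
    ext i j
    exact met_congr (eventuallyEq_pt_trans h hc) i j
  have e2 : gram c (trans c ψ z) = metMat (pt c) (trans c ψ z) := by
    ext i j
    exact gram_eq_met (range_mem_nhds hi hc) i j
  rw [e1, e2]
  exact metMat_det_comp ((isLocalDiffeomorphAt_pt' hi hc).mdifferentiableAt (by simp))
    (smooth_diffAt (trans_contDiffAt h hc))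

/-- The strength at `ψ z` is defined in the chart preferred by `ψ z` itself, so the comparison goes
through the transition map to that chart. The curl is multiplied by its Jacobian and the area
density by the absolute value of the Jacobian; absolute values make the two factors agree. -/
lemma fieldStrength_sq (h : IsLocalDiffeomorphAt 𝓘(ℝ, E2) (𝓡∂ 2) ∞ ψ z)
    {A : ∀ p : M, TangentSpace (𝓡∂ 2) p →L[ℝ] ℝ} (hA : IsSmoothForm A) :
    |fieldStrength A (ψ z)| * √(metMat ψ z).det = |pd 0 (cof A ψ 1) z - pd 1 (cof A ψ 0) z| := by
  have hi := interior_of_isLocalDiffeomorphAt h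
  set q := ψ z with hq
  have hc : q ∈ (extChartAt (𝓡∂ 2) q).source := mem_extChartAt_source q
  have hr := range_mem_nhds hi hc
  set y := extChartAt (𝓡∂ 2) q q with hy
  have htz : trans q ψ z = y := rfl
  have hnear : ∀ᶠ w in 𝓝 z, IsLocalDiffeomorphAt 𝓘(ℝ, E2) (𝓡∂ 2) ∞ ψ w ∧
      ψ w ∈ (extChartAt (𝓡∂ 2) q).source := by
    refine Filter.Eventually.and ?_ (h.contMDiffAt.continuousAt.preimage_mem_nhds
      ((isOpen_extChartAt_source (I := 𝓡∂ 2) q).mem_nhds hc))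
    obtain ⟨Φ, hΦ, he⟩ := h
    filter_upwards [Φ.open_source.mem_nhds hΦ] with w hw using ⟨Φ, hw, he⟩
  have hτ := trans_contDiffAt h hc
  have hτd := smooth_diffAt hτ
  have hτj (j : Fin 2) : ContDiffAt ℝ ∞ (fun w ↦ trans q ψ w j) z :=
    (coord_contDiff j).contDiffAt.comp z hτ
  have hcof (j : Fin 2) : ContDiffAt ℝ ∞ (cof A (pt q) j) (trans q ψ z) :=
    cof_contDiffAt hA (isLocalDiffeomorphAt_pt' hi hc) j
  have hcofc (j : Fin 2) : ContDiffAt ℝ ∞ (fun w ↦ cof A (pt q) j (trans q ψ w)) z :=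
    (hcof j).comp z hτ
  have hpd (i j : Fin 2) : pd j (cof A ψ i) z =
      pd j (pd i (fun y ↦ trans q ψ y 0)) z * cof A (pt q) 0 (trans q ψ z)
      + pd i (fun y ↦ trans q ψ y 0) z * pd j (fun w ↦ cof A (pt q) 0 (trans q ψ w)) z
      + (pd j (pd i (fun y ↦ trans q ψ y 1)) z * cof A (pt q) 1 (trans q ψ z)
      + pd i (fun y ↦ trans q ψ y 1) z * pd j (fun w ↦ cof A (pt q) 1 (trans q ψ w)) z) := by
    have e : cof A ψ i =ᶠ[𝓝 z] fun w ↦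
        pd i (fun y ↦ trans q ψ y 0) w * cof A (pt q) 0 (trans q ψ w)
      + pd i (fun y ↦ trans q ψ y 1) w * cof A (pt q) 1 (trans q ψ w) := by
      filter_upwards [hnear] with w hw
      exact cof_trans hw.1 hw.2 A i
    have d0 := smooth_diffAt (pd_contDiffAt (hτj 0) i)
    have d1 := smooth_diffAt (pd_contDiffAt (hτj 1) i)
    have d2 := smooth_diffAt (hcofc 0)
    have d3 := smooth_diffAt (hcofc 1)
    rw [pd_congr_at e, pd_add (d0.fun_mul d2) (d1.fun_mul d3), pd_mul d0 d2, pd_mul d1 d3]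
  have hchain (i j : Fin 2) := pd_comp (F := ℝ) (smooth_diffAt (hcof j)) hτd i
  have hb : fieldStrength A q = (pd 0 (cof A (pt q) 1) y - pd 1 (cof A (pt q) 0) y)
      / √(gram q y).det := by
    have hev : ∀ᶠ w in 𝓝 y, Set.range (𝓡∂ 2) ∈ 𝓝 w := eventually_eventually_nhds.2 hr
    unfold fieldStrength
    rw [← hy, pderivIn_eq_pd hr, pderivIn_eq_pd hr]
    congr 2
    · exact pd_congr_at (hev.mono fun w hw ↦ formCoeff_eq_cof A hw 1) 0
    · exact pd_congr_at (hev.mono fun w hw ↦ formCoeff_eq_cof A hw 0) 1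
  have hdet := metMat_det_trans h hc
  have hpos := metMat_det_pos h
  have hgpos : 0 < (gram q y).det := by
    rw [hdet] at hpos
    exact pos_of_mul_pos_right hpos (sq_nonneg _)
  rw [hb, hdet, htz, Real.sqrt_mul (sq_nonneg _), Real.sqrt_sq_eq_abs, abs_div,
    abs_of_nonneg (Real.sqrt_nonneg _)]
  have hs : √(gram q y).det ≠ 0 := (Real.sqrt_pos.2 hgpos).ne'
  -- The second derivatives of the transition map cancel by symmetry, which is the invariance of the
  -- exterior derivative.
  have hcurl : pd 0 (cof A ψ 1) z - pd 1 (cof A ψ 0) z =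
      (pd 0 (cof A (pt q) 1) y - pd 1 (cof A (pt q) 0) y) * jac (trans q ψ) z := by
    rw [hpd, hpd, hchain, hchain, hchain, hchain, pd_comm (hτj 0) 0 1, pd_comm (hτj 1) 0 1, htz, jac]
    simp only [smul_eq_mul]
    ring
  rw [hcurl, abs_mul]
  field_simp

end ChangeOfChart

/-! ### The Riemannian area measure in a parametrization. -/

section Volume

variable {M : Type*} [TopologicalSpace M] [MeasurableSpace M] [BorelSpace M]
  [ChartedSpace (EuclideanHalfSpace 2) M]
  [RiemannianBundle (fun p : M ↦ TangentSpace (𝓡∂ 2) p)]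

lemma measurableSet_extChartAt_target (c : M) : MeasurableSet (extChartAt (𝓡∂ 2) c).target := by
  rw [extChartAt_target]
  exact ((chartAt (EuclideanHalfSpace 2) c).open_target.preimage
    (𝓡∂ 2).continuous_symm).measurableSet.inter (𝓡∂ 2).isClosed_range.measurableSet

lemma chartVolume_apply (c : M) {S : Set M} (hS : MeasurableSet S) :
    chartVolume c S = ∫⁻ y in pt c ⁻¹' S ∩ (extChartAt (𝓡∂ 2) c).target,
      ENNReal.ofReal √(gram c y).det := by
  have hm : AEMeasurable (extChartAt (𝓡∂ 2) c).symm
      ((volume.restrict (extChartAt (𝓡∂ 2) c).target).withDensity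
        fun y ↦ ENNReal.ofReal √(gram c y).det) :=
    ((continuousOn_extChartAt_symm c).aemeasurable (measurableSet_extChartAt_target c)).mono_ac
      (withDensity_absolutelyContinuous _ _)
  rw [chartVolume, Measure.map_apply_of_aemeasurable hm hS, withDensity_apply',
    Measure.restrict_restrict' (measurableSet_extChartAt_target c)]
  rfl

lemma measurableSet_source_inter_preimage (Φ : PartialDiffeomorph 𝓘(ℝ, E2) (𝓡∂ 2) E2 M ∞)
    {S : Set M} (hS : MeasurableSet S) : MeasurableSet (Φ.source ∩ Φ ⁻¹' S) := by
  have h1 : Measurable (Φ.source.domRestrict Φ) :=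
    (Φ.contMDiffOn.continuousOn.domRestrict).measurable
  have h2 := (MeasurableEmbedding.subtype_coe Φ.open_source.measurableSet).measurableSet_image.2
    (h1 hS)
  convert h2 using 1
  ext z
  simp [Set.domRestrict, and_comm]

variable [IsManifold (𝓡∂ 2) ∞ M]

/-- The volume measure of a chart, computed in a parametrization. -/
lemma chartVolume_eq_lintegral (Φ : PartialDiffeomorph 𝓘(ℝ, E2) (𝓡∂ 2) E2 M ∞) (c : M)
    {S : Set M} (hS : MeasurableSet S) (hSU : S ⊆ Φ.target) :
    chartVolume c S = ∫⁻ z in Φ.source ∩ Φ ⁻¹' (S ∩ (extChartAt (𝓡∂ 2) c).source),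
      ENNReal.ofReal √(metMat Φ z).det := by
  set D := Φ.source ∩ Φ ⁻¹' (S ∩ (extChartAt (𝓡∂ 2) c).source) with hD
  have hDm : MeasurableSet D := measurableSet_source_inter_preimage Φ
    (hS.inter (isOpen_extChartAt_source c).measurableSet)
  have hloc (z : E2) (hz : z ∈ D) : IsLocalDiffeomorphAt 𝓘(ℝ, E2) (𝓡∂ 2) ∞ Φ z :=
    Φ.isLocalDiffeomorphAt _ _ _ hz.1
  have himg : pt c ⁻¹' S ∩ (extChartAt (𝓡∂ 2) c).target = trans c Φ '' D := by
    ext y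
    constructor
    · rintro ⟨hy, hyt⟩
      have hsrc : pt c y ∈ (extChartAt (𝓡∂ 2) c).source := (extChartAt (𝓡∂ 2) c).map_target hyt
      refine ⟨Φ.symm (pt c y), ⟨Φ.map_target (hSU hy), ?_⟩, ?_⟩
      · have e : Φ.toFun (Φ.invFun (pt c y)) = pt c y := Φ.right_inv (hSU hy)
        change Φ.toFun (Φ.invFun (pt c y)) ∈ S ∩ (extChartAt (𝓡∂ 2) c).source
        rw [e]
        exact ⟨hy, hsrc⟩
      · have e : Φ.toFun (Φ.invFun (pt c y)) = pt c y := Φ.right_inv (hSU hy)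
        change extChartAt (𝓡∂ 2) c (Φ.toFun (Φ.invFun (pt c y))) = y
        rw [e]
        exact (extChartAt (𝓡∂ 2) c).right_inv hyt
    · rintro ⟨z, hz, rfl⟩
      refine ⟨?_, (extChartAt (𝓡∂ 2) c).map_source hz.2.2⟩
      change (extChartAt (𝓡∂ 2) c).symm (extChartAt (𝓡∂ 2) c (Φ z)) ∈ S
      rw [(extChartAt (𝓡∂ 2) c).left_inv hz.2.2]
      exact hz.2.1
  have hinj : Set.InjOn (trans c Φ) D := by
    intro z hz w hw hzw
    have := (extChartAt (𝓡∂ 2) c).injOn hz.2.2 hw.2.2 hzw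
    exact Φ.injOn hz.1 hw.1 this
  have hder (z : E2) (hz : z ∈ D) : DifferentiableAt ℝ (trans c Φ) z :=
    smooth_diffAt (trans_contDiffAt (hloc z hz) hz.2.2)
  rw [chartVolume_apply c hS, himg, lintegral_image_eq_lintegral_abs_det_fderiv_mul volume hDm
    (fun z hz ↦ (hder z hz).hasFDerivAt.hasFDerivWithinAt) hinj]
  -- The Jacobian of the transition map combines with the density of the chart to the density of the
  -- parametrization.
  refine setLIntegral_congr_fun hDm fun z hz ↦ ?_
  rw [det_fderiv_eq_jac (hder z hz), metMat_det_trans (hloc z hz) hz.2.2,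
    Real.sqrt_mul (sq_nonneg _), Real.sqrt_sq_eq_abs, ENNReal.ofReal_mul (abs_nonneg _)]

/-- A supremum of measures is not computed set by set. Here every chart measure lies below the
measure that is `chartVolume x` on `U` and infinite off `U`, hence so does the supremum, and off `U`
nothing is claimed. -/
lemma riemannianVolume_eq_chartVolume {U : Set M} (hU : MeasurableSet U) {x : M}
    (hle : ∀ (c : M) (S : Set M), MeasurableSet S → S ⊆ U → chartVolume c S ≤ chartVolume x S)
    {S : Set M} (hS : MeasurableSet S) (hSU : S ⊆ U) :
    riemannianVolume M S = chartVolume x S := by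
  apply le_antisymm
  · have h : riemannianVolume M ≤ (chartVolume x).restrict U + (⊤ : Measure M).restrict Uᶜ := by
      refine iSup_le fun c ↦ ?_
      rw [← Measure.restrict_add_restrict_compl (μ := chartVolume c) hU]
      refine add_le_add (Measure.le_iff.2 fun T hT ↦ ?_) (Measure.restrict_mono_measure le_top _)
      rw [Measure.restrict_apply hT, Measure.restrict_apply hT]
      exact hle c _ (hT.inter hU) Set.inter_subset_right
    refine (h S).trans ?_
    rw [Measure.add_apply, Measure.restrict_apply hS, Measure.restrict_apply hS,
      Set.inter_eq_left.2 hSU, Set.disjoint_iff_inter_eq_empty.1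
        (Set.disjoint_compl_right_iff_subset.2 hSU)]
    simp
  · exact (le_iSup (fun c : M ↦ chartVolume c) x) S

/-- The area measure in the coordinates of a parametrization. -/
def paramVolume (Φ : PartialDiffeomorph 𝓘(ℝ, E2) (𝓡∂ 2) E2 M ∞) : Measure E2 :=
  (volume.restrict Φ.source).withDensity fun z ↦ ENNReal.ofReal √(metMat Φ z).det

/-- When the whole target lies in the domain of one chart, that chart sees all of `S` while any
other sees at most a part of it; this is the domination required by
`riemannianVolume_eq_chartVolume`. -/
lemma riemannianVolume_eq_lintegral (Φ : PartialDiffeomorph 𝓘(ℝ, E2) (𝓡∂ 2) E2 M ∞) {x : M}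
    (hx : Φ.target ⊆ (extChartAt (𝓡∂ 2) x).source) {S : Set M} (hS : MeasurableSet S)
    (hSU : S ⊆ Φ.target) :
    riemannianVolume M S = ∫⁻ z in Φ.source ∩ Φ ⁻¹' S, ENNReal.ofReal √(metMat Φ z).det := by
  rw [riemannianVolume_eq_chartVolume (x := x) Φ.open_target.measurableSet ?_ hS hSU,
    chartVolume_eq_lintegral Φ x hS hSU, Set.inter_eq_left.2 (hSU.trans hx)]
  intro c T hT hTU
  rw [chartVolume_eq_lintegral Φ x hT hTU, chartVolume_eq_lintegral Φ c hT hTU,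
    Set.inter_eq_left.2 (hTU.trans hx)]
  exact lintegral_mono_set (by gcongr; exact Set.inter_subset_left)

lemma aemeasurable_symm (Φ : PartialDiffeomorph 𝓘(ℝ, E2) (𝓡∂ 2) E2 M ∞) (μ : Measure M) :
    AEMeasurable Φ.symm (μ.restrict Φ.target) :=
  (Φ.contMDiffOn_invFun.continuousOn).aemeasurable Φ.open_target.measurableSet

lemma map_symm_riemannianVolume (Φ : PartialDiffeomorph 𝓘(ℝ, E2) (𝓡∂ 2) E2 M ∞) {x : M}
    (hx : Φ.target ⊆ (extChartAt (𝓡∂ 2) x).source) :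
    Measure.map Φ.symm ((riemannianVolume M).restrict Φ.target) = paramVolume Φ := by
  have hc : ContinuousOn Φ.symm Φ.target := Φ.contMDiffOn_invFun.continuousOn
  ext B hB
  have hm : MeasurableSet (Φ.target ∩ Φ.symm ⁻¹' B) := by
    have h2 := (MeasurableEmbedding.subtype_coe Φ.open_target.measurableSet).measurableSet_image.2
      (hc.domRestrict.measurable hB)
    convert h2 using 1
    ext z
    simp [Set.domRestrict, and_comm]
  rw [Measure.map_apply_of_aemeasurable (aemeasurable_symm Φ _) hB,
    Measure.restrict_apply' Φ.open_target.measurableSet, Set.inter_comm,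
    riemannianVolume_eq_lintegral Φ hx hm Set.inter_subset_left, paramVolume, withDensity_apply _ hB,
    Measure.restrict_restrict hB]
  congr 2
  ext z
  constructor
  · rintro ⟨h1, h2, h3⟩
    have : Φ.invFun (Φ.toFun z) = z := Φ.left_inv h1
    refine ⟨?_, h1⟩
    rw [← this]; exact h3
  · rintro ⟨h1, h2⟩
    have : Φ.invFun (Φ.toFun z) = z := Φ.left_inv h2
    refine ⟨h2, Φ.map_source h2, ?_⟩
    change Φ.invFun (Φ.toFun z) ∈ B
    rwa [this]

/-- The function on the surface which is given by `w` in a parametrization, extended by zero. -/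
def push {F : Type*} [Zero F] (Φ : PartialDiffeomorph 𝓘(ℝ, E2) (𝓡∂ 2) E2 M ∞) (w : E2 → F) :
    M → F :=
  Φ.target.indicator (w ∘ Φ.symm)

lemma push_apply {F : Type*} [Zero F] (Φ : PartialDiffeomorph 𝓘(ℝ, E2) (𝓡∂ 2) E2 M ∞)
    (w : E2 → F) {z : E2} (hz : z ∈ Φ.source) : push Φ w (Φ z) = w z := by
  have : Φ.invFun (Φ.toFun z) = z := Φ.left_inv hz
  rw [push, Set.indicator_of_mem (Φ.map_source hz)]
  exact congrArg w this

variable {F : Type*} [NormedAddCommGroup F]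

lemma eLpNorm_push (Φ : PartialDiffeomorph 𝓘(ℝ, E2) (𝓡∂ 2) E2 M ∞) {x : M}
    (hx : Φ.target ⊆ (extChartAt (𝓡∂ 2) x).source) {w : E2 → F} (hw : Continuous w) :
    eLpNorm (push Φ w) 2 (riemannianVolume M) = eLpNorm w 2 (paramVolume Φ) := by
  rw [push, eLpNorm_indicator_eq_eLpNorm_restrict Φ.open_target.measurableSet,
    ← map_symm_riemannianVolume Φ hx, eLpNorm_map_measure hw.aestronglyMeasurable
      (aemeasurable_symm Φ _)]

variable [IsContMDiffRiemannianBundle (𝓡∂ 2) ∞ E2 (fun p : M ↦ TangentSpace (𝓡∂ 2) p)]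

lemma metMat_det_contDiffAt {ψ : E2 → M} {z : E2} (h : ContMDiffAt 𝓘(ℝ, E2) (𝓡∂ 2) ∞ ψ z) :
    ContDiffAt ℝ ∞ (fun y ↦ (metMat ψ y).det) z := by
  have hm := met_contDiffAt h
  simp only [Matrix.det_fin_two, metMat, Matrix.of_apply]
  exact ((hm 0 0).mul (hm 1 1)).sub ((hm 0 1).mul (hm 1 0))

lemma integral_push [NormedSpace ℝ F] (Φ : PartialDiffeomorph 𝓘(ℝ, E2) (𝓡∂ 2) E2 M ∞) {x : M}
    (hx : Φ.target ⊆ (extChartAt (𝓡∂ 2) x).source) {f : M → F} {w : E2 → F}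
    (hw : ContinuousOn w Φ.source)
    (hf : ∀ p ∉ Φ.target, f p = 0) (hfw : ∀ z ∈ Φ.source, f (Φ z) = w z) :
    ∫ p, f p ∂(riemannianVolume M) = ∫ z in Φ.source, √(metMat Φ z).det • w z := by
  have hdet : ContinuousOn (fun y ↦ (metMat Φ y).det) Φ.source := fun z hz ↦
    (metMat_det_contDiffAt (Φ.contMDiffOn.contMDiffAt
      (Φ.open_source.mem_nhds hz))).continuousAt.continuousWithinAt
  rw [← setIntegral_eq_integral_of_forall_compl_eq_zero (s := Φ.target) hf]
  have e : Set.EqOn f (w ∘ Φ.symm) Φ.target := by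
    intro p hp
    have h1 : Φ.toFun (Φ.invFun p) = p := Φ.right_inv hp
    have h2 := hfw (Φ.invFun p) (Φ.map_target hp)
    change f (Φ.toFun (Φ.invFun p)) = _ at h2
    rwa [h1] at h2
  rw [setIntegral_congr_fun Φ.open_target.measurableSet e]
  have hmap := map_symm_riemannianVolume Φ hx
  have hms : AEStronglyMeasurable w (paramVolume Φ) :=
    (hw.aestronglyMeasurable Φ.open_source.measurableSet).mono_ac
      (withDensity_absolutelyContinuous _ _)
  rw [← hmap] at hms
  have h3 := integral_map (aemeasurable_symm Φ (riemannianVolume M)) hms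
  change ∫ p in Φ.target, w (Φ.symm p) ∂_ = _
  rw [← h3, hmap, paramVolume, integral_withDensity_eq_integral_toReal_smul₀]
  · refine setIntegral_congr_fun Φ.open_source.measurableSet fun z _ ↦ ?_
    simp only [ENNReal.toReal_ofReal (Real.sqrt_nonneg _)]
  · exact (hdet.sqrt.aemeasurable Φ.open_source.measurableSet).ennreal_ofReal
  · exact .of_forall fun z ↦ ENNReal.ofReal_lt_top

end Volume

/-! ### The magnetic Laplacian in coordinates and integration by parts. -/

section PlaneOperator

/-- The component `ih∂ᵢ + aᵢ` of the magnetic derivative in coordinates. -/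
def planeD (h : ℝ) (a : E2 → ℝ) (i : Fin 2) (u : E2 → ℂ) (z : E2) : ℂ :=
  Complex.I * h * pd i u z + a z * u z

/-- The magnetic Laplacian in coordinates; `ρ` is the area density and `G = ρ g⁻¹`. -/
def planeH (h : ℝ) (ρ : E2 → ℝ) (G : Fin 2 → Fin 2 → E2 → ℝ) (a : Fin 2 → E2 → ℝ) (u : E2 → ℂ)
    (z : E2) : ℂ :=
  ((ρ z)⁻¹ : ℝ) * ∑ i, planeD h (a i) i (fun y ↦ ∑ j, (G i j y : ℂ) * planeD h (a j) j u y) z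

lemma contDiffAt_ofReal {f : E2 → ℝ} {z : E2} (hf : ContDiffAt ℝ ∞ f z) :
    ContDiffAt ℝ ∞ (fun y ↦ (f y : ℂ)) z :=
  Complex.ofRealCLM.contDiff.contDiffAt.comp z hf

lemma planeD_contDiffAt {h : ℝ} {a : E2 → ℝ} {u : E2 → ℂ} {z : E2} (ha : ContDiffAt ℝ ∞ a z)
    (hu : ContDiffAt ℝ ∞ u z) (i : Fin 2) : ContDiffAt ℝ ∞ (planeD h a i u) z :=
  (contDiffAt_const.mul (pd_contDiffAt hu i)).add ((contDiffAt_ofReal ha).mul hu)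

lemma planeD_eq_zero {h : ℝ} {a : E2 → ℝ} {u : E2 → ℂ} {z : E2} (hu : u =ᶠ[𝓝 z] 0) (i : Fin 2) :
    planeD h a i u =ᶠ[𝓝 z] 0 := by
  filter_upwards [hu, pd_congr hu i] with y h1 h2
  have h3 : pd i (0 : E2 → ℂ) y = 0 := pd_const 0 i y
  simp [planeD, h1, h2, h3]

lemma planeH_contDiffAt {h : ℝ} {ρ : E2 → ℝ} {G : Fin 2 → Fin 2 → E2 → ℝ} {a : Fin 2 → E2 → ℝ}
    {u : E2 → ℂ} {z : E2} (hρ : ContDiffAt ℝ ∞ ρ z) (hρ0 : ρ z ≠ 0)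
    (hG : ∀ i j, ContDiffAt ℝ ∞ (G i j) z) (ha : ∀ i, ContDiffAt ℝ ∞ (a i) z)
    (hu : ContDiffAt ℝ ∞ u z) : ContDiffAt ℝ ∞ (planeH h ρ G a u) z :=
  (contDiffAt_ofReal (hρ.inv hρ0)).mul (ContDiffAt.sum fun i _ ↦ planeD_contDiffAt (ha i)
    (ContDiffAt.sum fun j _ ↦ (contDiffAt_ofReal (hG i j)).mul (planeD_contDiffAt (ha j) hu j)) i)

lemma flux_eq_zero {h : ℝ} {G : Fin 2 → E2 → ℝ} {a : Fin 2 → E2 → ℝ}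
    {u : E2 → ℂ} {z : E2} (hu : u =ᶠ[𝓝 z] 0) :
    (fun y ↦ ∑ j, (G j y : ℂ) * planeD h (a j) j u y) =ᶠ[𝓝 z] 0 := by
  filter_upwards [planeD_eq_zero (h := h) (a := a 0) hu 0,
    planeD_eq_zero (h := h) (a := a 1) hu 1] with y h0 h1
  simp [Fin.sum_univ_two, h0, h1]

lemma planeH_eq_zero {h : ℝ} {ρ : E2 → ℝ} {G : Fin 2 → Fin 2 → E2 → ℝ} {a : Fin 2 → E2 → ℝ}
    {u : E2 → ℂ} {z : E2} (hu : u =ᶠ[𝓝 z] 0) : planeH h ρ G a u =ᶠ[𝓝 z] 0 := by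
  have h0 := planeD_eq_zero (h := h) (a := a 0) (flux_eq_zero (h := h) (G := G 0) (a := a) hu) 0
  have h1 := planeD_eq_zero (h := h) (a := a 1) (flux_eq_zero (h := h) (G := G 1) (a := a) hu) 1
  filter_upwards [h0, h1] with y h0 h1
  rw [planeH, Fin.sum_univ_two, h0, h1]
  simp

/-- A function which is smooth on an open set, and supported there. -/
structure SuppIn (V : Set E2) (w : E2 → ℂ) : Prop where
  smooth : ContDiff ℝ ∞ w
  compact : HasCompactSupport w
  subset : tsupport w ⊆ V

lemma eventuallyEq_zero_of_notMem {w : E2 → ℂ} {z : E2} (hz : z ∉ tsupport w) : w =ᶠ[𝓝 z] 0 :=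
  notMem_tsupport_iff_eventuallyEq.1 hz

/-- Applied to differential expressions in `w` whose coefficients are smooth on `V` only: being
local, they vanish wherever `w` vanishes locally, so the behaviour of the coefficients off `V` does
not matter. -/
lemma SuppIn.of_local {V : Set E2} {w u : E2 → ℂ} (hw : SuppIn V w)
    (hs : ∀ z ∈ V, ContDiffAt ℝ ∞ u z) (h0 : ∀ z, w =ᶠ[𝓝 z] 0 → u =ᶠ[𝓝 z] 0) : SuppIn V u := by
  have hsub : tsupport u ⊆ tsupport w := fun z hz ↦ by
    by_contra hn
    exact notMem_tsupport_iff_eventuallyEq.2 (h0 z (eventuallyEq_zero_of_notMem hn)) hz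
  refine ⟨contDiff_iff_contDiffAt.2 fun z ↦ ?_, hw.compact.mono' (subset_closure.trans hsub),
    hsub.trans hw.subset⟩
  by_cases hz : z ∈ tsupport w
  · exact hs z (hw.subset hz)
  · exact contDiffAt_const.congr_of_eventuallyEq (h0 z (eventuallyEq_zero_of_notMem hz))

lemma SuppIn.continuous_mul {V : Set E2} (hV : IsOpen V) {w g : E2 → ℂ} (hw : SuppIn V w)
    (hg : ContinuousOn g V) : Continuous (fun z ↦ w z * g z) := by
  refine continuous_iff_continuousAt.2 fun z ↦ ?_
  by_cases hz : z ∈ tsupport w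
  · exact hw.smooth.continuous.continuousAt.mul (hg.continuousAt (hV.mem_nhds (hw.subset hz)))
  · have : (fun z ↦ w z * g z) =ᶠ[𝓝 z] fun _ ↦ 0 := by
      filter_upwards [eventuallyEq_zero_of_notMem hz] with y hy
      simp [hy]
    exact continuousAt_const.congr this.symm

lemma SuppIn.integrable_mul {V : Set E2} (hV : IsOpen V) {w g : E2 → ℂ} (hw : SuppIn V w)
    (hg : ContinuousOn g V) : Integrable (fun z ↦ w z * g z) :=
  (hw.continuous_mul hV hg).integrable_of_hasCompactSupport (hw.compact.mul_right)

/-- Integration by parts for the magnetic derivative. -/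
lemma integral_planeD {V : Set E2} (hV : IsOpen V) {X v : E2 → ℂ} (hX : SuppIn V X)
    {a : E2 → ℝ} (ha : ∀ z ∈ V, ContDiffAt ℝ ∞ a z) (hv : ∀ z ∈ V, ContDiffAt ℝ ∞ v z) (h : ℝ)
    (i : Fin 2) :
    ∫ z, X z * (starRingEnd ℂ) (planeD h a i v z)
      = ∫ z, planeD h a i X z * (starRingEnd ℂ) (v z) := by
  have hc : ContinuousOn v V := fun z hz ↦ (hv z hz).continuousAt.continuousWithinAt
  have hac : ContinuousOn a V := fun z hz ↦ (ha z hz).continuousAt.continuousWithinAt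
  have hvs (z : E2) (hz : z ∈ V) : ContDiffAt ℝ ∞ (fun y ↦ (starRingEnd ℂ) (v y)) z :=
    (Complex.conjCLE.contDiff (n := ∞)).contDiffAt.comp z (hv z hz)
  have hvc : ContinuousOn (fun y ↦ (starRingEnd ℂ) (v y)) V :=
    fun z hz ↦ (hvs z hz).continuousAt.continuousWithinAt
  have hpd (z : E2) (hz : z ∈ V) :
      pd i (fun y ↦ (starRingEnd ℂ) (v y)) z = (starRingEnd ℂ) (pd i v z) := by
    have := (Complex.conjCLE.toContinuousLinearMap.hasFDerivAt (x := v z)).comp z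
      (smooth_diffAt (hv z hz)).hasFDerivAt
    unfold pd
    exact congrArg (fun T : E2 →L[ℝ] ℂ ↦ T (stdVec i)) this.fderiv
  have hpc : ContinuousOn (pd i (fun y ↦ (starRingEnd ℂ) (v y))) V :=
    fun z hz ↦ (pd_contDiffAt (hvs z hz) i).continuousAt.continuousWithinAt
  have hpX : SuppIn V (pd i X) := hX.of_local (fun z _ ↦ pd_contDiffAt hX.smooth.contDiffAt i)
    fun z hz ↦ (pd_congr hz i).trans (.of_forall fun y ↦ by exact pd_const 0 i y)
  -- The operator ih∂ is symmetric: conjugation changes the sign of i and integration by parts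
  -- restores it. Compact support of `X` removes boundary terms, although `v` need not have support
  -- in `V`.
  have ibp := integral_mul_fderiv_eq_neg_fderiv_mul_of_integrable (𝕜 := ℂ) (μ := volume)
    (f := X) (g := fun y ↦ (starRingEnd ℂ) (v y)) (v := stdVec i)
    (hpX.integrable_mul hV hvc) (hX.integrable_mul hV hpc) (hX.integrable_mul hV hvc)
    (fun z _ ↦ hX.smooth.differentiable (by simp) z)
    (fun z hz ↦ smooth_diffAt (hvs z (hX.subset hz)))
  have i1 : Integrable (fun z ↦ X z * pd i (fun y ↦ (starRingEnd ℂ) (v y)) z) :=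
    hX.integrable_mul hV hpc
  have i2 : Integrable (fun z ↦ X z * ((a z : ℂ) * (starRingEnd ℂ) (v z))) :=
    hX.integrable_mul hV ((Complex.continuous_ofReal.comp_continuousOn hac).mul hvc)
  have i3 : Integrable (fun z ↦ pd i X z * (starRingEnd ℂ) (v z)) := hpX.integrable_mul hV hvc
  have e1 : ∫ z, X z * (starRingEnd ℂ) (planeD h a i v z) =
      ∫ z, ((-(Complex.I * h)) * (X z * pd i (fun y ↦ (starRingEnd ℂ) (v y)) z)
        + X z * ((a z : ℂ) * (starRingEnd ℂ) (v z))) := by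
    congr 1
    funext z
    by_cases hz : z ∈ V
    · rw [hpd z hz]
      simp only [planeD, map_add, map_mul, Complex.conj_I, Complex.conj_ofReal]
      ring
    · have : X z = 0 := image_eq_zero_of_notMem_tsupport fun hn ↦ hz (hX.subset hn)
      simp [this]
  have e2 : ∫ z, planeD h a i X z * (starRingEnd ℂ) (v z) =
      ∫ z, ((Complex.I * h) * (pd i X z * (starRingEnd ℂ) (v z))
        + X z * ((a z : ℂ) * (starRingEnd ℂ) (v z))) := by
    congr 1
    funext z
    simp only [planeD]
    ring
  rw [e1, e2, integral_add (i1.const_mul _) i2, integral_add (i3.const_mul _) i2,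
    integral_const_mul, integral_const_mul]
  have : ∫ z, X z * pd i (fun y ↦ (starRingEnd ℂ) (v y)) z =
      -∫ z, pd i X z * (starRingEnd ℂ) (v z) := ibp
  rw [this]
  ring

end PlaneOperator

/-! ### Transplanting functions and the operator from the plane to the surface. -/

section Transfer

variable {M : Type*} [TopologicalSpace M] [T2Space M]
  [ChartedSpace (EuclideanHalfSpace 2) M]

/-- In a Hausdorff surface the compact image of the support is closed, so extension by zero creates
no new support points; this gives smoothness across the edge of `Φ.target`. -/
lemma tsupport_push (Φ : PartialDiffeomorph 𝓘(ℝ, E2) (𝓡∂ 2) E2 M ∞) {w : E2 → ℂ}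
    (hw : SuppIn Φ.source w) : tsupport (push Φ w) ⊆ Φ '' tsupport w ∧
      IsCompact (Φ '' tsupport w) := by
  have hc : IsCompact (Φ '' tsupport w) :=
    hw.compact.isCompact.image_of_continuousOn (Φ.contMDiffOn.continuousOn.mono hw.subset)
  refine ⟨closure_minimal (fun p hp ↦ ?_) hc.isClosed, hc⟩
  have hpt : p ∈ Φ.target := by
    by_contra hn
    exact hp (Set.indicator_of_notMem hn _)
  rw [Function.mem_support, push, Set.indicator_of_mem hpt] at hp
  exact ⟨Φ.invFun p, subset_closure hp, Φ.right_inv hpt⟩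

lemma isTestFunction_push (Φ : PartialDiffeomorph 𝓘(ℝ, E2) (𝓡∂ 2) E2 M ∞) {w : E2 → ℂ}
    (hw : SuppIn Φ.source w) : IsTestFunction (push Φ w) := by
  obtain ⟨h1, h2⟩ := tsupport_push Φ hw
  have h3 : Φ '' tsupport w ⊆ Φ.target := by
    rintro _ ⟨z, hz, rfl⟩
    exact Φ.map_source (hw.subset hz)
  refine ⟨contMDiff_of_tsupport fun p hp ↦ ?_, h2.of_isClosed_subset (isClosed_tsupport _) h1, ?_⟩
  · have hpt := Φ.open_target.mem_nhds (h3 (h1 hp))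
    have hs : ContMDiffAt (𝓡∂ 2) 𝓘(ℝ, ℂ) ∞ (w ∘ Φ.symm) p :=
      hw.smooth.contMDiff.contMDiffAt.comp p (Φ.contMDiffOn_invFun.contMDiffAt hpt)
    refine hs.congr_of_eventuallyEq ?_
    filter_upwards [hpt] with q hq
    rw [push, Set.indicator_of_mem hq]
  · intro p hp
    obtain ⟨z, hz, rfl⟩ := h1 hp
    exact interior_of_isLocalDiffeomorphAt (Φ.isLocalDiffeomorphAt _ _ _ (hw.subset hz))

variable [MeasurableSpace M] [BorelSpace M]
  [IsManifold (𝓡∂ 2) ∞ M] [RiemannianBundle (fun p : M ↦ TangentSpace (𝓡∂ 2) p)]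
  [IsContMDiffRiemannianBundle (𝓡∂ 2) ∞ E2 (fun p : M ↦ TangentSpace (𝓡∂ 2) p)]

/-- The area density in a parametrization. -/
def dens (ψ : E2 → M) (z : E2) : ℝ := √(metMat ψ z).det

/-- The inverse metric times the area density in a parametrization. -/
def coMet (ψ : E2 → M) (i j : Fin 2) (z : E2) : ℝ := dens ψ z * (metMat ψ z)⁻¹ i j

lemma dens_pos {ψ : E2 → M} {z : E2} (h : IsLocalDiffeomorphAt 𝓘(ℝ, E2) (𝓡∂ 2) ∞ ψ z) :
    0 < dens ψ z := Real.sqrt_pos.2 (metMat_det_pos h)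

lemma dens_contDiffAt {ψ : E2 → M} {z : E2} (h : IsLocalDiffeomorphAt 𝓘(ℝ, E2) (𝓡∂ 2) ∞ ψ z) :
    ContDiffAt ℝ ∞ (dens ψ) z :=
  (metMat_det_contDiffAt h.contMDiffAt).sqrt (metMat_det_pos h).ne'

lemma metMat_inv (ψ : E2 → M) (z : E2) :
    (metMat ψ z)⁻¹ 0 0 = ((metMat ψ z).det)⁻¹ * met ψ 1 1 z ∧
    (metMat ψ z)⁻¹ 0 1 = -(((metMat ψ z).det)⁻¹ * met ψ 0 1 z) ∧
    (metMat ψ z)⁻¹ 1 0 = -(((metMat ψ z).det)⁻¹ * met ψ 0 1 z) ∧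
    (metMat ψ z)⁻¹ 1 1 = ((metMat ψ z).det)⁻¹ * met ψ 0 0 z := by
  rw [Matrix.inv_def, Ring.inverse_eq_inv', Matrix.adjugate_fin_two]
  simp [metMat, met_symm ψ 1 0]

lemma metMat_inv_contDiffAt {ψ : E2 → M} {z : E2}
    (h : IsLocalDiffeomorphAt 𝓘(ℝ, E2) (𝓡∂ 2) ∞ ψ z) (i j : Fin 2) :
    ContDiffAt ℝ ∞ (fun y ↦ (metMat ψ y)⁻¹ i j) z := by
  have hd := (metMat_det_contDiffAt h.contMDiffAt).inv (metMat_det_pos h).ne'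
  have hm := met_contDiffAt h.contMDiffAt
  fin_cases i <;> fin_cases j
  · exact (hd.mul (hm 1 1)).congr_of_eventuallyEq (.of_forall fun y ↦ (metMat_inv ψ y).1)
  · exact (hd.mul (hm 0 1)).neg.congr_of_eventuallyEq (.of_forall fun y ↦ (metMat_inv ψ y).2.1)
  · exact (hd.mul (hm 0 1)).neg.congr_of_eventuallyEq (.of_forall fun y ↦ (metMat_inv ψ y).2.2.1)
  · exact (hd.mul (hm 0 0)).congr_of_eventuallyEq (.of_forall fun y ↦ (metMat_inv ψ y).2.2.2)

lemma coMet_contDiffAt {ψ : E2 → M} {z : E2} (h : IsLocalDiffeomorphAt 𝓘(ℝ, E2) (𝓡∂ 2) ∞ ψ z)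
    (i j : Fin 2) : ContDiffAt ℝ ∞ (coMet ψ i j) z :=
  (dens_contDiffAt h).mul (metMat_inv_contDiffAt h i j)

lemma coMet_symm (ψ : E2 → M) (i j : Fin 2) : coMet ψ i j = coMet ψ j i := by
  funext z
  unfold coMet
  congr 1
  fin_cases i <;> fin_cases j
  · rfl
  · exact (metMat_inv ψ z).2.1.trans (metMat_inv ψ z).2.2.1.symm
  · exact (metMat_inv ψ z).2.2.1.trans (metMat_inv ψ z).2.1.symm
  · rfl

variable (Φ : PartialDiffeomorph 𝓘(ℝ, E2) (𝓡∂ 2) E2 M ∞)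

lemma magneticD_vec {h : ℝ} {A : ∀ p : M, TangentSpace (𝓡∂ 2) p →L[ℝ] ℝ} {v : M → ℂ} {ψ : E2 → M}
    {z : E2} (hψ : IsLocalDiffeomorphAt 𝓘(ℝ, E2) (𝓡∂ 2) ∞ ψ z)
    (hv : DifferentiableAt ℝ (fun y ↦ v (ψ y)) z) (i : Fin 2) :
    magneticD h A v (ψ z) (vec ψ i z) = planeD h (cof A ψ i) i (fun y ↦ v (ψ y)) z := by
  have h1 := (hasMFDerivAt_of_comp hψ hv).2 i
  unfold planeD
  rw [← h1]
  simp only [magneticD, cof]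
  change (Complex.I * (h : ℂ)) • _ + (v (ψ z)) • ((A (ψ z) (vec ψ i z) : ℝ) : ℂ) = _
  simp only [smul_eq_mul]
  rw [mul_comm (v (ψ z))]
  rfl

lemma magneticD_eq_zero {h : ℝ} {A : ∀ p : M, TangentSpace (𝓡∂ 2) p →L[ℝ] ℝ} {v : M → ℂ} {p : M}
    (hv : v =ᶠ[𝓝 p] fun _ ↦ 0) : magneticD h A v p = 0 := by
  have h1 : mfderiv (𝓡∂ 2) 𝓘(ℝ, ℂ) v p = mfderiv (𝓡∂ 2) 𝓘(ℝ, ℂ) (fun _ ↦ (0 : ℂ)) p :=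
    hv.mfderiv_eq
  rw [mfderiv_const] at h1
  have h2 : v p = 0 := hv.eq_of_nhds
  have key (T B : E2 →L[ℝ] ℂ) (c : ℂ) (hT : T = 0) (hc : c = 0) :
      (Complex.I * (h : ℂ)) • T + c • B = 0 := by
    subst hT hc
    ext w
    change Complex.I * (h : ℂ) * 0 + 0 * B w = 0
    ring
  exact key _ _ _ h1 h2

/-- The magnetic Laplacian of a function which is supported in a parametrized region. -/
lemma isMagneticLaplacian_push {x : M} (hx : Φ.target ⊆ (extChartAt (𝓡∂ 2) x).source)
    {A : ∀ p : M, TangentSpace (𝓡∂ 2) p →L[ℝ] ℝ} (hA : IsSmoothForm A) (h : ℝ) {w : E2 → ℂ}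
    (hw : SuppIn Φ.source w) :
    SuppIn Φ.source (planeH h (dens Φ) (coMet Φ) (cof A Φ) w) ∧
    IsMagneticLaplacian h A (push Φ w) (push Φ (planeH h (dens Φ) (coMet Φ) (cof A Φ) w)) := by
  have hloc (z : E2) (hz : z ∈ Φ.source) : IsLocalDiffeomorphAt 𝓘(ℝ, E2) (𝓡∂ 2) ∞ Φ z :=
    Φ.isLocalDiffeomorphAt _ _ _ hz
  have ha (i : Fin 2) (z : E2) (hz : z ∈ Φ.source) : ContDiffAt ℝ ∞ (cof A Φ i) z :=
    cof_contDiffAt hA (hloc z hz).contMDiffAt i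
  have hH : SuppIn Φ.source (planeH h (dens Φ) (coMet Φ) (cof A Φ) w) :=
    hw.of_local (fun z hz ↦ planeH_contDiffAt (dens_contDiffAt (hloc z hz))
      (dens_pos (hloc z hz)).ne' (coMet_contDiffAt (hloc z hz)) (fun i ↦ ha i z hz)
      hw.smooth.contDiffAt) fun z hz ↦ planeH_eq_zero hz
  refine ⟨hH, isTestFunction_push Φ hH, fun v hv ↦ ?_⟩
  set X : Fin 2 → E2 → ℂ := fun i y ↦ ∑ j, (coMet Φ i j y : ℂ) * planeD h (cof A Φ j) j w y with hXdef
  have hX (i : Fin 2) : SuppIn Φ.source (X i) :=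
    hw.of_local (fun z hz ↦ ContDiffAt.sum fun j _ ↦
      (contDiffAt_ofReal (coMet_contDiffAt (hloc z hz) i j)).mul
        (planeD_contDiffAt (ha j z hz) hw.smooth.contDiffAt j)) fun z hz ↦ flux_eq_zero hz
  have hvs (z : E2) (hz : z ∈ Φ.source) : ContDiffAt ℝ ∞ (fun y ↦ v (Φ y)) z :=
    (hv.smooth.contMDiffAt.comp z (hloc z hz).contMDiffAt).contDiffAt
  have hvc : ContinuousOn (fun z ↦ (starRingEnd ℂ) (v (Φ z))) Φ.source := fun z hz ↦
    (Complex.continuous_conj.continuousAt.comp (hvs z hz).continuousAt).continuousWithinAt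
  have hDv (i : Fin 2) : ContinuousOn
      (fun z ↦ (starRingEnd ℂ) (planeD h (cof A Φ i) i (fun y ↦ v (Φ y)) z)) Φ.source := fun z hz ↦
    (Complex.continuous_conj.continuousAt.comp
      (planeD_contDiffAt (ha i z hz) (hvs z hz) i).continuousAt).continuousWithinAt
  have hsrc := Φ.open_source
  have hρc : ContinuousOn (dens Φ) Φ.source := fun z hz ↦
    (dens_contDiffAt (hloc z hz)).continuousAt.continuousWithinAt
  have hoff (p : M) (hp : p ∉ Φ.target) : push Φ w =ᶠ[𝓝 p] fun _ ↦ 0 := by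
    refine notMem_tsupport_iff_eventuallyEq.1 fun hn ↦ hp ?_
    obtain ⟨z, hz, rfl⟩ := (tsupport_push Φ hw).1 hn
    exact Φ.map_source (hw.subset hz)
  have hpush (z : E2) (hz : z ∈ Φ.source) : (fun y ↦ push Φ w (Φ y)) =ᶠ[𝓝 z] w := by
    filter_upwards [hsrc.mem_nhds hz] with y hy using push_apply Φ w hy
  -- The factor ρ⁻¹ of `planeH` cancels the area density and leaves the divergence form, ready for
  -- integration by parts.
  have lhs : ∫ p, push Φ (planeH h (dens Φ) (coMet Φ) (cof A Φ) w) p * (starRingEnd ℂ) (v p)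
      ∂(riemannianVolume M)
      = ∫ z in Φ.source, ∑ i, planeD h (cof A Φ i) i (X i) z * (starRingEnd ℂ) (v (Φ z)) := by
    rw [integral_push Φ hx (w := fun z ↦ planeH h (dens Φ) (coMet Φ) (cof A Φ) w z
      * (starRingEnd ℂ) (v (Φ z))) (hH.smooth.continuous.continuousOn.mul hvc)]
    · refine setIntegral_congr_fun hsrc.measurableSet fun z hz ↦ ?_
      have hne : ((dens Φ z : ℝ) : ℂ) ≠ 0 := by exact_mod_cast (dens_pos (hloc z hz)).ne'
      change ((dens Φ z : ℝ) : ℂ) * (((((dens Φ z)⁻¹ : ℝ) : ℂ) *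
        ∑ i, planeD h (cof A Φ i) i (X i) z) * _) = _
      rw [← Finset.sum_mul]
      push_cast
      field_simp
    · intro p hp
      simp [push, hp]
    · intro z hz
      rw [push_apply Φ _ hz]
  have rhs : ∫ p, coInner p (magneticD h A (push Φ w) p) (magneticD h A v p) ∂(riemannianVolume M)
      = ∫ z in Φ.source, ∑ i, X i z *
        (starRingEnd ℂ) (planeD h (cof A Φ i) i (fun y ↦ v (Φ y)) z) := by
    rw [integral_push Φ hx (w := fun z ↦ ∑ i, ∑ j, (((metMat Φ z)⁻¹ i j : ℝ) : ℂ) *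
      planeD h (cof A Φ i) i w z *
        (starRingEnd ℂ) (planeD h (cof A Φ j) j (fun y ↦ v (Φ y)) z))]
    · refine setIntegral_congr_fun hsrc.measurableSet fun z hz ↦ ?_
      -- `coInner` pairs component i of the first argument with component j of the second, whereas
      -- the flux `X i` carries component j; symmetry of the inverse metric reconciles them.
      have hs : (metMat Φ z)⁻¹ 1 0 = (metMat Φ z)⁻¹ 0 1 :=
        (metMat_inv Φ z).2.2.1.trans (metMat_inv Φ z).2.1.symm
      simp only [hXdef, coMet, Fin.sum_univ_two, hs]
      change ((dens Φ z : ℝ) : ℂ) * _ = _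
      push_cast
      ring
    · refine continuousOn_finsetSum _ fun i _ ↦ continuousOn_finsetSum _ fun j _ ↦
        ContinuousOn.mul (ContinuousOn.mul (fun z hz ↦ ?_) fun z hz ↦ ?_) (hDv j)
      · exact (contDiffAt_ofReal
          (metMat_inv_contDiffAt (hloc z hz) i j)).continuousAt.continuousWithinAt
      · exact (planeD_contDiffAt (ha i z hz)
          hw.smooth.contDiffAt i).continuousAt.continuousWithinAt
    · intro p hp
      rw [magneticD_eq_zero (hoff p hp)]
      simp [coInner]
    · intro z hz
      rw [coInner_eq (Φ z) _ _ (fun i ↦ vec Φ i z) _ (fun i ↦ vec_eq_sum_basisVec Φ i z)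
        (frame_det_ne_zero (hloc z hz))]
      have e1 (i : Fin 2) : magneticD h A (push Φ w) (Φ z) (vec Φ i z)
          = planeD h (cof A Φ i) i w z := by
        rw [magneticD_vec (hloc z hz) ((smooth_diffAt hw.smooth.contDiffAt).congr_of_eventuallyEq
          (hpush z hz))]
        simp only [planeD]
        rw [pd_congr_at (hpush z hz), push_apply Φ w hz]
      have e2 (i : Fin 2) := magneticD_vec (h := h) (A := A) (hloc z hz) (smooth_diffAt (hvs z hz)) i
      simp only [e1, e2]
      rfl
  rw [lhs, rhs, integral_finsetSum, integral_finsetSum]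
  · refine Finset.sum_congr rfl fun i _ ↦ ?_
    have hdX : SuppIn Φ.source (planeD h (cof A Φ i) i (X i)) :=
      (hX i).of_local (fun z hz ↦ planeD_contDiffAt (ha i z hz) (hX i).smooth.contDiffAt i)
        fun z hz ↦ planeD_eq_zero hz i
    rw [setIntegral_eq_integral_of_forall_compl_eq_zero,
      setIntegral_eq_integral_of_forall_compl_eq_zero]
    · exact (integral_planeD hsrc (hX i) (ha i) hvs h i).symm
    · intro z hz
      rw [image_eq_zero_of_notMem_tsupport fun hn ↦ hz ((hX i).subset hn), zero_mul]
    · intro z hz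
      rw [image_eq_zero_of_notMem_tsupport fun hn ↦ hz (hdX.subset hn), zero_mul]
  · exact fun i _ ↦ ((hX i).integrable_mul hsrc (hDv i)).integrableOn
  · intro i _
    have hdX : SuppIn Φ.source (planeD h (cof A Φ i) i (X i)) :=
      (hX i).of_local (fun z hz ↦ planeD_contDiffAt (ha i z hz) (hX i).smooth.contDiffAt i)
        fun z hz ↦ planeD_eq_zero hz i
    exact (hdX.integrable_mul hsrc hvc).integrableOn

end Transfer

/-! ### Killing the first derivatives of the metric; the curvature as the remaining invariant. -/

section NormalForm

lemma HasJet.of_eq {f : E2 → ℝ} {c l0 l1 q00 q01 q11 c' l0' l1' q00' q01' q11' : ℝ}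
    (h : HasJet f c l0 l1 q00 q01 q11) (e1 : c = c') (e2 : l0 = l0') (e3 : l1 = l1')
    (e4 : q00 = q00') (e5 : q01 = q01') (e6 : q11 = q11') :
    HasJet f c' l0' l1' q00' q01' q11' := by
  subst e1 e2 e3 e4 e5 e6; exact h

lemma hasJet_quadPoly (c l0 l1 q00 q01 q11 : ℝ) :
    HasJet (quadPoly c l0 l1 q00 q01 q11) c l0 l1 q00 q01 q11 :=
  (Van.zero 3).congr (.of_forall fun z ↦ by simp)

/-- A homogeneous cubic polynomial. -/
def cubPoly (a b c d : ℝ) (z : E2) : ℝ :=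
  a * (z 0 * z 0 * z 0) + b * (z 0 * z 0 * z 1) + c * (z 0 * z 1 * z 1) + d * (z 1 * z 1 * z 1)

lemma cubPoly_contDiff (a b c d : ℝ) : ContDiff ℝ ∞ (cubPoly a b c d) := by
  have h0 := coord_contDiff 0
  have h1 := coord_contDiff 1
  unfold cubPoly
  fun_prop

lemma van_cubPoly (a b c d : ℝ) : Van 3 (cubPoly a b c d) := by
  have h0 := Van.coord 0
  have h1 := Van.coord 1
  exact ((((h0.mul h0).mul h0).const_mul a).add (((h0.mul h0).mul h1).const_mul b)).add
    (((h0.mul h1).mul h1).const_mul c) |>.add (((h1.mul h1).mul h1).const_mul d)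

lemma pd_cubPoly (a b c d : ℝ) :
    pd 0 (cubPoly a b c d) = quadPoly 0 0 0 (6 * a) (2 * b) (2 * c) ∧
    pd 1 (cubPoly a b c d) = quadPoly 0 0 0 (2 * b) (2 * c) (6 * d) := by
  constructor
  all_goals
    funext z
    have h0 : DifferentiableAt ℝ (fun z : E2 ↦ z 0) z :=
      (coord_contDiff 0).differentiable (by simp) z
    have h1 : DifferentiableAt ℝ (fun z : E2 ↦ z 1) z :=
      (coord_contDiff 1).differentiable (by simp) z
    unfold cubPoly
    rw [pd_add (by fun_prop) (by fun_prop), pd_add (by fun_prop) (by fun_prop),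
      pd_add (by fun_prop) (by fun_prop), pd_const_mul _ (by fun_prop),
      pd_const_mul _ (by fun_prop), pd_const_mul _ (by fun_prop), pd_const_mul _ (by fun_prop)]
    repeat rw [pd_mul (by fun_prop) (by fun_prop)]
    rw [pd_coord, pd_coord]
    simp [quadPoly]
    ring

/-- The map of the plane with components `f` and `g`. -/
def planeMap (f g : E2 → ℝ) (z : E2) : E2 := !₂[f z, g z]

@[simp] lemma planeMap_zero (f g : E2 → ℝ) (z : E2) : planeMap f g z 0 = f z := rfl
@[simp] lemma planeMap_one (f g : E2 → ℝ) (z : E2) : planeMap f g z 1 = g z := rfl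

lemma planeMap_contDiff {f g : E2 → ℝ} (hf : ContDiff ℝ ∞ f) (hg : ContDiff ℝ ∞ g) :
    ContDiff ℝ ∞ (planeMap f g) := by
  refine (contDiff_euclidean (𝕜 := ℝ)).2 fun i ↦ ?_
  fin_cases i
  · exact hf
  · exact hg

lemma isLocalDiffeomorphAt_of_jac {E : E2 → E2} (hE : ContDiff ℝ ∞ E) {z : E2} (hj : jac E z ≠ 0) :
    IsLocalDiffeomorphAt 𝓘(ℝ, E2) 𝓘(ℝ, E2) ∞ E z := by
  have hd := hE.differentiable (by simp) z
  rw [← det_fderiv_eq_jac hd] at hj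
  refine isLocalDiffeomorphAt_of_hasFDerivAt hE
    (L := (fderiv ℝ E z).toContinuousLinearEquivOfDetNeZero hj) ?_
  exact hd.hasFDerivAt

variable {M : Type*} [TopologicalSpace M] [T2Space M] [MeasurableSpace M] [BorelSpace M]
  [ChartedSpace (EuclideanHalfSpace 2) M]
  [IsManifold (𝓡∂ 2) ∞ M] [RiemannianBundle (fun p : M ↦ TangentSpace (𝓡∂ 2) p)]
  [IsContMDiffRiemannianBundle (𝓡∂ 2) ∞ E2 (fun p : M ↦ TangentSpace (𝓡∂ 2) p)]

lemma eventually_isLocalDiffeomorphAt {ψ : E2 → M} {z : E2}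
    (h : IsLocalDiffeomorphAt 𝓘(ℝ, E2) (𝓡∂ 2) ∞ ψ z) :
    ∀ᶠ w in 𝓝 z, IsLocalDiffeomorphAt 𝓘(ℝ, E2) (𝓡∂ 2) ∞ ψ w := by
  obtain ⟨Φ, hΦ, he⟩ := h
  filter_upwards [Φ.open_source.mem_nhds hΦ] with w hw using ⟨Φ, hw, he⟩

lemma met_comp_eventually {ψ : E2 → M} (h : IsLocalDiffeomorphAt 𝓘(ℝ, E2) (𝓡∂ 2) ∞ ψ 0)
    {E : E2 → E2} (hE : ContDiff ℝ ∞ E) (hE0 : E 0 = 0) (i j : Fin 2) :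
    (fun z ↦ pd i (fun y ↦ E y 0) z * pd j (fun y ↦ E y 0) z * met ψ 0 0 (E z)
      + (pd i (fun y ↦ E y 0) z * pd j (fun y ↦ E y 1) z
        + pd i (fun y ↦ E y 1) z * pd j (fun y ↦ E y 0) z) * met ψ 0 1 (E z)
      + pd i (fun y ↦ E y 1) z * pd j (fun y ↦ E y 1) z * met ψ 1 1 (E z)) =ᶠ[𝓝 0]
      met (fun y ↦ ψ (E y)) i j := by
  have hc : Tendsto E (𝓝 0) (𝓝 0) := by simpa [hE0] using hE.continuous.tendsto 0
  filter_upwards [hc.eventually (eventually_isLocalDiffeomorphAt h)] with z hz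
  exact (met_comp (hz.mdifferentiableAt (by simp)) (hE.differentiable (by simp) z) i j).symm

/-- The Christoffel symbols in a parametrization. -/
def gam (ψ : E2 → M) (k i j : Fin 2) (z : E2) : ℝ :=
  (1 / 2) * ∑ l, (metMat ψ z)⁻¹ k l *
    (pd i (met ψ j l) z + pd j (met ψ i l) z - pd l (met ψ i j) z)

lemma gam_contDiffAt {ψ : E2 → M} {z : E2} (h : IsLocalDiffeomorphAt 𝓘(ℝ, E2) (𝓡∂ 2) ∞ ψ z)
    (k i j : Fin 2) : ContDiffAt ℝ ∞ (gam ψ k i j) z := by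
  have hm (i j l : Fin 2) : ContDiffAt ℝ ∞ (pd l (met ψ i j)) z :=
    pd_contDiffAt (met_contDiffAt h.contMDiffAt i j) l
  exact contDiffAt_const.mul (ContDiffAt.sum fun l _ ↦
    (metMat_inv_contDiffAt h k l).mul (((hm j l i).add (hm i l j)).sub (hm i j l)))

lemma gam_symm (ψ : E2 → M) (k i j : Fin 2) : gam ψ k i j = gam ψ k j i := by
  funext z
  simp only [gam, met_symm ψ i j, Fin.sum_univ_two]
  ring

/-- The Levi-Civita connection is metric. -/
lemma pd_met {ψ : E2 → M} {z : E2} (h : IsLocalDiffeomorphAt 𝓘(ℝ, E2) (𝓡∂ 2) ∞ ψ z)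
    (a b c : Fin 2) : pd a (met ψ b c) z =
      met ψ c 0 z * gam ψ 0 a b z + met ψ c 1 z * gam ψ 1 a b z
        + (met ψ b 0 z * gam ψ 0 a c z + met ψ b 1 z * gam ψ 1 a c z) := by
  have hD := (metMat_det_pos h).ne'
  have e : (metMat ψ z).det = met ψ 0 0 z * met ψ 1 1 z - met ψ 0 1 z * met ψ 0 1 z := by
    rw [Matrix.det_fin_two, metMat]
    simp [met_symm ψ 1 0]
  -- Lowering the upper index cancels the inverse metric and leaves Christoffel symbols of the first
  -- kind, two of which add up to the derivative of the metric.
  have key (m i j : Fin 2) : met ψ m 0 z * gam ψ 0 i j z + met ψ m 1 z * gam ψ 1 i j z =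
      (1 / 2) * (pd i (met ψ j m) z + pd j (met ψ i m) z - pd m (met ψ i j) z) := by
    simp only [gam, Fin.sum_univ_two, (metMat_inv ψ z).1, (metMat_inv ψ z).2.1,
      (metMat_inv ψ z).2.2.1, (metMat_inv ψ z).2.2.2]
    fin_cases m
    · simp only [Fin.zero_eta, Fin.isValue]
      field_simp
      rw [e]
      ring
    · simp only [Fin.mk_one, Fin.isValue, met_symm ψ 1 0]
      field_simp
      rw [e]
      ring
  rw [key, key, met_symm ψ c b]
  ring

/-- The scalar curvature computed from the Christoffel symbols of a parametrization at the
origin. -/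
def scal (ψ : E2 → M) : ℝ :=
  ∑ j, ∑ k, (metMat ψ 0)⁻¹ j k * ∑ i, (pd i (gam ψ i j k) 0 - pd k (gam ψ i i j) 0
    + ∑ l, (gam ψ i i l 0 * gam ψ l j k 0 - gam ψ i k l 0 * gam ψ l i j 0))

lemma pd_translate {F : Type*} [NormedAddCommGroup F] [NormedSpace ℝ F] (f : E2 → F) (y z : E2)
    (i : Fin 2) : pd i (fun w ↦ f (y + w)) z = pd i f (y + z) := by
  unfold pd
  rw [fderiv_comp_add_left]

/-- The preferred parametrization around an interior point. -/
lemma exists_chart_param {x : M} (hx : x ∈ (𝓡∂ 2).interior M) :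
    ∃ ψ : E2 → M, IsLocalDiffeomorphAt 𝓘(ℝ, E2) (𝓡∂ 2) ∞ ψ 0 ∧ ψ 0 = x ∧
      scal ψ = scalarCurvature x := by
  set y := extChartAt (𝓡∂ 2) x x with hy
  let E : E2 → E2 := fun z ↦ y + z
  have hE : ContDiff ℝ ∞ E := contDiff_const.add contDiff_id
  have hE0 : E 0 = y := add_zero y
  have hEl : IsLocalDiffeomorphAt 𝓘(ℝ, E2) 𝓘(ℝ, E2) ∞ E 0 :=
    isLocalDiffeomorphAt_of_hasFDerivAt hE (L := ContinuousLinearEquiv.refl ℝ E2)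
      ((hasFDerivAt_id (0 : E2)).const_add y)
  have hr : ∀ᶠ w in 𝓝 y, Set.range (𝓡∂ 2) ∈ 𝓝 w :=
    eventually_eventually_nhds.2 (mem_interior_iff_mem_nhds.1 hx)
  have hpt : IsLocalDiffeomorphAt 𝓘(ℝ, E2) (𝓡∂ 2) ∞ (pt x) y := isLocalDiffeomorphAt_pt hx
  have hpt' : IsLocalDiffeomorphAt 𝓘(ℝ, E2) (𝓡∂ 2) ∞ (pt x) (E 0) := hE0.symm ▸ hpt
  refine ⟨fun z ↦ pt x (E z), IsLocalDiffeomorphAt.comp (hf := hEl) (hg := hpt'), ?_, ?_⟩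
  · change pt x (E 0) = x
    rw [hE0]
    exact extChartAt_to_inv x
  have hvec (w : E2) (hw : IsLocalDiffeomorphAt 𝓘(ℝ, E2) (𝓡∂ 2) ∞ (pt x) (E w)) (i j : Fin 2) :
      met (fun z ↦ pt x (E z)) i j w = met (pt x) i j (E w) := by
    have hcoord (i j : Fin 2) : pd i (fun z ↦ E z j) w = if i = j then 1 else 0 := by
      have := pd_translate (fun v : E2 ↦ v j) y w i
      rw [pd_coord] at this
      exact this
    rw [met_comp (hw.mdifferentiableAt (by simp)) (hE.differentiable (by simp) w)]
    simp only [hcoord]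
    fin_cases i <;> fin_cases j <;> simp [met_symm (pt x) 1 0]
  have hnear : ∀ᶠ w in 𝓝 (0 : E2), (IsLocalDiffeomorphAt 𝓘(ℝ, E2) (𝓡∂ 2) ∞ (pt x) (E w)) ∧
      Set.range (𝓡∂ 2) ∈ 𝓝 (E w) := by
    have hc : Tendsto E (𝓝 0) (𝓝 y) := by simpa [hE0] using hE.continuous.tendsto 0
    exact hc.eventually ((eventually_isLocalDiffeomorphAt hpt).and hr)
  have hmet : ∀ᶠ w in 𝓝 (0 : E2), ∀ i j, gram x (E w) i j = met (fun z ↦ pt x (E z)) i j w := by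
    filter_upwards [hnear] with w hw i j
    rw [gram_eq_met hw.2, hvec w hw.1]
  have hpd : ∀ᶠ w in 𝓝 (0 : E2), ∀ l i j, pderivIn l (fun z ↦ gram x z i j) (E w)
      = pd l (met (fun z ↦ pt x (E z)) i j) w := by
    filter_upwards [hmet.eventually_nhds, hnear] with w hw hw2 l i j
    rw [pderivIn_eq_pd hw2.2, ← pd_translate (fun z ↦ gram x z i j) y w]
    exact pd_congr_at (hw.mono fun v hv ↦ hv i j) l
  have hgam : ∀ᶠ w in 𝓝 (0 : E2), ∀ k i j, christoffel x k i j (E w)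
      = gam (fun z ↦ pt x (E z)) k i j w := by
    filter_upwards [hmet, hpd] with w hw hw2 k i j
    have e : gram x (E w) = metMat (fun z ↦ pt x (E z)) w := by
      ext i j; exact hw i j
    simp only [christoffel, gam, hw2, e]
  have hpg (l k i j : Fin 2) : pderivIn l (christoffel x k i j) y
      = pd l (gam (fun z ↦ pt x (E z)) k i j) 0 := by
    rw [pderivIn_eq_pd hr.self_of_nhds]
    have := pd_translate (christoffel x k i j) y 0 l
    rw [add_zero] at this
    rw [← this]
    exact pd_congr_at (hgam.mono fun v hv ↦ hv k i j) l
  have e0 : gram x y = metMat (fun z ↦ pt x (E z)) 0 := by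
    ext i j; rw [← hE0]; exact hmet.self_of_nhds i j
  have g0 (k i j : Fin 2) : christoffel x k i j y = gam (fun z ↦ pt x (E z)) k i j 0 := by
    rw [← hE0]; exact hgam.self_of_nhds k i j
  simp only [scal, scalarCurvature, ← hy, e0, ricci, hpg, g0]

/-- Coordinates in which the first derivatives of the metric vanish at the origin. -/
lemma exists_param_of_scal {ψ : E2 → M} (h : IsLocalDiffeomorphAt 𝓘(ℝ, E2) (𝓡∂ 2) ∞ ψ 0) :
    ∃ φ : E2 → M, IsLocalDiffeomorphAt 𝓘(ℝ, E2) (𝓡∂ 2) ∞ φ 0 ∧ φ 0 = ψ 0 ∧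
      ∃ e f g p00 p01 p11 q00 q01 q11 r00 r01 r11 : ℝ,
        HasJet (met φ 0 0) e 0 0 p00 p01 p11 ∧ HasJet (met φ 0 1) f 0 0 q00 q01 q11 ∧
        HasJet (met φ 1 1) g 0 0 r00 r01 r11 ∧
        2 * q01 - p11 - r00 = scal ψ * (e * g - f * f) := by
  have hne := eventually_isLocalDiffeomorphAt h
  -- The second-order part of geodesic normal coordinates, z^k - ½ Γ^k_ij z^i z^j; it makes the
  -- Christoffel symbols vanish at the origin.
  let Q (k : Fin 2) : E2 → ℝ := quadPoly 0 (if k = 0 then 1 else 0) (if k = 1 then 1 else 0)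
    (-gam ψ k 0 0 0) (-gam ψ k 0 1 0) (-gam ψ k 1 1 0)
  let E : E2 → E2 := planeMap (Q 0) (Q 1)
  have hE : ContDiff ℝ ∞ E := planeMap_contDiff (quadPoly_contDiff ..) (quadPoly_contDiff ..)
  have hE0 : E 0 = 0 := by ext i; fin_cases i <;> simp [E, Q, quadPoly]
  have hj0 : HasJet (fun z ↦ E z 0) 0 1 0 (-gam ψ 0 0 0 0) (-gam ψ 0 0 1 0) (-gam ψ 0 1 1 0) :=
    (hasJet_quadPoly ..)
  have hj1 : HasJet (fun z ↦ E z 1) 0 0 1 (-gam ψ 1 0 0 0) (-gam ψ 1 0 1 0) (-gam ψ 1 1 1 0) :=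
    (hasJet_quadPoly ..)
  have d00 : HasJet (pd 0 (fun z ↦ E z 0)) 1 (-gam ψ 0 0 0 0) (-gam ψ 0 0 1 0) 0 0 0 :=
    (hasJet_quadPoly _ _ _ 0 0 0).congr (.of_forall fun z ↦ by
      change _ = pd 0 (Q 0) z
      rw [(pd_quadPoly ..).1]; simp [quadPoly])
  have d10 : HasJet (pd 1 (fun z ↦ E z 0)) 0 (-gam ψ 0 0 1 0) (-gam ψ 0 1 1 0) 0 0 0 :=
    (hasJet_quadPoly _ _ _ 0 0 0).congr (.of_forall fun z ↦ by
      change _ = pd 1 (Q 0) z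
      rw [(pd_quadPoly ..).2]; simp [quadPoly])
  have d01 : HasJet (pd 0 (fun z ↦ E z 1)) 0 (-gam ψ 1 0 0 0) (-gam ψ 1 0 1 0) 0 0 0 :=
    (hasJet_quadPoly _ _ _ 0 0 0).congr (.of_forall fun z ↦ by
      change _ = pd 0 (Q 1) z
      rw [(pd_quadPoly ..).1]; simp [quadPoly])
  have d11 : HasJet (pd 1 (fun z ↦ E z 1)) 1 (-gam ψ 1 0 1 0) (-gam ψ 1 1 1 0) 0 0 0 :=
    (hasJet_quadPoly _ _ _ 0 0 0).congr (.of_forall fun z ↦ by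
      change _ = pd 1 (Q 1) z
      rw [(pd_quadPoly ..).2]; simp [quadPoly])
  have hjac : jac E 0 ≠ 0 := by
    rw [jac, ((hasJet_iff d00.contDiffAt).1 d00).1, ((hasJet_iff d10.contDiffAt).1 d10).1,
      ((hasJet_iff d11.contDiffAt).1 d11).1]
    simp
  have hm (i j : Fin 2) : ContDiffAt ℝ ∞ (met ψ i j) 0 := met_contDiffAt h.contMDiffAt i j
  have hgd (k i j : Fin 2) := smooth_diffAt (gam_contDiffAt h k i j)
  have hmd (i j : Fin 2) := smooth_diffAt (hm i j)
  -- first and second derivatives of the metric in terms of the Christoffel symbols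
  have e1 (a b c : Fin 2) := pd_met h a b c
  have e2 (d a b c : Fin 2) : pd d (pd a (met ψ b c)) 0 =
      pd d (met ψ c 0) 0 * gam ψ 0 a b 0 + met ψ c 0 0 * pd d (gam ψ 0 a b) 0
      + (pd d (met ψ c 1) 0 * gam ψ 1 a b 0 + met ψ c 1 0 * pd d (gam ψ 1 a b) 0)
      + (pd d (met ψ b 0) 0 * gam ψ 0 a c 0 + met ψ b 0 0 * pd d (gam ψ 0 a c) 0
      + (pd d (met ψ b 1) 0 * gam ψ 1 a c 0 + met ψ b 1 0 * pd d (gam ψ 1 a c) 0)) := by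
    rw [pd_congr_at (hne.mono fun z hz ↦ pd_met hz a b c) d,
      pd_add (by fun_prop) (by fun_prop), pd_add (by fun_prop) (by fun_prop),
      pd_add (by fun_prop) (by fun_prop),
      pd_mul (hmd _ _) (hgd _ _ _), pd_mul (hmd _ _) (hgd _ _ _),
      pd_mul (hmd _ _) (hgd _ _ _), pd_mul (hmd _ _) (hgd _ _ _)]
  have c00 := pd_comm (hm 0 0) 0 1
  have c01 := pd_comm (hm 0 1) 0 1
  have c11 := pd_comm (hm 1 1) 0 1
  have hcmp (i j : Fin 2) := (hasJet_self (hm i j)).comp hE hj0 hj1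
  have hc : Tendsto E (𝓝 0) (𝓝 0) := by simpa [hE0] using hE.continuous.tendsto 0
  have hφ : IsLocalDiffeomorphAt 𝓘(ℝ, E2) (𝓡∂ 2) ∞ (fun z ↦ ψ (E z)) 0 :=
    IsLocalDiffeomorphAt.comp (hf := isLocalDiffeomorphAt_of_jac hE hjac) (hg := hE0.symm ▸ h)
  have hdet := (metMat_det_pos h).ne'
  have ed : (metMat ψ 0).det = met ψ 0 0 0 * met ψ 1 1 0 - met ψ 0 1 0 * met ψ 0 1 0 := by
    rw [Matrix.det_fin_two, metMat]
    simp [met_symm ψ 1 0]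
  have s01 := met_symm ψ 1 0
  have g01 (k : Fin 2) := gam_symm ψ k 1 0
  have J00 := (((d00.mul d00).mul (hcmp 0 0)).add (((d00.mul d01).add (d01.mul d00)).mul
    (hcmp 0 1))).add ((d01.mul d01).mul (hcmp 1 1))
  have J01 := (((d00.mul d10).mul (hcmp 0 0)).add (((d00.mul d11).add (d01.mul d10)).mul
    (hcmp 0 1))).add ((d01.mul d11).mul (hcmp 1 1))
  have J11 := (((d10.mul d10).mul (hcmp 0 0)).add (((d10.mul d11).add (d11.mul d10)).mul
    (hcmp 0 1))).add ((d11.mul d11).mul (hcmp 1 1))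
  replace J00 := J00.congr (met_comp_eventually h hE hE0 0 0)
  replace J01 := J01.congr (met_comp_eventually h hE hE0 0 1)
  replace J11 := J11.congr (met_comp_eventually h hE hE0 1 1)
  refine ⟨fun z ↦ ψ (E z), hφ, by simp [hE0], met ψ 0 0 0, met ψ 0 1 0, met ψ 1 1 0,
    _, _, _, _, _, _, _, _, _,
    J00.of_eq ?_ ?_ ?_ rfl rfl rfl, J01.of_eq ?_ ?_ ?_ rfl rfl rfl,
    J11.of_eq ?_ ?_ ?_ rfl rfl rfl, ?_⟩
  iterate 9
    try simp only [e1, s01, g01]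
    ring
  have hinv := metMat_inv ψ 0
  simp only [scal, Fin.sum_univ_two, hinv.1, hinv.2.1, hinv.2.2.1, hinv.2.2.2]
  simp only [e2, e1, s01, g01] at c00 c01 c11 ⊢
  rw [← ed]
  field_simp
  -- With all second derivatives of the metric expressed through derivatives of Γ, the equality of
  -- the mixed second derivatives of g₀₁ is the one relation still needed.
  linear_combination c01

end NormalForm

/-! ### Orthonormal frame with prescribed normal, and the Fermi form of the metric. -/

section NormalFrame

variable {M : Type*} [TopologicalSpace M] [T2Space M] [MeasurableSpace M] [BorelSpace M]
  [ChartedSpace (EuclideanHalfSpace 2) M]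
  [IsManifold (𝓡∂ 2) ∞ M] [RiemannianBundle (fun p : M ↦ TangentSpace (𝓡∂ 2) p)]
  [IsContMDiffRiemannianBundle (𝓡∂ 2) ∞ E2 (fun p : M ↦ TangentSpace (𝓡∂ 2) p)]

/-- The coordinates of a tangent vector in the frame of a parametrization. -/
lemma exists_coords {ψ : E2 → M} {z : E2} (h : IsLocalDiffeomorphAt 𝓘(ℝ, E2) (𝓡∂ 2) ∞ ψ z)
    (v : TangentSpace (𝓡∂ 2) (ψ z)) : ∃ a b : ℝ, v = a • vec ψ 0 z + b • vec ψ 1 z := by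
  obtain ⟨w, hw⟩ := (h.mfderivToContinuousLinearEquiv (by simp)).surjective v
  let w' : E2 := w
  refine ⟨w' 0, w' 1, ?_⟩
  rw [← hw]
  exact clm_apply_eq (mfderiv 𝓘(ℝ, E2) (𝓡∂ 2) ψ z) w'

/-- A linear change of coordinates makes the frame at the origin orthonormal, with a prescribed
second vector. -/
lemma exists_param_orthonormal {φ : E2 → M} (h : IsLocalDiffeomorphAt 𝓘(ℝ, E2) (𝓡∂ 2) ∞ φ 0)
    {N : ∀ p : M, TangentSpace (𝓡∂ 2) p} (hN : ‖N (φ 0)‖ = 1)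
    {e f g p00 p01 p11 q00 q01 q11 r00 r01 r11 R : ℝ}
    (h00 : HasJet (met φ 0 0) e 0 0 p00 p01 p11) (h01 : HasJet (met φ 0 1) f 0 0 q00 q01 q11)
    (h11 : HasJet (met φ 1 1) g 0 0 r00 r01 r11)
    (hR : 2 * q01 - p11 - r00 = R * (e * g - f * f)) :
    ∃ χ : E2 → M, IsLocalDiffeomorphAt 𝓘(ℝ, E2) (𝓡∂ 2) ∞ χ 0 ∧ χ 0 = φ 0 ∧
      vec χ 1 0 = N (χ 0) ∧
      ∃ p00 p01 p11 q00 q01 q11 r00 r01 r11 : ℝ,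
        HasJet (met χ 0 0) 1 0 0 p00 p01 p11 ∧ HasJet (met χ 0 1) 0 0 0 q00 q01 q11 ∧
        HasJet (met χ 1 1) 1 0 0 r00 r01 r11 ∧ 2 * q01 - p11 - r00 = R := by
  obtain ⟨n0, n1, hn⟩ := exists_coords h (N (φ 0))
  have e0 : met φ 0 0 0 = e := ((hasJet_iff h00.contDiffAt).1 h00).1
  have f0 : met φ 0 1 0 = f := ((hasJet_iff h01.contDiffAt).1 h01).1
  have g0 : met φ 1 1 0 = g := ((hasJet_iff h11.contDiffAt).1 h11).1
  have hD : 0 < e * g - f * f := by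
    have := metMat_det_pos h
    rw [Matrix.det_fin_two, metMat] at this
    simpa [met_symm φ 1 0, e0, f0, g0] using this
  have hunit : e * n0 ^ 2 + 2 * f * (n0 * n1) + g * n1 ^ 2 = 1 := by
    have : (inner ℝ (N (φ 0)) (N (φ 0)) : ℝ) = 1 := by
      rw [real_inner_self_eq_norm_sq, hN]; norm_num
    rw [hn] at this
    simp only [inner_add_left, inner_add_right, real_inner_smul_left, real_inner_smul_right] at this
    have a1 : (inner ℝ (vec φ 0 0) (vec φ 0 0) : ℝ) = e := e0
    have a2 : (inner ℝ (vec φ 0 0) (vec φ 1 0) : ℝ) = f := f0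
    have a3 : (inner ℝ (vec φ 1 0) (vec φ 1 0) : ℝ) = g := g0
    have a4 : (inner ℝ (vec φ 1 0) (vec φ 0 0) : ℝ) = f := by rw [← f0, met_symm]; rfl
    rw [a1, a2, a3, a4] at this
    linear_combination this
  -- With g the metric at the origin, n the components of N and d = (det g)^{-1/2}, the other frame
  -- vector is n turned by a right angle: m = d(-(gn)₁, (gn)₀), a unit vector orthogonal to n.
  obtain ⟨d, hd0, hd⟩ : ∃ d : ℝ, d ≠ 0 ∧ d ^ 2 * (e * g - f * f) = 1 :=
    ⟨(√(e * g - f * f))⁻¹, (inv_pos.2 (Real.sqrt_pos.2 hD)).ne', by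
      rw [inv_pow, Real.sq_sqrt hD.le, inv_mul_cancel₀ hD.ne']⟩
  set m0 := -(d * (f * n0 + g * n1)) with hm0
  set m1 := d * (e * n0 + f * n1) with hm1
  let E : E2 → E2 := planeMap (quadPoly 0 m0 n0 0 0 0) (quadPoly 0 m1 n1 0 0 0)
  have hE : ContDiff ℝ ∞ E := planeMap_contDiff (quadPoly_contDiff ..) (quadPoly_contDiff ..)
  have hE0 : E 0 = 0 := by ext i; fin_cases i <;> simp [E, quadPoly]
  have hj0 : HasJet (fun z ↦ E z 0) 0 m0 n0 0 0 0 := (hasJet_quadPoly ..)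
  have hj1 : HasJet (fun z ↦ E z 1) 0 m1 n1 0 0 0 := (hasJet_quadPoly ..)
  have d00 : pd 0 (fun z ↦ E z 0) = quadPoly m0 0 0 0 0 0 := by
    funext z; change pd 0 (quadPoly 0 m0 n0 0 0 0) z = _
    rw [(pd_quadPoly ..).1]; simp [quadPoly]
  have d10 : pd 1 (fun z ↦ E z 0) = quadPoly n0 0 0 0 0 0 := by
    funext z; change pd 1 (quadPoly 0 m0 n0 0 0 0) z = _
    rw [(pd_quadPoly ..).2]; simp [quadPoly]
  have d01 : pd 0 (fun z ↦ E z 1) = quadPoly m1 0 0 0 0 0 := by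
    funext z; change pd 0 (quadPoly 0 m1 n1 0 0 0) z = _
    rw [(pd_quadPoly ..).1]; simp [quadPoly]
  have d11 : pd 1 (fun z ↦ E z 1) = quadPoly n1 0 0 0 0 0 := by
    funext z; change pd 1 (quadPoly 0 m1 n1 0 0 0) z = _
    rw [(pd_quadPoly ..).2]; simp [quadPoly]
  have hjv : m0 * n1 - n0 * m1 = -d := by
    rw [hm0, hm1]; linear_combination (-d) * hunit
  have hjac : jac E 0 ≠ 0 := by
    have : jac E 0 = m0 * n1 - n0 * m1 := by rw [jac, d00, d10, d01, d11]; simp [quadPoly]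
    rw [this, hjv]; exact neg_ne_zero.2 hd0
  have hφ : IsLocalDiffeomorphAt 𝓘(ℝ, E2) (𝓡∂ 2) ∞ (fun z ↦ φ (E z)) 0 :=
    IsLocalDiffeomorphAt.comp (hf := isLocalDiffeomorphAt_of_jac hE hjac) (hg := hE0.symm ▸ h)
  have hJ (i j : Fin 2) {a b c d : ℝ}
      (hi0 : pd i (fun z ↦ E z 0) = quadPoly a 0 0 0 0 0)
      (hi1 : pd i (fun z ↦ E z 1) = quadPoly b 0 0 0 0 0)
      (hj0 : pd j (fun z ↦ E z 0) = quadPoly c 0 0 0 0 0)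
      (hj1 : pd j (fun z ↦ E z 1) = quadPoly d 0 0 0 0 0) := by
    have k0 := hasJet_quadPoly a 0 0 0 0 0
    have k1 := hasJet_quadPoly b 0 0 0 0 0
    have k2 := hasJet_quadPoly c 0 0 0 0 0
    have k3 := hasJet_quadPoly d 0 0 0 0 0
    have hmc := met_comp_eventually h hE hE0 i j
    rw [hi0, hi1, hj0, hj1] at hmc
    exact ((((k0.mul k2).mul (h00.comp hE ‹_› ‹_›)).add (((k0.mul k3).add (k1.mul k2)).mul
      (h01.comp hE ‹_› ‹_›))).add ((k1.mul k3).mul (h11.comp hE ‹_› ‹_›))).congr hmc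
  refine ⟨fun z ↦ φ (E z), hφ, by simp [hE0], ?_, _, _, _, _, _, _, _, _, _,
    (hJ 0 0 d00 d01 d00 d01).of_eq ?_ ?_ ?_ rfl rfl rfl,
    (hJ 0 1 d00 d01 d10 d11).of_eq ?_ ?_ ?_ rfl rfl rfl,
    (hJ 1 1 d10 d11 d10 d11).of_eq ?_ ?_ ?_ rfl rfl rfl, ?_⟩
  · rw [vec_comp (by rw [hE0]; exact h.mdifferentiableAt (by simp))
      (hE.differentiable (by simp) 0), d10, d11]
    have key (y : E2) (hy : y = 0) : n0 • vec φ 0 y + n1 • vec φ 1 y = N (φ y) := by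
      subst hy; exact hn.symm
    simpa [quadPoly] using key (E 0) hE0
  · rw [hm0, hm1]; linear_combination (d ^ 2 * (e * g - f * f)) * hunit + hd
  · ring
  · ring
  · rw [hm0, hm1]; ring
  · ring
  · ring
  · linear_combination hunit
  · ring
  · ring
  -- The combination of second derivatives behaves like a curvature component: a linear change
  -- multiplies it by the squared determinant, here d² = 1/det g.
  · linear_combination (m0 * n1 - n0 * m1) ^ 2 * hR + R * (e * g - f * f) *
      ((m0 * n1 - n0 * m1) - d) * hjv + R * hd

/-- Coordinates in which the metric has the normal form of Fermi coordinates along a geodesic, up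
to terms of order three. -/
lemma exists_param_normal {φ : E2 → M} (h : IsLocalDiffeomorphAt 𝓘(ℝ, E2) (𝓡∂ 2) ∞ φ 0)
    {N : ∀ p : M, TangentSpace (𝓡∂ 2) p} (hN : vec φ 1 0 = N (φ 0))
    {p00 p01 p11 q00 q01 q11 r00 r01 r11 R : ℝ}
    (h00 : HasJet (met φ 0 0) 1 0 0 p00 p01 p11) (h01 : HasJet (met φ 0 1) 0 0 0 q00 q01 q11)
    (h11 : HasJet (met φ 1 1) 1 0 0 r00 r01 r11) (hR : 2 * q01 - p11 - r00 = R) :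
    ∃ χ : E2 → M, IsLocalDiffeomorphAt 𝓘(ℝ, E2) (𝓡∂ 2) ∞ χ 0 ∧ χ 0 = φ 0 ∧
      vec χ 1 0 = N (χ 0) ∧
      HasJet (met χ 0 0) 1 0 0 0 0 (-R) ∧ HasJet (met χ 0 1) 0 0 0 0 0 0 ∧
      HasJet (met χ 1 1) 1 0 0 0 0 0 := by
  -- A cubic change of coordinates has eight coefficients, and the metric nine second derivatives.
  -- The eight are chosen to kill everything except the second t-derivative of g₀₀, which must then
  -- carry the invariant 2q₀₁ - p₁₁ - r₀₀ with a minus sign.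
  obtain ⟨A1, hA1⟩ : ∃ A : ℝ, A = -p00 / 12 := ⟨_, rfl⟩
  obtain ⟨A2, hA2⟩ : ∃ A : ℝ, A = -p01 / 4 := ⟨_, rfl⟩
  obtain ⟨B2, hB2⟩ : ∃ A : ℝ, A = -r00 / 4 := ⟨_, rfl⟩
  obtain ⟨B3, hB3⟩ : ∃ A : ℝ, A = -r01 / 4 := ⟨_, rfl⟩
  obtain ⟨B4, hB4⟩ : ∃ A : ℝ, A = -r11 / 12 := ⟨_, rfl⟩
  obtain ⟨A3, hA3⟩ : ∃ A : ℝ, A = -(q01 + 2 * B2) / 2 := ⟨_, rfl⟩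
  obtain ⟨B1, hB1⟩ : ∃ A : ℝ, A = -(q00 + 2 * A2) / 6 := ⟨_, rfl⟩
  obtain ⟨A4, hA4⟩ : ∃ A : ℝ, A = -(q11 + 2 * B3) / 6 := ⟨_, rfl⟩
  let E : E2 → E2 := planeMap (fun z ↦ quadPoly 0 1 0 0 0 0 z + cubPoly A1 A2 A3 A4 z)
    (fun z ↦ quadPoly 0 0 1 0 0 0 z + cubPoly B1 B2 B3 B4 z)
  have hq (c l0 l1 q00 q01 q11 : ℝ) := quadPoly_contDiff c l0 l1 q00 q01 q11
  have hE : ContDiff ℝ ∞ E := planeMap_contDiff ((hq ..).add (cubPoly_contDiff ..))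
    ((hq ..).add (cubPoly_contDiff ..))
  have hE0 : E 0 = 0 := by ext i; fin_cases i <;> simp [E, quadPoly, cubPoly]
  have hj (l0 l1 A B C D : ℝ) :
      HasJet (fun z ↦ quadPoly 0 l0 l1 0 0 0 z + cubPoly A B C D z) 0 l0 l1 0 0 0 :=
    (van_cubPoly A B C D).congr (.of_forall fun z ↦ by simp)
  have hj0 : HasJet (fun z ↦ E z 0) 0 1 0 0 0 0 := hj ..
  have hj1 : HasJet (fun z ↦ E z 1) 0 0 1 0 0 0 := hj ..
  have hd (l0 l1 A B C D : ℝ) :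
      pd 0 (fun z ↦ quadPoly 0 l0 l1 0 0 0 z + cubPoly A B C D z) =
        quadPoly l0 0 0 (6 * A) (2 * B) (2 * C) ∧
      pd 1 (fun z ↦ quadPoly 0 l0 l1 0 0 0 z + cubPoly A B C D z) =
        quadPoly l1 0 0 (2 * B) (2 * C) (6 * D) := by
    constructor
    all_goals
      funext z
      rw [pd_add ((hq ..).differentiable (by simp) z)
        ((cubPoly_contDiff ..).differentiable (by simp) z)]
      simp only [(pd_quadPoly ..).1, (pd_quadPoly ..).2, (pd_cubPoly ..).1, (pd_cubPoly ..).2]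
      simp only [quadPoly]
      ring
  have d00 : pd 0 (fun z ↦ E z 0) = _ := (hd 1 0 A1 A2 A3 A4).1
  have d10 : pd 1 (fun z ↦ E z 0) = _ := (hd 1 0 A1 A2 A3 A4).2
  have d01 : pd 0 (fun z ↦ E z 1) = _ := (hd 0 1 B1 B2 B3 B4).1
  have d11 : pd 1 (fun z ↦ E z 1) = _ := (hd 0 1 B1 B2 B3 B4).2
  have hjac : jac E 0 ≠ 0 := by
    rw [jac, d00, d10, d01, d11]; simp [quadPoly]
  have hφ : IsLocalDiffeomorphAt 𝓘(ℝ, E2) (𝓡∂ 2) ∞ (fun z ↦ φ (E z)) 0 :=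
    IsLocalDiffeomorphAt.comp (hf := isLocalDiffeomorphAt_of_jac hE hjac) (hg := hE0.symm ▸ h)
  have hJ (i j : Fin 2) {a a0 a1 a2 b b0 b1 b2 c c0 c1 c2 d d0 d1 d2 : ℝ}
      (hi0 : pd i (fun z ↦ E z 0) = quadPoly a 0 0 a0 a1 a2)
      (hi1 : pd i (fun z ↦ E z 1) = quadPoly b 0 0 b0 b1 b2)
      (hj0 : pd j (fun z ↦ E z 0) = quadPoly c 0 0 c0 c1 c2)
      (hj1 : pd j (fun z ↦ E z 1) = quadPoly d 0 0 d0 d1 d2) := by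
    have k0 := hasJet_quadPoly a 0 0 a0 a1 a2
    have k1 := hasJet_quadPoly b 0 0 b0 b1 b2
    have k2 := hasJet_quadPoly c 0 0 c0 c1 c2
    have k3 := hasJet_quadPoly d 0 0 d0 d1 d2
    have hmc := met_comp_eventually h hE hE0 i j
    rw [hi0, hi1, hj0, hj1] at hmc
    exact ((((k0.mul k2).mul (h00.comp hE ‹_› ‹_›)).add (((k0.mul k3).add (k1.mul k2)).mul
      (h01.comp hE ‹_› ‹_›))).add ((k1.mul k3).mul (h11.comp hE ‹_› ‹_›))).congr hmc
  refine ⟨fun z ↦ φ (E z), hφ, by simp [hE0], ?_,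
    (hJ 0 0 d00 d01 d00 d01).of_eq ?_ ?_ ?_ ?_ ?_ ?_,
    (hJ 0 1 d00 d01 d10 d11).of_eq ?_ ?_ ?_ ?_ ?_ ?_,
    (hJ 1 1 d10 d11 d10 d11).of_eq ?_ ?_ ?_ ?_ ?_ ?_⟩
  · rw [vec_comp (by rw [hE0]; exact h.mdifferentiableAt (by simp))
      (hE.differentiable (by simp) 0), d10, d11]
    have key (y : E2) (hy : y = 0) : vec φ 1 y = N (φ y) := by
      subst hy; exact hN
    simpa [quadPoly] using key (E 0) hE0
  all_goals
    try simp only [hA3, hB1, hA4, hA1, hA2, hB2, hB3, hB4, ← hR]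
    ring

/-- Normal form of the metric around an interior point. -/
theorem exists_normal_param {x : M} (hx : x ∈ (𝓡∂ 2).interior M)
    {N : ∀ p : M, TangentSpace (𝓡∂ 2) p} (hN : ‖N x‖ = 1) :
    ∃ χ : E2 → M, IsLocalDiffeomorphAt 𝓘(ℝ, E2) (𝓡∂ 2) ∞ χ 0 ∧ χ 0 = x ∧
      vec χ 1 0 = N (χ 0) ∧
      HasJet (met χ 0 0) 1 0 0 0 0 (-scalarCurvature x) ∧ HasJet (met χ 0 1) 0 0 0 0 0 0 ∧
      HasJet (met χ 1 1) 1 0 0 0 0 0 := by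
  obtain ⟨ψ, hψ, hψx, hs⟩ := exists_chart_param hx
  obtain ⟨φ, hφ, hφ0, e, f, g, _, _, _, _, _, _, _, _, _, h00, h01, h11, hR⟩ :=
    exists_param_of_scal hψ
  obtain ⟨χ, hχ, hχ0, hv, _, _, _, _, _, _, _, _, _, k00, k01, k11, hR'⟩ :=
    exists_param_orthonormal (N := N) hφ (by rw [hφ0, hψx]; exact hN) h00 h01 h11 hR
  obtain ⟨ξ, hξ, hξ0, hvξ, l00, l01, l11⟩ := exists_param_normal hχ hv k00 k01 k11 hR'
  exact ⟨ξ, hξ, by rw [hξ0, hχ0, hφ0, hψx], hvξ, hs ▸ l00, l01, l11⟩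

end NormalFrame

/-! ### Degeneracy of the Hessian of a function that is minimal along a curve. -/

section PlaneHessian

lemma norm_plane_le (s t : ℝ) : ‖(!₂[s, t] : E2)‖ ≤ |s| + |t| := by
  have : (!₂[s, t] : E2) = s • stdVec 0 + t • stdVec 1 := by
    rw [eq_sum_stdVec !₂[s, t]]; simp
  rw [this]
  refine (norm_add_le _ _).trans ?_
  simp [norm_smul, stdVec]

/-- A function with a horizontal tangent of its zero set has zeros in every horizontal cone. -/
lemma exists_zero_in_cone {F : E2 → ℝ} (hF : ContDiffAt ℝ ∞ F 0) (h0 : F 0 = 0)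
    (h1 : pd 0 F 0 = 0) (h2 : pd 1 F 0 = 1) {η : ℝ} (hη : 0 < η) :
    ∀ᶠ s in 𝓝[>] (0 : ℝ), ∃ t, |t| ≤ η * s ∧ F !₂[s, t] = 0 := by
  have hlo := (smooth_diffAt hF).hasFDerivAt.isLittleO
  -- On the vertical segment |t| ≤ ηs the norm is at most (1+η)s, so this constant makes F - t at
  -- most ηs/2. Hence F has opposite signs at the two ends and the intermediate value theorem
  -- applies.
  have hc : 0 < η / (2 * (1 + η)) := by positivity
  obtain ⟨r1, hr1, hlo'⟩ := Metric.eventually_nhds_iff.1 (Asymptotics.isLittleO_iff.1 hlo hc)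
  obtain ⟨r2, hr2, hdiff⟩ := Metric.eventually_nhds_iff.1 (eventually_differentiableAt hF)
  have hr : 0 < min r1 r2 / (1 + η) := by positivity
  filter_upwards [Ioo_mem_nhdsGT hr] with s hs
  have hs0 : 0 < s := hs.1
  have hsr : s * (1 + η) < min r1 r2 := (lt_div_iff₀ (by positivity)).1 hs.2
  have hnorm (t : ℝ) (ht : |t| ≤ η * s) : ‖(!₂[s, t] : E2)‖ ≤ s * (1 + η) := by
    refine (norm_plane_le s t).trans ?_
    rw [abs_of_pos hs0]; linarith
  have key (t : ℝ) (ht : |t| ≤ η * s) : |F !₂[s, t] - t| ≤ η * s / 2 := by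
    have hn := hnorm t ht
    have := hlo' (y := !₂[s, t]) (by
      rw [dist_zero_right]; exact (hn.trans_lt hsr).trans_le (min_le_left _ _))
    rw [h0, sub_zero, sub_zero, fderiv_apply_eq_pd, h1, h2] at this
    simp only [Matrix.cons_val_zero, Matrix.cons_val_one, smul_eq_mul,
      mul_zero, zero_add, mul_one, Real.norm_eq_abs] at this
    refine this.trans ((mul_le_mul_of_nonneg_left hn hc.le).trans (le_of_eq ?_))
    field_simp
  have hηs : 0 < η * s := by positivity
  have hcont : ContinuousOn (fun t ↦ F !₂[s, t]) (Set.Icc (-(η * s)) (η * s)) := by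
    intro t ht
    have ht' : |t| ≤ η * s := abs_le.2 ht
    have hd : ContinuousAt F !₂[s, t] := (hdiff (y := !₂[s, t]) (by
      rw [dist_zero_right]
      exact ((hnorm t ht').trans_lt hsr).trans_le (min_le_right _ _))).continuousAt
    have hl : Continuous fun t : ℝ ↦ (!₂[s, t] : E2) := by
      refine (PiLp.continuous_toLp 2 _).comp (continuous_pi fun i ↦ ?_)
      fin_cases i
      · exact continuous_const
      · exact continuous_id
    exact (ContinuousAt.comp (f := fun t : ℝ ↦ (!₂[s, t] : E2)) hd hl.continuousAt).continuousWithinAt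
  have k1 := abs_le.1 (key (η * s) (abs_of_pos hηs).le)
  have k2 := abs_le.1 (key (-(η * s)) (by rw [abs_neg, abs_of_pos hηs]))
  obtain ⟨t, ht, hFt⟩ := intermediate_value_Icc (by linarith) hcont
    (show (0 : ℝ) ∈ _ from ⟨by linarith [k2.2], by linarith [k1.1]⟩)
  exact ⟨t, abs_le.2 ht, hFt⟩

/-- A function that attains its minimum along a curve with horizontal tangent has a Hessian which
is degenerate in the horizontal direction. -/
lemma hessian_eq_zero {β F : E2 → ℝ} {b p q r : ℝ} (hβ : HasJet β b 0 0 p q r)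
    (hF : ContDiffAt ℝ ∞ F 0) (h0 : F 0 = 0) (h1 : pd 0 F 0 = 0) (h2 : pd 1 F 0 ≠ 0)
    (hmin : ∀ᶠ z in 𝓝 0, b ≤ β z) (hz : ∀ᶠ z in 𝓝 0, F z = 0 → β z = b) : p = 0 ∧ q = 0 := by
  obtain ⟨C, hC, r0, hr0, hb⟩ := Van.bound hβ
  have hF' : ContDiffAt ℝ ∞ (fun z ↦ (pd 1 F 0)⁻¹ * F z) 0 := contDiffAt_const.mul hF
  have hz' : ∀ᶠ z in 𝓝 0, (pd 1 F 0)⁻¹ * F z = 0 → β z = b := by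
    filter_upwards [hz] with z hz hh
    exact hz ((mul_eq_zero.1 hh).resolve_left (inv_ne_zero h2))
  have hzero (η : ℝ) (hη : 0 < η) := exists_zero_in_cone hF' (by simp [h0])
    (by rw [pd_const_mul _ (smooth_diffAt hF), h1, mul_zero])
    (by rw [pd_const_mul _ (smooth_diffAt hF), inv_mul_cancel₀ h2]) hη
  obtain ⟨r1, hr1, hmin'⟩ := Metric.eventually_nhds_iff.1 hmin
  obtain ⟨r2, hr2, hz''⟩ := Metric.eventually_nhds_iff.1 hz'
  have hsmall {ρ : ℝ} (hρ : 0 < ρ) : ∀ᶠ s in 𝓝[>] (0 : ℝ), 0 < s ∧ s < ρ := Ioo_mem_nhdsGT hρ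
  have hest (s t : ℝ) (hs : 0 < s) (ht : |t| ≤ s) (hsr : 2 * s < r0) :
      |β !₂[s, t] - (b + p / 2 * (s * s) + q * (s * t) + r / 2 * (t * t))| ≤ 8 * C * s * s ^ 2 := by
    have hn : ‖(!₂[s, t] : E2)‖ ≤ 2 * s := by
      refine (norm_plane_le s t).trans ?_
      rw [abs_of_pos hs]; linarith
    have h := hb !₂[s, t] (hn.trans_lt hsr)
    simp only [quadPoly, Matrix.cons_val_zero, Matrix.cons_val_one, zero_mul,
      add_zero] at h
    refine h.trans ((mul_le_mul_of_nonneg_left (pow_le_pow_left₀ (norm_nonneg _) hn 3) hC).trans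
      (le_of_eq ?_))
    ring
  -- At a zero of F in a thin cone the value is b, so p s²/2 is balanced by the other terms. The
  -- choice of η bounds the quadratic ones by |p|s²/8, and that of s bounds the cubic remainder by
  -- |p|s²/8, too little if p ≠ 0.
  have hp : p = 0 := by
    by_contra hp
    have hp' : 0 < |p| := abs_pos.2 hp
    set η := min 1 (|p| / (8 * (|q| + |r| + 1))) with hη
    have hη0 : 0 < η := by positivity
    have hη1 : η ≤ 1 := min_le_left _ _
    have hη2 : η * (8 * (|q| + |r| + 1)) ≤ |p| :=
      (le_div_iff₀ (by positivity)).1 (min_le_right _ _)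
    obtain ⟨s, ⟨t, ht, hFt⟩, ⟨hs, hs1⟩⟩ := ((hzero η hη0).and
      (hsmall (ρ := min (min (r0 / 2) (r2 / 2)) (|p| / (64 * (C + 1)))) (by positivity))).exists
    have hs2 : 2 * s < r0 := by
      have := hs1.trans_le ((min_le_left _ _).trans (min_le_left _ _)); linarith
    have hs3 : 2 * s < r2 := by
      have := hs1.trans_le ((min_le_left _ _).trans (min_le_right _ _)); linarith
    have hs4 : s * (64 * (C + 1)) < |p| :=
      (lt_div_iff₀ (by positivity)).1 (hs1.trans_le (min_le_right _ _))
    have hts : |t| ≤ s := ht.trans (by nlinarith)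
    have e := hest s t hs hts hs2
    have hn : ‖(!₂[s, t] : E2)‖ < r2 := by
      refine (norm_plane_le s t).trans_lt ?_
      rw [abs_of_pos hs]; linarith
    rw [hz'' (y := !₂[s, t]) (by rwa [dist_zero_right]) hFt] at e
    have e1 : |p| / 2 * (s * s) ≤ 8 * C * s * s ^ 2 + |q| * (s * (η * s)) + |r| / 2 * (η * s * s) := by
      have b1 : |q * (s * t)| ≤ |q| * (s * (η * s)) := by
        rw [abs_mul, abs_mul, abs_of_pos hs]; gcongr
      have b2 : |r / 2 * (t * t)| ≤ |r| / 2 * (η * s * s) := by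
        rw [abs_mul, abs_mul, abs_div, abs_two]; gcongr
      have b3 : |p| / 2 * (s * s) = |p / 2 * (s * s)| := by
        rw [abs_mul, abs_div, abs_two, abs_of_pos (mul_pos hs hs)]
      rw [b3]
      have b4 := abs_sub_abs_le_abs_sub (p / 2 * (s * s))
        (b - (b + p / 2 * (s * s) + q * (s * t) + r / 2 * (t * t)) + p / 2 * (s * s))
      have b5 : |b - (b + p / 2 * (s * s) + q * (s * t) + r / 2 * (t * t)) + p / 2 * (s * s)| ≤
          |q| * (s * (η * s)) + |r| / 2 * (η * s * s) := by
        have : b - (b + p / 2 * (s * s) + q * (s * t) + r / 2 * (t * t)) + p / 2 * (s * s)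
          = -(q * (s * t) + r / 2 * (t * t)) := by ring
        rw [this, abs_neg]
        exact (abs_add_le _ _).trans (add_le_add b1 b2)
      have b6 : |p / 2 * (s * s) - (b - (b + p / 2 * (s * s) + q * (s * t) + r / 2 * (t * t)) +
          p / 2 * (s * s))| ≤ 8 * C * s * s ^ 2 := by
        rw [abs_sub_comm, add_sub_cancel_right]; exact e
      linarith
    have e2 : |p| / 2 ≤ 8 * C * s + |q| * η + |r| / 2 * η := by
      have hss : 0 < s * s := mul_pos hs hs
      refine le_of_mul_le_mul_right (e1.trans (le_of_eq ?_)) hss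
      ring
    nlinarith [abs_nonneg q, abs_nonneg r, mul_nonneg hη0.le (abs_nonneg r),
      mul_nonneg hη0.le (abs_nonneg q)]
  refine ⟨hp, ?_⟩
  subst hp
  by_contra hq
  have hq' : 0 < |q| := abs_pos.2 hq
  set δ := min 1 (|q| / (|r| + 1)) with hδ
  have hδ0 : 0 < δ := by positivity
  have hδ1 : δ ≤ 1 := min_le_left _ _
  have hδ2 : δ * (|r| + 1) ≤ |q| := (le_div_iff₀ (by positivity)).1 (min_le_right _ _)
  obtain ⟨s, ⟨hs, hs1⟩⟩ := (hsmall (ρ := min (min (r0 / 2) (r1 / 2))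
    (δ * |q| / (32 * (C + 1)))) (by positivity)).exists
  have hs2 : 2 * s < r0 := by
    have := hs1.trans_le ((min_le_left _ _).trans (min_le_left _ _)); linarith
  have hs3 : 2 * s < r1 := by
    have := hs1.trans_le ((min_le_left _ _).trans (min_le_right _ _)); linarith
  have hs4 : s * (32 * (C + 1)) < δ * |q| :=
    (lt_div_iff₀ (by positivity)).1 (hs1.trans_le (min_le_right _ _))
  -- With p = 0, a point with t = ±δs and q s t < 0 would lie below the minimum: the gain δ|q|s²
  -- exceeds r t²/2, which costs at most half of it, plus a cubic remainder below a quarter of it.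
  obtain ⟨t, ht1, ht2, ht3⟩ : ∃ t, |t| ≤ s ∧ q * (s * t) = -(δ * |q| * (s * s)) ∧
      t * t = δ ^ 2 * (s * s) := by
    rcases lt_or_gt_of_ne hq with h | h
    · refine ⟨δ * s, ?_, ?_, by ring⟩
      · rw [abs_of_pos (by positivity)]; nlinarith
      · rw [abs_of_neg h]; ring
    · refine ⟨-(δ * s), ?_, ?_, by ring⟩
      · rw [abs_neg, abs_of_pos (by positivity)]; nlinarith
      · rw [abs_of_pos h]; ring
  have e := (abs_le.1 (hest s t hs ht1 hs2)).2
  have hn : ‖(!₂[s, t] : E2)‖ < r1 := by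
    refine (norm_plane_le s t).trans_lt ?_
    rw [abs_of_pos hs]; linarith
  have hm := hmin' (y := !₂[s, t]) (by rwa [dist_zero_right])
  rw [ht2, ht3] at e
  have e1 : δ * |q| * (s * s) ≤ (8 * C * s + |r| / 2 * δ ^ 2) * (s * s) := by
    have : r / 2 * (δ ^ 2 * (s * s)) ≤ |r| / 2 * (δ ^ 2 * (s * s)) := by
      gcongr; exact le_abs_self r
    nlinarith
  have e2 := le_of_mul_le_mul_right e1 (mul_pos hs hs)
  have e3 : |r| / 2 * δ ^ 2 ≤ δ * |q| / 2 := by nlinarith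
  nlinarith

end PlaneHessian

/-! ### Jets of the field strength and of the metric coefficients at a point of the well. -/

section Field

variable {M : Type*} [TopologicalSpace M] [T2Space M] [MeasurableSpace M] [BorelSpace M]
  [ChartedSpace (EuclideanHalfSpace 2) M]
  [IsManifold (𝓡∂ 2) ∞ M] [RiemannianBundle (fun p : M ↦ TangentSpace (𝓡∂ 2) p)]
  [IsContMDiffRiemannianBundle (𝓡∂ 2) ∞ E2 (fun p : M ↦ TangentSpace (𝓡∂ 2) p)]
  {A : ∀ p : M, TangentSpace (𝓡∂ 2) p →L[ℝ] ℝ} {ψ : E2 → M}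

lemma minField_le (A : ∀ p : M, TangentSpace (𝓡∂ 2) p →L[ℝ] ℝ) (p : M) :
    minField A ≤ |fieldStrength A p| :=
  ciInf_le ⟨0, by rintro _ ⟨q, rfl⟩; positivity⟩ p

/-- The curl of the coefficients of a one-form in a parametrization. -/
def curl (A : ∀ p : M, TangentSpace (𝓡∂ 2) p →L[ℝ] ℝ) (ψ : E2 → M) (z : E2) : ℝ :=
  pd 0 (cof A ψ 1) z - pd 1 (cof A ψ 0) z

lemma curl_contDiffAt (hA : IsSmoothForm A) {z : E2}
    (h : IsLocalDiffeomorphAt 𝓘(ℝ, E2) (𝓡∂ 2) ∞ ψ z) : ContDiffAt ℝ ∞ (curl A ψ) z :=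
  (pd_contDiffAt (cof_contDiffAt hA h.contMDiffAt 1) 0).sub
    (pd_contDiffAt (cof_contDiffAt hA h.contMDiffAt 0) 1)

/-- Near a point where the field does not vanish, its strength is smooth in a parametrization. -/
lemma exists_sign_curl (hA : IsSmoothForm A) (h : IsLocalDiffeomorphAt 𝓘(ℝ, E2) (𝓡∂ 2) ∞ ψ 0)
    (hb : fieldStrength A (ψ 0) ≠ 0) : ∃ σ : ℝ, (σ = 1 ∨ σ = -1) ∧
      (fun z ↦ |fieldStrength A (ψ z)| * dens ψ z) =ᶠ[𝓝 0] (fun z ↦ σ * curl A ψ z) ∧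
      ContDiffAt ℝ ∞ (fun z ↦ |fieldStrength A (ψ z)|) 0 := by
  have hcurl := curl_contDiffAt hA h
  have hne : curl A ψ 0 ≠ 0 := by
    intro h0
    have := fieldStrength_sq h hA
    rw [show pd 0 (cof A ψ 1) 0 - pd 1 (cof A ψ 0) 0 = 0 from h0, abs_zero] at this
    rcases mul_eq_zero.1 this with h1 | h1
    · exact hb (abs_eq_zero.1 h1)
    · exact (Real.sqrt_pos.2 (metMat_det_pos h)).ne' h1
  obtain ⟨σ, hσ, hσc⟩ : ∃ σ : ℝ, (σ = 1 ∨ σ = -1) ∧ ∀ᶠ z in 𝓝 0, |curl A ψ z| = σ * curl A ψ z := by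
    rcases lt_or_gt_of_ne hne with h1 | h1
    · refine ⟨-1, .inr rfl, ?_⟩
      filter_upwards [hcurl.continuousAt.eventually (gt_mem_nhds h1)] with z hz
      rw [abs_of_neg hz]; ring
    · refine ⟨1, .inl rfl, ?_⟩
      filter_upwards [hcurl.continuousAt.eventually (lt_mem_nhds h1)] with z hz
      rw [abs_of_pos hz]; ring
  have he : (fun z ↦ |fieldStrength A (ψ z)| * dens ψ z) =ᶠ[𝓝 0] (fun z ↦ σ * curl A ψ z) := by
    filter_upwards [hσc, eventually_isLocalDiffeomorphAt h] with z h1 h2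
    rw [← h1]
    exact fieldStrength_sq h2 hA
  refine ⟨σ, hσ, he, ?_⟩
  have hs : ContDiffAt ℝ ∞ (fun z ↦ σ * curl A ψ z / dens ψ z) 0 :=
    (contDiffAt_const.mul hcurl).div (dens_contDiffAt h) (dens_pos h).ne'
  refine hs.congr_of_eventuallyEq ?_
  filter_upwards [he, eventually_isLocalDiffeomorphAt h] with z h1 h2
  rw [← h1, mul_div_cancel_right₀ _ (dens_pos h2).ne']

/-- The coefficients of a smooth vector field in the frame of a parametrization are smooth. -/
lemma exists_coeff (h : IsLocalDiffeomorphAt 𝓘(ℝ, E2) (𝓡∂ 2) ∞ ψ 0)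
    {N : ∀ p : M, TangentSpace (𝓡∂ 2) p}
    (hN : ContMDiffAt (𝓡∂ 2) (𝓡∂ 2).tangent ∞ (fun p ↦ (⟨p, N p⟩ : TangentBundle (𝓡∂ 2) M)) (ψ 0)) :
    ∃ n : Fin 2 → E2 → ℝ, (∀ i, ContDiffAt ℝ ∞ (n i) 0) ∧
      ∀ᶠ z in 𝓝 0, N (ψ z) = n 0 z • vec ψ 0 z + n 1 z • vec ψ 1 z := by
  let m (j : Fin 2) (z : E2) : ℝ := inner ℝ (vec ψ j z) (N (ψ z))
  have hm (j : Fin 2) : ContDiffAt ℝ ∞ (m j) 0 :=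
    (ContMDiffAt.inner_bundle (IB := 𝓡∂ 2) (F := E2) (E := fun p : M ↦ TangentSpace (𝓡∂ 2) p)
      (b := ψ) (contMDiffAt_vec h.contMDiffAt j) (hN.comp 0 h.contMDiffAt)).contDiffAt
  -- The components are recovered from the scalar products with the frame by inverting the Gram
  -- matrix, an expression visibly smooth in z.
  refine ⟨fun i z ↦ ∑ j, (metMat ψ z)⁻¹ i j * m j z,
    fun i ↦ ContDiffAt.sum fun j _ ↦ (metMat_inv_contDiffAt h i j).mul (hm j), ?_⟩
  filter_upwards [eventually_isLocalDiffeomorphAt h] with z hz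
  obtain ⟨a, b, hab⟩ := exists_coords hz (N (ψ z))
  have hD := (metMat_det_pos hz).ne'
  have ed : (metMat ψ z).det = met ψ 0 0 z * met ψ 1 1 z - met ψ 0 1 z * met ψ 0 1 z := by
    rw [Matrix.det_fin_two, metMat]
    simp [met_symm ψ 1 0]
  have hinv := metMat_inv ψ z
  have m0 : m 0 z = a * met ψ 0 0 z + b * met ψ 0 1 z := by
    simp only [m, hab, inner_add_right, real_inner_smul_right, met]
  have m1 : m 1 z = a * met ψ 0 1 z + b * met ψ 1 1 z := by
    rw [met_symm ψ 0 1]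
    simp only [m, hab, inner_add_right, real_inner_smul_right, met]
  have ea : ∑ j, (metMat ψ z)⁻¹ 0 j * m j z = a := by
    rw [Fin.sum_univ_two, hinv.1, hinv.2.1, m0, m1]
    field_simp
    rw [ed]; ring
  have eb : ∑ j, (metMat ψ z)⁻¹ 1 j * m j z = b := by
    rw [Fin.sum_univ_two, hinv.2.2.1, hinv.2.2.2, m0, m1]
    field_simp
    rw [ed]; ring
  rw [ea, eb]; exact hab

/-- The second derivative of the field strength in the direction of the normal field. -/
lemma beta2_eq (h : IsLocalDiffeomorphAt 𝓘(ℝ, E2) (𝓡∂ 2) ∞ ψ 0)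
    {N : ∀ p : M, TangentSpace (𝓡∂ 2) p}
    (hN : ContMDiffAt (𝓡∂ 2) (𝓡∂ 2).tangent ∞ (fun p ↦ (⟨p, N p⟩ : TangentBundle (𝓡∂ 2) M)) (ψ 0))
    (hv : vec ψ 1 0 = N (ψ 0)) (hb : ContDiffAt ℝ ∞ (fun z ↦ |fieldStrength A (ψ z)|) 0)
    (h0 : ∀ i, pd i (fun z ↦ |fieldStrength A (ψ z)|) 0 = 0) :
    beta2 A N (ψ 0) = pd 1 (pd 1 (fun z ↦ |fieldStrength A (ψ z)|)) 0 := by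
  set β : E2 → ℝ := fun z ↦ |fieldStrength A (ψ z)| with hβ
  obtain ⟨n, hn, hNn⟩ := exists_coeff h hN
  have e : (fun z ↦ alongField N (fun q ↦ |fieldStrength A q|) (ψ z)) =ᶠ[𝓝 0]
      fun z ↦ n 0 z * pd 0 β z + n 1 z * pd 1 β z := by
    filter_upwards [hNn, eventually_isLocalDiffeomorphAt h, eventually_differentiableAt hb]
      with z h1 h2 h3
    have hd := (hasMFDerivAt_of_comp h2 (f := fun q ↦ |fieldStrength A q|) h3).2
    unfold alongField
    rw [h1, map_add, map_smul, map_smul, hd, hd]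
    rfl
  have hsm (i : Fin 2) : ContDiffAt ℝ ∞ (fun z ↦ n i z * pd i β z) 0 :=
    (hn i).mul (pd_contDiffAt hb i)
  have hd : DifferentiableAt ℝ (fun z ↦ alongField N (fun q ↦ |fieldStrength A q|) (ψ z)) 0 :=
    (smooth_diffAt ((hsm 0).add (hsm 1))).congr_of_eventuallyEq e
  have hn01 : n 0 0 = 0 ∧ n 1 0 = 1 := by
    have h1 := hNn.self_of_nhds
    rw [← hv] at h1
    have hinj := mfderiv_injective h
    have h2 : mfderiv 𝓘(ℝ, E2) (𝓡∂ 2) ψ 0 (stdVec 1) =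
        mfderiv 𝓘(ℝ, E2) (𝓡∂ 2) ψ 0 (n 0 0 • stdVec 0 + n 1 0 • stdVec 1 : E2) := by
      have e3 := clm_apply_eq (mfderiv 𝓘(ℝ, E2) (𝓡∂ 2) ψ 0) (n 0 0 • stdVec 0 + n 1 0 • stdVec 1)
      simp only [stdVec, PiLp.add_apply, PiLp.smul_apply] at e3
      simp at e3
      exact h1.trans e3.symm
    have h3 : (stdVec 1 : E2) = n 0 0 • stdVec 0 + n 1 0 • stdVec 1 := hinj h2
    constructor
    · simpa [stdVec] using (congrArg (fun v : E2 ↦ v 0) h3).symm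
    · simpa [stdVec] using (congrArg (fun v : E2 ↦ v 1) h3).symm
  -- In N(Nβ) the derivatives of the coefficients of N multiply first derivatives of β, which vanish
  -- at the origin; only the Hessian on N, that is ∂₁²β, survives.
  unfold beta2
  rw [show alongField N (alongField N fun q ↦ |fieldStrength A q|) (ψ 0) =
    mfderiv (𝓡∂ 2) 𝓘(ℝ, ℝ) (alongField N fun q ↦ |fieldStrength A q|) (ψ 0) (N (ψ 0)) from rfl,
    ← hv, (hasMFDerivAt_of_comp h hd).2, pd_congr_at e,
    pd_add (smooth_diffAt (hsm 0)) (smooth_diffAt (hsm 1)),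
    pd_mul (smooth_diffAt (hn 0)) (smooth_diffAt (pd_contDiffAt hb 0)),
    pd_mul (smooth_diffAt (hn 1)) (smooth_diffAt (pd_contDiffAt hb 1)), h0, h0, hn01.1, hn01.2]
  simp

/-- The jet of the field strength at a point of the well. -/
theorem fieldStrength_hasJet (hA : IsSmoothForm A)
    (h : IsLocalDiffeomorphAt 𝓘(ℝ, E2) (𝓡∂ 2) ∞ ψ 0) (hb₀ : 0 < minField A)
    (hx : ψ 0 ∈ well A) (hcurve : IsSmoothCurve (well A))
    {N : ∀ p : M, TangentSpace (𝓡∂ 2) p} (hN : IsNormalGeodesicField (well A) N)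
    (hv : vec ψ 1 0 = N (ψ 0)) (horth : met ψ 0 1 0 = 0) (hunit : met ψ 1 1 0 = 1) :
    HasJet (fun z ↦ |fieldStrength A (ψ z)|) (minField A) 0 0 0 0 (beta2 A N (ψ 0)) := by
  obtain ⟨U₀, hU₀, hSU, hNs, -, hNn, -⟩ := hN
  have hNx := hNs.contMDiffAt (hU₀.mem_nhds (hSU hx))
  have hx' : |fieldStrength A (ψ 0)| = minField A := hx
  obtain ⟨σ, -, -, hsm⟩ := exists_sign_curl hA h (by
    intro h0; rw [h0, abs_zero] at hx'; exact hb₀.ne hx')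
  have hmin : ∀ z, minField A ≤ |fieldStrength A (ψ z)| := fun z ↦ minField_le A _
  have h0 (i : Fin 2) : pd i (fun z ↦ |fieldStrength A (ψ z)|) 0 = 0 := by
    have : IsLocalMin (fun z ↦ |fieldStrength A (ψ z)|) 0 :=
      .of_forall fun z ↦ by simp only [hx']; exact hmin z
    rw [pd, this.fderiv_eq_zero]; rfl
  have hjet := hasJet_self hsm
  rw [h0, h0, hx', ← beta2_eq h hNx hv hsm h0] at hjet
  obtain ⟨U, f, hxU, hf⟩ := hcurve _ hx
  have hfs : ContDiffAt ℝ ∞ (fun z ↦ f (ψ z)) 0 :=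
    (((hf.smooth.contMDiffAt (hf.isOpen.mem_nhds hxU)).comp 0 h.contMDiffAt)).contDiffAt
  have hfd := (hasMFDerivAt_of_comp h (f := f) (smooth_diffAt hfs)).2
  -- With (a, b) the gradient of f, the vector b v₀ - a v₁ is tangent to the curve. Its scalar
  -- product with the normal v₁ is -a, so a = 0 and the curve is horizontal at the origin.
  have hf0 : pd 0 (fun z ↦ f (ψ z)) 0 = 0 := by
    set a := pd 0 (fun z ↦ f (ψ z)) 0
    set b := pd 1 (fun z ↦ f (ψ z)) 0
    have hw := hNn _ hx U f hxU hf (b • vec ψ 0 0 - a • vec ψ 1 0) (by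
      rw [map_sub, map_smul, map_smul, hfd, hfd]
      exact sub_eq_zero.2 (show b * a = a * b from mul_comm b a))
    rw [← hv, inner_sub_right, real_inner_smul_right, real_inner_smul_right,
      show (inner ℝ (vec ψ 1 0) (vec ψ 0 0) : ℝ) = 0 from by rw [← horth, met_symm]; rfl,
      show (inner ℝ (vec ψ 1 0) (vec ψ 1 0) : ℝ) = 1 from hunit] at hw
    linarith
  have hf1 : pd 1 (fun z ↦ f (ψ z)) 0 ≠ 0 := by
    intro h1
    apply hf.regular _ hxU hx
    ext v
    obtain ⟨a, b, rfl⟩ := exists_coords h v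
    rw [map_add, map_smul, map_smul, hfd, hfd, hf0, h1]
    exact (by ring : a * 0 + b * 0 = (0 : ℝ))
  have hcont : ContinuousAt ψ 0 := h.contMDiffAt.continuousAt
  obtain ⟨hp, hq⟩ := hessian_eq_zero hjet hfs ((hf.zero_iff _ hxU).1 hx) hf0 hf1
    (.of_forall hmin) (by
      filter_upwards [hcont.preimage_mem_nhds (hf.isOpen.mem_nhds hxU)] with z hz hz0
      exact (hf.zero_iff _ hz).2 hz0)
  rw [hp, hq] at hjet
  exact hjet

/-- The jet of the area density in a parametrization in normal form. -/
lemma dens_hasJet (h : IsLocalDiffeomorphAt 𝓘(ℝ, E2) (𝓡∂ 2) ∞ ψ 0) {K : ℝ}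
    (h00 : HasJet (met ψ 0 0) 1 0 0 0 0 (-(2 * K))) (h01 : HasJet (met ψ 0 1) 0 0 0 0 0 0)
    (h11 : HasJet (met ψ 1 1) 1 0 0 0 0 0) : HasJet (dens ψ) 1 0 0 0 0 (-K) := by
  have hd := dens_contDiffAt h
  have hj := hasJet_self hd
  -- The density is a square root; its jet is found by comparing coefficients in ρ² = det g together
  -- with ρ > 0.
  have hsq := hj.mul hj
  have hdet : HasJet (fun z ↦ met ψ 0 0 z * met ψ 1 1 z + -1 * (met ψ 0 1 z * met ψ 0 1 z))
      1 0 0 0 0 (-(2 * K)) :=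
    ((h00.mul h11).add ((hasJet_quadPoly (-1) 0 0 0 0 0).mul (h01.mul h01))).of_eq
      (by ring) (by ring) (by ring) (by ring) (by ring) (by ring) |>.congr
      (.of_forall fun z ↦ by simp [quadPoly])
  have he : (fun z ↦ met ψ 0 0 z * met ψ 1 1 z + -1 * (met ψ 0 1 z * met ψ 0 1 z)) =ᶠ[𝓝 0]
      fun z ↦ dens ψ z * dens ψ z := by
    filter_upwards [eventually_isLocalDiffeomorphAt h] with z hz
    have := metMat_det_pos hz
    rw [dens, Real.mul_self_sqrt this.le, Matrix.det_fin_two, metMat]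
    simp [met_symm ψ 1 0]; ring
  have e1 := (hasJet_iff hsq.contDiffAt).1 hsq
  have e2 := (hasJet_iff hsq.contDiffAt).1 (hdet.congr he)
  obtain ⟨a1, a2, a3, a4, a5, a6⟩ := e1
  obtain ⟨b1, b2, b3, b4, b5, b6⟩ := e2
  rw [b1] at a1; rw [b2] at a2; rw [b3] at a3; rw [b4] at a4; rw [b5] at a5; rw [b6] at a6
  have hp := dens_pos h
  have c1 : dens ψ 0 = 1 := by nlinarith
  rw [c1] at a2 a3 a4 a5 a6 hj
  have c2 : pd 0 (dens ψ) 0 = 0 := by linarith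
  have c3 : pd 1 (dens ψ) 0 = 0 := by linarith
  simp only [c2, c3] at a4 a5 a6 hj
  refine hj.of_eq rfl rfl rfl ?_ ?_ ?_ <;> linarith

/-- Coefficients are compared in ρ · ρ⁻¹ = 1. -/
lemma inv_dens_hasJet (h : IsLocalDiffeomorphAt 𝓘(ℝ, E2) (𝓡∂ 2) ∞ ψ 0) {K : ℝ}
    (hj : HasJet (dens ψ) 1 0 0 0 0 (-K)) : HasJet (fun z ↦ (dens ψ z)⁻¹) 1 0 0 0 0 K := by
  have hd := dens_contDiffAt h
  have hi : ContDiffAt ℝ ∞ (fun z ↦ (dens ψ z)⁻¹) 0 := hd.inv (dens_pos h).ne'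
  have hk := hasJet_self hi
  have hm := hj.mul hk
  have h1 : HasJet (fun z ↦ dens ψ z * (dens ψ z)⁻¹) 1 0 0 0 0 0 :=
    (hasJet_quadPoly 1 0 0 0 0 0).congr (by
      filter_upwards [eventually_isLocalDiffeomorphAt h] with z hz
      rw [mul_inv_cancel₀ (dens_pos hz).ne']; simp [quadPoly])
  obtain ⟨a1, a2, a3, a4, a5, a6⟩ := (hasJet_iff hm.contDiffAt).1 hm
  obtain ⟨b1, b2, b3, b4, b5, b6⟩ := (hasJet_iff hm.contDiffAt).1 h1
  rw [b1] at a1; rw [b2] at a2; rw [b3] at a3; rw [b4] at a4; rw [b5] at a5; rw [b6] at a6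
  have c1 : dens ψ 0 = 1 := ((hasJet_iff hd).1 hj).1
  rw [c1] at a2 a3 a4 a5 a6 hk
  refine hk.of_eq ?_ ?_ ?_ ?_ ?_ ?_ <;> norm_num at * <;> linarith

/-- The jets of the contravariant metric density in a parametrization in normal form. -/
lemma coMet_hasJet (h : IsLocalDiffeomorphAt 𝓘(ℝ, E2) (𝓡∂ 2) ∞ ψ 0) {K : ℝ}
    (h00 : HasJet (met ψ 0 0) 1 0 0 0 0 (-(2 * K))) (h01 : HasJet (met ψ 0 1) 0 0 0 0 0 0)
    (h11 : HasJet (met ψ 1 1) 1 0 0 0 0 0) :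
    HasJet (coMet ψ 0 0) 1 0 0 0 0 K ∧ HasJet (coMet ψ 0 1) 0 0 0 0 0 0 ∧
      HasJet (coMet ψ 1 1) 1 0 0 0 0 (-K) := by
  have hi := inv_dens_hasJet h (dens_hasJet h h00 h01 h11)
  -- Since ρ² = det g, one has ρ g⁻¹ = ρ⁻¹ adj(g), so the jets are products of known ones.
  have key : ∀ᶠ z in 𝓝 0, (dens ψ z)⁻¹ = dens ψ z * ((metMat ψ z).det)⁻¹ := by
    filter_upwards [eventually_isLocalDiffeomorphAt h] with z hz
    have hp := metMat_det_pos hz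
    have : (metMat ψ z).det = dens ψ z * dens ψ z := (Real.mul_self_sqrt hp.le).symm
    rw [this]
    have := (dens_pos hz).ne'
    field_simp
  refine ⟨((hi.mul h11).of_eq ?_ ?_ ?_ ?_ ?_ ?_).congr ?_,
    (((hasJet_quadPoly (-1) 0 0 0 0 0).mul (hi.mul h01)).of_eq ?_ ?_ ?_ ?_ ?_ ?_).congr ?_,
    ((hi.mul h00).of_eq ?_ ?_ ?_ ?_ ?_ ?_).congr ?_⟩
  case refine_7 | refine_14 | refine_21 =>
    filter_upwards [key] with z hz
    simp only [coMet, (metMat_inv ψ z).1, (metMat_inv ψ z).2.1, (metMat_inv ψ z).2.2.2, quadPoly]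
    rw [hz]; ring
  all_goals ring

end Field

/-! ### Choice of gauge and estimates from the first axis. -/

section Gauge

lemma hasDerivAt_vertical {F : Type*} [NormedAddCommGroup F] [NormedSpace ℝ F] {f : E2 → F}
    {s t : ℝ} (hf : DifferentiableAt ℝ f !₂[s, t]) :
    HasDerivAt (fun y ↦ f !₂[s, y]) (pd 1 f !₂[s, t]) t := by
  have hl : HasDerivAt (fun y : ℝ ↦ (!₂[s, y] : E2)) (stdVec 1) t := by
    have e : (fun y : ℝ ↦ (!₂[s, y] : E2)) = fun y ↦ !₂[s, 0] + y • stdVec 1 := by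
      funext y; ext i; fin_cases i <;> simp [stdVec]
    rw [e]
    simpa using ((hasDerivAt_id t).smul_const (stdVec 1)).const_add (!₂[s, 0] : E2)
  exact HasFDerivAt.comp_hasDerivAt (f := fun y : ℝ ↦ (!₂[s, y] : E2)) t hf.hasFDerivAt hl

lemma hasDerivAt_horizontal {F : Type*} [NormedAddCommGroup F] [NormedSpace ℝ F] {f : E2 → F}
    {s t : ℝ} (hf : DifferentiableAt ℝ f !₂[s, t]) :
    HasDerivAt (fun y ↦ f !₂[y, t]) (pd 0 f !₂[s, t]) s := by
  have hl : HasDerivAt (fun y : ℝ ↦ (!₂[y, t] : E2)) (stdVec 0) s := by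
    have e : (fun y : ℝ ↦ (!₂[y, t] : E2)) = fun y ↦ !₂[0, t] + y • stdVec 0 := by
      funext y; ext i; fin_cases i <;> simp [stdVec]
    rw [e]
    simpa using ((hasDerivAt_id s).smul_const (stdVec 0)).const_add (!₂[0, t] : E2)
  exact HasFDerivAt.comp_hasDerivAt (f := fun y : ℝ ↦ (!₂[y, t] : E2)) s hf.hasFDerivAt hl

lemma plane_eta (z : E2) : (!₂[z 0, z 1] : E2) = z := by
  ext i; fin_cases i <;> simp

/-- A smooth compactly supported function on the plane has a smooth primitive in the second
variable. -/
lemma exists_vertical_primitive {a : E2 → ℝ} (ha : ContDiff ℝ ∞ a) (hc : HasCompactSupport a) :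
    ∃ θ : E2 → ℝ, ContDiff ℝ ∞ θ ∧ pd 1 θ = a := by
  let g : E2 → ℝ → ℝ := fun z τ ↦ a !₂[z 0, τ]
  -- Convolution in the second variable with the indicator of the half line is integration from -∞;
  -- smoothness jointly with the first variable comes from the theory of parametric convolutions.
  let H : ℝ → ℝ := (Set.Ici 0).indicator 1
  let L := ContinuousLinearMap.mul ℝ ℝ
  obtain ⟨k, hk, hkz⟩ : ∃ k : Set ℝ, IsCompact k ∧ ∀ p x, x ∉ k → g p x = 0 := by
    refine ⟨(fun z : E2 ↦ z 1) '' tsupport a, hc.image (coord_contDiff 1).continuous, ?_⟩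
    intro p x hx
    by_contra h0
    exact hx ⟨!₂[p 0, x], subset_tsupport _ h0, by simp⟩
  have hg : ContDiff ℝ ∞ ↿g := by
    refine ha.comp ((contDiff_euclidean (𝕜 := ℝ)).2 fun i ↦ ?_)
    fin_cases i
    · change ContDiff ℝ ∞ fun x : E2 × ℝ ↦ x.1 0
      exact (coord_contDiff 0).comp contDiff_fst
    · exact contDiff_snd
  have hgz (z : E2) : Continuous (g z) :=
    hg.continuous.comp (f := fun τ : ℝ ↦ (z, τ)) (by fun_prop)
  have hH : LocallyIntegrable H volume := by
    refine (locallyIntegrable_const (1 : ℝ)).indicator measurableSet_Ici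
  have hsm : ContDiff ℝ ∞ (fun z : E2 ↦ (convolution H (g z) L volume) (z 1)) := by
    rw [← contDiffOn_univ]
    exact contDiffOn_convolution_right_with_param_comp (n := ⊤) L
      (coord_contDiff 1).contDiffOn isOpen_univ hk (fun p x _ hx ↦ hkz p x hx) hH hg.contDiffOn
  have hint (z : E2) : Integrable (g z) volume :=
    (hgz z).integrable_of_hasCompactSupport (HasCompactSupport.intro hk fun x hx ↦ hkz z x hx)
  have hval (z : E2) (x : ℝ) : (convolution H (g z) L volume) x = ∫ τ in Set.Iic x, g z τ := by
    rw [convolution_eq_swap, ← integral_indicator measurableSet_Iic]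
    refine integral_congr_ae (.of_forall fun τ ↦ ?_)
    by_cases hτ : τ ≤ x
    · simp [H, L, Set.indicator, hτ]
    · simp [H, L, Set.indicator, hτ]
  refine ⟨_, hsm, funext fun z ↦ ?_⟩
  have hd := hasDerivAt_vertical (hsm.differentiable (by simp) !₂[z 0, z 1])
  have hd2 : HasDerivAt (fun y : ℝ ↦ (convolution H (g !₂[z 0, y]) L volume)
      ((!₂[z 0, y] : E2) 1)) (a z) (z 1) := by
    have e : (fun y : ℝ ↦ (convolution H (g !₂[z 0, y]) L volume) ((!₂[z 0, y] : E2) 1)) =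
        fun y ↦ (∫ τ in Set.Iic 0, g z τ) + ∫ τ in (0 : ℝ)..y, g z τ := by
      funext y
      rw [hval, ← intervalIntegral.integral_Iic_sub_Iic (hint z).integrableOn
        (hint z).integrableOn]
      simp [g]
    rw [e]
    have h1 := intervalIntegral.integral_hasDerivAt_right (f := g z) (a := 0) (b := z 1)
      ((hgz z).intervalIntegrable _ _) ((hgz z).stronglyMeasurableAtFilter _ _)
      (hgz z).continuousAt
    have h2 : g z (z 1) = a z := by simp only [g, plane_eta]
    rw [h2] at h1
    exact h1.const_add _
  rw [plane_eta] at hd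
  exact hd.unique hd2

/-- A smooth function near the origin agrees there with a compactly supported one. -/
lemma exists_cutoff {a : E2 → ℝ} (ha : ∀ᶠ z in 𝓝 0, ContDiffAt ℝ ∞ a z) :
    ∃ f : E2 → ℝ, ContDiff ℝ ∞ f ∧ HasCompactSupport f ∧ f =ᶠ[𝓝 0] a := by
  obtain ⟨r, hr, hra⟩ := Metric.eventually_nhds_iff_ball.1 ha
  let χ : ContDiffBump (0 : E2) := ⟨r / 3, r / 2, by positivity, by linarith⟩
  refine ⟨fun z ↦ χ z * a z, contDiff_iff_contDiffAt.2 fun z ↦ ?_,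
    χ.hasCompactSupport.mul_right, ?_⟩
  · by_cases hz : z ∈ tsupport χ
    · refine χ.contDiff.contDiffAt.mul (hra z ?_)
      rw [χ.tsupport_eq] at hz
      exact Metric.closedBall_subset_ball (by simp only [χ]; linarith) hz
    · refine contDiffAt_const (c := (0 : ℝ)) |>.congr_of_eventuallyEq ?_
      filter_upwards [notMem_tsupport_iff_eventuallyEq.1 hz] with y hy
      simp [hy]
  · filter_upwards [χ.eventuallyEq_one] with z hz
    simp [hz]

/-- A gauge in which the second component of a one-form vanishes near the origin, as does the
first component along the first axis. -/
lemma exists_gauge {a0 a1 : E2 → ℝ} (h0 : ∀ᶠ z in 𝓝 0, ContDiffAt ℝ ∞ a0 z)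
    (h1 : ∀ᶠ z in 𝓝 0, ContDiffAt ℝ ∞ a1 z) :
    ∃ θ : E2 → ℝ, ContDiff ℝ ∞ θ ∧ pd 1 θ =ᶠ[𝓝 0] a1 ∧
      ∀ᶠ z in 𝓝 0, z 1 = 0 → pd 0 θ z = a0 z := by
  obtain ⟨f0, hf0, -, e0⟩ := exists_cutoff h0
  obtain ⟨f1, hf1, hc1, e1⟩ := exists_cutoff h1
  obtain ⟨θ, hθ, hθ1⟩ := exists_vertical_primitive hf1 hc1
  -- A primitive of g, as a function of the first variable alone, corrects ∂₀θ on the axis and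
  -- leaves ∂₁θ untouched.
  let g : ℝ → ℝ := fun s ↦ f0 !₂[s, 0] - pd 0 θ !₂[s, 0]
  have hl : ContDiff ℝ ∞ (fun s : ℝ ↦ (!₂[s, 0] : E2)) := by
    refine (contDiff_euclidean (𝕜 := ℝ)).2 fun i ↦ ?_
    fin_cases i
    · exact contDiff_id
    · exact contDiff_const
  have hg : ContDiff ℝ ∞ g := (hf0.comp hl).sub ((pd_contDiff hθ 0).comp hl)
  let G : ℝ → ℝ := fun s ↦ ∫ x in (0 : ℝ)..s, g x
  have hGd (s : ℝ) : HasDerivAt G (g s) s :=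
    intervalIntegral.integral_hasDerivAt_right (hg.continuous.intervalIntegrable _ _)
      (hg.continuous.stronglyMeasurableAtFilter _ _) hg.continuous.continuousAt
  have hG : ContDiff ℝ ∞ G := by
    refine contDiff_infty_iff_deriv.2 ⟨fun s ↦ (hGd s).differentiableAt, ?_⟩
    rwa [show deriv G = g from funext fun s ↦ (hGd s).deriv]
  have hG2 : ContDiff ℝ ∞ (fun z : E2 ↦ G (z 0)) := hG.comp (coord_contDiff 0)
  have hpd (i : Fin 2) (z : E2) : pd i (fun z : E2 ↦ G (z 0)) z = if i = 0 then g (z 0) else 0 := by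
    have h := ((hGd (z 0)).comp_hasFDerivAt z
      (EuclideanSpace.proj (𝕜 := ℝ) (0 : Fin 2) : E2 →L[ℝ] ℝ).hasFDerivAt).fderiv
    change fderiv ℝ (G ∘ (EuclideanSpace.proj (𝕜 := ℝ) (0 : Fin 2) : E2 →L[ℝ] ℝ)) z (stdVec i) = _
    rw [h]
    fin_cases i <;> simp [stdVec]
  have hadd (i : Fin 2) (z : E2) := pd_add (hθ.differentiable (by simp) z)
    (hG2.differentiable (by simp) z) i
  refine ⟨fun z ↦ θ z + G (z 0), hθ.add hG2, ?_, ?_⟩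
  · filter_upwards [e1] with z hz
    rw [hadd, hpd, hθ1, hz]; simp
  · filter_upwards [e0] with z hz hz1
    have hze : (!₂[z 0, 0] : E2) = z := by rw [← hz1]; exact plane_eta z
    rw [hadd, hpd]
    simp only [if_true, g, hze, hz]
    ring

/-- A function vanishing on the first axis is controlled by its second derivative. -/
lemma vertical_bound {f : E2 → ℝ} {n : ℕ} (hf : ContDiffAt ℝ ∞ f 0) (h : Van n (pd 1 f))
    (h0 : ∀ᶠ z in 𝓝 0, z 1 = 0 → f z = 0) :
    ∃ C : ℝ, 0 ≤ C ∧ ∀ᶠ z in 𝓝 0, |f z| ≤ C * (|z 1| * ‖z‖ ^ n) := by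
  obtain ⟨C, hC, r0, hr0, hb⟩ := h.bound
  obtain ⟨r1, hr1, hd⟩ := Metric.eventually_nhds_iff.1 (eventually_differentiableAt hf)
  obtain ⟨r2, hr2, hz⟩ := Metric.eventually_nhds_iff.1 h0
  refine ⟨C, hC, ?_⟩
  filter_upwards [Metric.ball_mem_nhds (0 : E2) (show 0 < min r0 (min r1 r2) by positivity)]
    with z hzb
  rw [mem_ball_zero_iff, lt_min_iff, lt_min_iff] at hzb
  have hnorm (y : ℝ) (hy : y ∈ Set.uIcc 0 (z 1)) : ‖(!₂[z 0, y] : E2)‖ ≤ ‖z‖ := by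
    have hy' : |y| ≤ |z 1| := by
      have := Set.abs_sub_left_of_mem_uIcc hy
      simpa using this
    rw [EuclideanSpace.norm_eq, EuclideanSpace.norm_eq]
    refine Real.sqrt_le_sqrt ?_
    simp only [Fin.sum_univ_two, Real.norm_eq_abs, Matrix.cons_val_zero, Matrix.cons_val_one]
    gcongr
  -- Mean value inequality on the vertical segment from the axis to z: its length supplies the
  -- factor `|z 1|`, and no point on it has larger norm than z.
  have key := (convex_uIcc (0 : ℝ) (z 1)).norm_image_sub_le_of_norm_hasDerivWithin_le
    (f := fun y ↦ f !₂[z 0, y]) (f' := fun y ↦ pd 1 f !₂[z 0, y]) (C := C * ‖z‖ ^ n)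
    (x := 0) (y := z 1)
    (fun y hy ↦ (hasDerivAt_vertical (hd (by
      rw [dist_zero_right]; exact (hnorm y hy).trans_lt hzb.2.1))).hasDerivWithinAt)
    (fun y hy ↦ (hb _ ((hnorm y hy).trans_lt hzb.1)).trans (by
      gcongr; exact hnorm y hy))
    (Set.left_mem_uIcc) (Set.right_mem_uIcc)
  have e0 : f !₂[z 0, 0] = 0 := hz (y := !₂[z 0, 0]) (by
    rw [dist_zero_right]; exact (hnorm 0 Set.left_mem_uIcc).trans_lt hzb.2.2) (by simp)
  rw [plane_eta, e0, sub_zero, sub_zero, Real.norm_eq_abs, Real.norm_eq_abs] at key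
  refine key.trans (le_of_eq (by ring))

end Gauge

/-! ### Gauge covariance and expansion around the model operator. -/

section PlaneExpansion

lemma pd_ofReal {f : E2 → ℝ} {z : E2} (hf : DifferentiableAt ℝ f z) (i : Fin 2) :
    pd i (fun y ↦ (f y : ℂ)) z = ((pd i f z : ℝ) : ℂ) := by
  have := (Complex.ofRealCLM.hasFDerivAt.comp z hf.hasFDerivAt).fderiv
  change fderiv ℝ (Complex.ofRealCLM ∘ f) z (stdVec i) = _
  rw [this]; rfl

lemma pd_cexp {f : E2 → ℂ} {z : E2} (hf : DifferentiableAt ℝ f z) (i : Fin 2) :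
    pd i (fun y ↦ Complex.exp (f y)) z = Complex.exp (f z) * pd i f z := by
  rw [pd, hf.hasFDerivAt.cexp.fderiv]; rfl

/-- The phase of a gauge transformation. -/
def phase (h : ℝ) (θ : E2 → ℝ) (z : E2) : ℂ := Complex.exp ((Complex.I / h) * (θ z : ℂ))

lemma norm_phase (h : ℝ) (θ : E2 → ℝ) (z : E2) : ‖phase h θ z‖ = 1 := by
  have : (Complex.I / h) * (θ z : ℂ) = ((θ z / h : ℝ) : ℂ) * Complex.I := by push_cast; ring
  rw [phase, this, Complex.norm_exp_ofReal_mul_I]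

lemma phase_contDiff {h : ℝ} {θ : E2 → ℝ} (hθ : ContDiff ℝ ∞ θ) : ContDiff ℝ ∞ (phase h θ) :=
  (contDiff_const.mul (contDiff_iff_contDiffAt.2 fun _ ↦
    contDiffAt_ofReal hθ.contDiffAt)).cexp

/-- Because ih · (i/h) = -1, differentiating e^{iθ/h} subtracts dθ from the potential. The phase has
modulus one, so the gauge costs nothing in norm. -/
lemma planeD_phase {h : ℝ} (hh : h ≠ 0) {θ : E2 → ℝ} (hθ : ContDiff ℝ ∞ θ) (a : E2 → ℝ) (i : Fin 2)
    {u : E2 → ℂ} {z : E2} (hu : DifferentiableAt ℝ u z) :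
    planeD h a i (fun y ↦ phase h θ y * u y) z =
      phase h θ z * planeD h (fun y ↦ a y - pd i θ y) i u z := by
  have h1 : DifferentiableAt ℝ (fun y ↦ (θ y : ℂ)) z :=
    smooth_diffAt (contDiffAt_ofReal hθ.contDiffAt)
  have h2 : pd i (phase h θ) z = phase h θ z * ((Complex.I / h) * ((pd i θ z : ℝ) : ℂ)) := by
    unfold phase
    rw [pd_cexp (h1.const_mul _), pd_const_mul _ h1,
      pd_ofReal (hθ.differentiable (by simp) z)]
  have hh' : (h : ℂ) ≠ 0 := by exact_mod_cast hh
  simp only [planeD]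
  rw [pd_mul ((phase_contDiff hθ).differentiable (by simp) z) hu, h2]
  push_cast
  field_simp
  linear_combination (u z * phase h θ z * ((pd i θ z : ℝ) : ℂ)) * Complex.I_sq

lemma planeH_phase {h : ℝ} (hh : h ≠ 0) {θ : E2 → ℝ} (hθ : ContDiff ℝ ∞ θ) (ρ : E2 → ℝ)
    {G : Fin 2 → Fin 2 → E2 → ℝ} {a : Fin 2 → E2 → ℝ} {u : E2 → ℂ} {z : E2}
    (hG : ∀ i j, ContDiffAt ℝ ∞ (G i j) z) (ha : ∀ i, ContDiffAt ℝ ∞ (a i) z)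
    (hu : ContDiff ℝ ∞ u) :
    planeH h ρ G a (fun y ↦ phase h θ y * u y) z =
      phase h θ z * planeH h ρ G (fun i y ↦ a i y - pd i θ y) u z := by
  have e (i : Fin 2) : (fun y ↦ ∑ j, (G i j y : ℂ) * planeD h (a j) j
      (fun y ↦ phase h θ y * u y) y) = fun y ↦ phase h θ y *
        ∑ j, (G i j y : ℂ) * planeD h (fun y ↦ a j y - pd j θ y) j u y := by
    funext y
    rw [Finset.mul_sum]
    refine Finset.sum_congr rfl fun j _ ↦ ?_
    rw [planeD_phase hh hθ _ _ (hu.differentiable (by simp) y)]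
    ring
  simp only [planeH, e]
  have hs (i : Fin 2) : DifferentiableAt ℝ
      (fun y ↦ ∑ j, (G i j y : ℂ) * planeD h (fun y ↦ a j y - pd j θ y) j u y) z :=
    smooth_diffAt (ContDiffAt.sum fun j _ ↦ (contDiffAt_ofReal (hG i j)).mul
      (planeD_contDiffAt ((ha j).sub (pd_contDiff hθ j).contDiffAt) hu.contDiffAt j))
  simp only [planeD_phase hh hθ _ _ (hs _)]
  rw [← Finset.mul_sum]
  ring

/-- The model operator `ih∂₀ + b x₁`. -/
def modelD (h b : ℝ) (w : E2 → ℂ) (z : E2) : ℂ :=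
  Complex.I * h * pd 0 w z + ((b * z 1 : ℝ) : ℂ) * w z

lemma modelD_contDiff {h b : ℝ} {w : E2 → ℂ} (hw : ContDiff ℝ ∞ w) :
    ContDiff ℝ ∞ (modelD h b w) :=
  contDiff_iff_contDiffAt.2 fun _ ↦ planeD_contDiffAt
    (contDiffAt_const.mul (coord_contDiff 1).contDiffAt) hw.contDiffAt 0

/-- Expansion of the magnetic Laplacian around the model operator. -/
lemma planeH_expand {h b : ℝ} {ρ γ : E2 → ℝ} {G : Fin 2 → Fin 2 → E2 → ℝ} {a : Fin 2 → E2 → ℝ}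
    {w : E2 → ℂ} {z : E2} (hG : ∀ i j, ContDiffAt ℝ ∞ (G i j) z) (hsymm : G 1 0 = G 0 1)
    (hγ : ContDiffAt ℝ ∞ γ z) (ha0 : a 0 =ᶠ[𝓝 z] fun y ↦ b * y 1 + γ y) (ha1 : a 1 =ᶠ[𝓝 z] 0)
    (hw : ContDiff ℝ ∞ w) :
    planeH h ρ G a w z = ((ρ z)⁻¹ : ℝ) * (
      G 0 0 z * (modelD h b (modelD h b w) z + 2 * γ z * modelD h b w z
          + (Complex.I * h * pd 0 γ z + γ z ^ 2) * w z)
      + Complex.I * h * (pd 0 (G 0 0) z + pd 1 (G 0 1) z) * (modelD h b w z + γ z * w z)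
      + G 0 1 z * (-2 * h ^ 2 * pd 1 (pd 0 w) z
          + Complex.I * h * (2 * (b * z 1 + γ z) * pd 1 w z + (b + pd 1 γ z) * w z))
      - h ^ 2 * (pd 0 (G 0 1) z + pd 1 (G 1 1) z) * pd 1 w z
      - h ^ 2 * G 1 1 z * pd 1 (pd 1 w) z) := by
  have hu := modelD_contDiff (h := h) (b := b) hw
  have dw := hw.differentiable (by simp)
  have du := hu.differentiable (by simp)
  have dwi (i : Fin 2) := (pd_contDiff hw i).differentiable (by simp)
  have dG (i j : Fin 2) : DifferentiableAt ℝ (fun y ↦ (G i j y : ℂ)) z :=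
    smooth_diffAt (contDiffAt_ofReal (hG i j))
  have dγ : DifferentiableAt ℝ (fun y ↦ (γ y : ℂ)) z := smooth_diffAt (contDiffAt_ofReal hγ)
  have dt : DifferentiableAt ℝ (fun y : E2 ↦ ((b * y 1 : ℝ) : ℂ)) z :=
    smooth_diffAt (contDiffAt_ofReal (contDiffAt_const.mul (coord_contDiff 1).contDiffAt))
  have ptb : pd 1 (fun y : E2 ↦ ((b * y 1 : ℝ) : ℂ)) z = b := by
    rw [pd_ofReal (((coord_contDiff 1).differentiable (by simp) z).const_mul b),
      pd_const_mul b ((coord_contDiff 1).differentiable (by simp) z), pd_coord]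
    simp
  have dtw : DifferentiableAt ℝ (fun y : E2 ↦ ((b * y 1 : ℝ) : ℂ) * w y) z := dt.mul (dw z)
  have dsw : DifferentiableAt ℝ (fun y ↦ Complex.I * h * pd 0 w y) z := (dwi 0 z).const_mul _
  have dγw : DifferentiableAt ℝ (fun y ↦ (γ y : ℂ) * w y) z := dγ.mul (dw z)
  have dp : DifferentiableAt ℝ (fun y ↦ modelD h b w y + γ y * w y) z :=
    (du z).add (dγ.mul (dw z))
  have dq : DifferentiableAt ℝ (fun y ↦ Complex.I * h * pd 1 w y) z := (dwi 1 z).const_mul _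
  have dGp (i : Fin 2) : DifferentiableAt ℝ
      (fun y ↦ (G i 0 y : ℂ) * (modelD h b w y + γ y * w y)) z := (dG i 0).mul dp
  have dGq (i : Fin 2) : DifferentiableAt ℝ
      (fun y ↦ (G i 1 y : ℂ) * (Complex.I * h * pd 1 w y)) z := (dG i 1).mul dq
  have e0 : planeD h (a 0) 0 w =ᶠ[𝓝 z] fun y ↦ modelD h b w y + γ y * w y := by
    filter_upwards [ha0] with y hy
    simp only [planeD, modelD, hy]
    push_cast; ring
  have e1 : planeD h (a 1) 1 w =ᶠ[𝓝 z] fun y ↦ Complex.I * h * pd 1 w y := by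
    filter_upwards [ha1] with y hy
    simp [planeD, hy]
  have ef (i : Fin 2) : (fun y ↦ ∑ j, (G i j y : ℂ) * planeD h (a j) j w y) =ᶠ[𝓝 z]
      fun y ↦ G i 0 y * (modelD h b w y + γ y * w y) + G i 1 y * (Complex.I * h * pd 1 w y) := by
    filter_upwards [e0, e1] with y h0 h1
    rw [Fin.sum_univ_two, h0, h1]
  have pf (i k : Fin 2) : pd k (fun y ↦ ∑ j, (G i j y : ℂ) * planeD h (a j) j w y) z =
      pd k (G i 0) z * (modelD h b w z + γ z * w z)
        + G i 0 z * (pd k (modelD h b w) z + (pd k γ z * w z + γ z * pd k w z))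
        + (pd k (G i 1) z * (Complex.I * h * pd 1 w z)
        + G i 1 z * (Complex.I * h * pd k (pd 1 w) z)) := by
    rw [pd_congr_at (ef i), pd_add (dGp i) (dGq i), pd_mul (dG i 0) dp,
      pd_mul (dG i 1) dq, pd_add (du z) dγw, pd_mul dγ (dw z),
      pd_const_mul _ (dwi 1 z), pd_ofReal (smooth_diffAt (hG i 0)),
      pd_ofReal (smooth_diffAt (hG i 1)), pd_ofReal (smooth_diffAt hγ)]
  have pu : pd 1 (modelD h b w) z =
      Complex.I * h * pd 1 (pd 0 w) z + (b * w z + b * z 1 * pd 1 w z) := by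
    change pd 1 (fun y ↦ Complex.I * h * pd 0 w y + ((b * y 1 : ℝ) : ℂ) * w y) z = _
    rw [pd_add dsw dtw, pd_const_mul _ (dwi 0 z), pd_mul dt (dw z), ptb]
    push_cast; ring
  have hcomm : pd 0 (pd 1 w) z = pd 1 (pd 0 w) z := pd_comm hw.contDiffAt 0 1
  have eu : modelD h b (modelD h b w) z =
      Complex.I * h * pd 0 (modelD h b w) z + ((b * z 1 : ℝ) : ℂ) * modelD h b w z := rfl
  have ew : modelD h b w z = Complex.I * h * pd 0 w z + ((b * z 1 : ℝ) : ℂ) * w z := rfl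
  rw [planeH, Fin.sum_univ_two]
  conv_lhs => unfold planeD
  congr 1
  have f0 := (ef 0).eq_of_nhds
  have f1 := (ef 1).eq_of_nhds
  simp only [planeD] at pf f0 f1
  simp only [pf, f0, f1, pu, hcomm, eu, ha0.eq_of_nhds, ha1.eq_of_nhds, hsymm]
  simp only [Pi.zero_apply]
  have hI : Complex.I ^ 2 = -1 := Complex.I_sq
  rw [ew]
  push_cast
  linear_combination (h ^ 2 * (((pd 0 (G 0 1) z : ℝ) + (pd 1 (G 1 1) z : ℝ) : ℂ) * pd 1 w z
    + 2 * G 0 1 z * pd 1 (pd 0 w) z + G 1 1 z * pd 1 (pd 1 w) z) : ℂ) * hI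

end PlaneExpansion

/-! ### Size calculus for families concentrated at the scale (ε³, ε⁴). -/

section Families

/-- Families of functions concentrated near the origin, with the anisotropic scaling
`(ε³, ε⁴)`, which are of size `ε ^ r` up to rapidly decreasing factors in the second variable. -/
def Bd (r : ℕ) (u : ℝ → E2 → ℂ) : Prop :=
  (∀ᶠ ε in 𝓝[>] (0 : ℝ), ∀ z, u ε z ≠ 0 → |z 0| ≤ ε ^ 3 ∧ |z 1| ≤ ε ^ 3) ∧
  ∀ m : ℕ, ∃ C : ℝ, ∀ᶠ ε in 𝓝[>] (0 : ℝ), ∀ z, ‖u ε z‖ * (1 + |z 1| / ε ^ 4) ^ m ≤ C * ε ^ r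

/-- Coefficients with a zero of the given order at the origin and along the first axis. -/
def Co (j n : ℕ) (f : E2 → ℝ) : Prop :=
  ∃ C : ℝ, 0 ≤ C ∧ ∀ᶠ z in 𝓝 0, |f z| ≤ C * (|z 1| ^ j * ‖z‖ ^ n)

lemma eventually_pos_lt {δ : ℝ} (hδ : 0 < δ) : ∀ᶠ ε in 𝓝[>] (0 : ℝ), 0 < ε ∧ ε < δ :=
  Ioo_mem_nhdsGT hδ

namespace Co

lemma mul {j n j' n' : ℕ} {f g : E2 → ℝ} (hf : Co j n f) (hg : Co j' n' g) :
    Co (j + j') (n + n') (fun z ↦ f z * g z) := by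
  obtain ⟨C, hC, h⟩ := hf
  obtain ⟨C', hC', h'⟩ := hg
  refine ⟨C * C', by positivity, ?_⟩
  filter_upwards [h, h'] with z h h'
  rw [abs_mul]
  refine (mul_le_mul h h' (abs_nonneg _) (by positivity)).trans (le_of_eq (by ring))

lemma of_van {n : ℕ} {f : E2 → ℝ} (h : Van n f) : Co 0 n f := by
  obtain ⟨C, hC, r, hr, hb⟩ := h.bound
  refine ⟨C, hC, ?_⟩
  filter_upwards [Metric.ball_mem_nhds (0 : E2) hr] with z hz
  simpa using hb z (mem_ball_zero_iff.1 hz)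

lemma vertical : Co 1 0 (fun z ↦ z 1) :=
  ⟨1, zero_le_one, .of_forall fun z ↦ by simp⟩

lemma of_vertical {f : E2 → ℝ} {n : ℕ} (hf : ContDiffAt ℝ ∞ f 0) (h : Van n (pd 1 f))
    (h0 : ∀ᶠ z in 𝓝 0, z 1 = 0 → f z = 0) : Co 1 n f := by
  obtain ⟨C, hC, hb⟩ := vertical_bound hf h h0
  exact ⟨C, hC, hb.mono fun z hz ↦ by simpa using hz⟩

lemma congr {j n : ℕ} {f g : E2 → ℝ} (hf : Co j n f) (hfg : f =ᶠ[𝓝 0] g) : Co j n g := by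
  obtain ⟨C, hC, h⟩ := hf
  refine ⟨C, hC, ?_⟩
  filter_upwards [h, hfg] with z hz he
  rwa [← he]

end Co

namespace Bd

lemma congr {r : ℕ} {u v : ℝ → E2 → ℂ} (hu : Bd r u)
    (h : ∀ᶠ ε in 𝓝[>] (0 : ℝ), ∀ z, u ε z = v ε z) : Bd r v := by
  refine ⟨?_, fun m ↦ ?_⟩
  · filter_upwards [hu.1, h] with ε h1 h2 z hz
    exact h1 z (by rwa [h2])
  · obtain ⟨C, hC⟩ := hu.2 m
    refine ⟨C, ?_⟩
    filter_upwards [hC, h] with ε h1 h2 z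
    rw [← h2]; exact h1 z

lemma add {r : ℕ} {u v : ℝ → E2 → ℂ} (hu : Bd r u) (hv : Bd r v) :
    Bd r (fun ε z ↦ u ε z + v ε z) := by
  refine ⟨?_, fun m ↦ ?_⟩
  · filter_upwards [hu.1, hv.1] with ε h1 h2 z hz
    by_cases h : u ε z = 0
    · exact h2 z (fun h' ↦ hz (by rw [h, h', add_zero]))
    · exact h1 z h
  · obtain ⟨C, hC⟩ := hu.2 m
    obtain ⟨C', hC'⟩ := hv.2 m
    refine ⟨C + C', ?_⟩
    filter_upwards [hC, hC', eventually_pos_lt one_pos] with ε h1 h2 h3 z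
    have h0 : 0 ≤ (1 + |z 1| / ε ^ 4) ^ m := by have := h3.1; positivity
    calc ‖u ε z + v ε z‖ * (1 + |z 1| / ε ^ 4) ^ m
        ≤ (‖u ε z‖ + ‖v ε z‖) * (1 + |z 1| / ε ^ 4) ^ m :=
          mul_le_mul_of_nonneg_right (norm_add_le _ _) h0
      _ ≤ (C + C') * ε ^ r := by linarith [h1 z, h2 z]

lemma const_mul {r : ℕ} {u : ℝ → E2 → ℂ} (c : ℂ) (hu : Bd r u) : Bd r (fun ε z ↦ c * u ε z) := by
  refine ⟨?_, fun m ↦ ?_⟩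
  · filter_upwards [hu.1] with ε h1 z hz
    exact h1 z (right_ne_zero_of_mul hz)
  · obtain ⟨C, hC⟩ := hu.2 m
    refine ⟨‖c‖ * C, ?_⟩
    filter_upwards [hC] with ε h1 z
    rw [norm_mul, mul_assoc, mul_assoc]
    exact mul_le_mul_of_nonneg_left (h1 z) (norm_nonneg _)

lemma neg {r : ℕ} {u : ℝ → E2 → ℂ} (hu : Bd r u) : Bd r (fun ε z ↦ -u ε z) := by
  simpa using hu.const_mul (-1)

lemma sub {r : ℕ} {u v : ℝ → E2 → ℂ} (hu : Bd r u) (hv : Bd r v) :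
    Bd r (fun ε z ↦ u ε z - v ε z) := by
  simpa [sub_eq_add_neg] using hu.add hv.neg

lemma zero (r : ℕ) : Bd r (fun _ _ ↦ 0) :=
  ⟨.of_forall fun _ _ h ↦ absurd rfl h, fun _ ↦ ⟨0, .of_forall fun _ _ ↦ by simp⟩⟩

lemma sum {ι : Type*} {r : ℕ} (s : Finset ι) {u : ι → ℝ → E2 → ℂ} (h : ∀ i ∈ s, Bd r (u i)) :
    Bd r (fun ε z ↦ ∑ i ∈ s, u i ε z) := by
  classical
  induction s using Finset.induction_on with
  | empty => simpa using zero r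
  | insert a s ha ih =>
    refine ((h a (Finset.mem_insert_self a s)).add
      (ih fun i hi ↦ h i (Finset.mem_insert_of_mem hi))).congr (.of_forall fun ε z ↦ ?_)
    rw [Finset.sum_insert ha]

lemma pow_mul {r : ℕ} {u : ℝ → E2 → ℂ} (k : ℕ) (hu : Bd r u) :
    Bd (r + k) (fun ε z ↦ (ε : ℂ) ^ k * u ε z) := by
  refine ⟨?_, fun m ↦ ?_⟩
  · filter_upwards [hu.1] with ε h1 z hz
    exact h1 z (right_ne_zero_of_mul hz)
  · obtain ⟨C, hC⟩ := hu.2 m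
    refine ⟨C, ?_⟩
    filter_upwards [hC, eventually_pos_lt one_pos] with ε h1 h2 z
    rw [norm_mul, norm_pow, Complex.norm_real, Real.norm_eq_abs, abs_of_pos h2.1, mul_assoc,
      pow_add]
    refine (mul_le_mul_of_nonneg_left (h1 z) (pow_nonneg h2.1.le k)).trans (le_of_eq (by ring))

lemma mono {r r' : ℕ} {u : ℝ → E2 → ℂ} (hu : Bd r u) (h : r' ≤ r) : Bd r' u := by
  refine ⟨hu.1, fun m ↦ ?_⟩
  obtain ⟨C, hC⟩ := hu.2 m
  refine ⟨|C|, ?_⟩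
  filter_upwards [hC, eventually_pos_lt one_pos] with ε h1 h2 z
  refine (h1 z).trans (mul_le_mul (le_abs_self C)
    (pow_le_pow_of_le_one h2.1.le h2.2.le h) (pow_nonneg h2.1.le _) (abs_nonneg _))

lemma norm_le_of_box {ε : ℝ} {z : E2} (h : |z 0| ≤ ε ^ 3 ∧ |z 1| ≤ ε ^ 3) :
    ‖z‖ ≤ 2 * ε ^ 3 := by
  have := norm_plane_le (z 0) (z 1)
  rw [plane_eta] at this
  linarith [h.1, h.2]

/-- Boxes of side ε³ shrink to the origin, so whatever holds near the origin holds on the supports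
of the families for small ε. -/
lemma eventually_box {p : E2 → Prop} (hp : ∀ᶠ z in 𝓝 0, p z) :
    ∀ᶠ ε in 𝓝[>] (0 : ℝ), ∀ z : E2, |z 0| ≤ ε ^ 3 ∧ |z 1| ≤ ε ^ 3 → p z := by
  obtain ⟨r, hr, h⟩ := Metric.eventually_nhds_iff.1 hp
  filter_upwards [eventually_pos_lt (show 0 < min 1 (r / 2) by positivity)] with ε hε z hz
  have h1 : ε ^ 3 ≤ ε := pow_le_of_le_one hε.1.le (hε.2.le.trans (min_le_left _ _)) (by norm_num)
  have h2 : ε < r / 2 := hε.2.trans_le (min_le_right _ _)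
  refine h ?_
  rw [dist_zero_right]
  linarith [norm_le_of_box hz]

/-- A factor `|z 1|` is at most ε⁴ times the weight 1 + |z 1|/ε⁴, which is paid for by one more
power of decay; a factor `‖z‖` is at most 2ε³ on the supporting box. -/
lemma coef_mul {r j n : ℕ} {u : ℝ → E2 → ℂ} {f : E2 → ℝ} (hu : Bd r u) (hf : Co j n f) :
    Bd (r + 4 * j + 3 * n) (fun ε z ↦ (f z : ℂ) * u ε z) := by
  obtain ⟨D, hD, hf⟩ := hf
  refine ⟨?_, fun m ↦ ?_⟩
  · filter_upwards [hu.1] with ε h1 z hz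
    exact h1 z (right_ne_zero_of_mul hz)
  · obtain ⟨C, hC⟩ := hu.2 (m + j)
    refine ⟨D * 2 ^ n * C, ?_⟩
    filter_upwards [hC, eventually_pos_lt one_pos, hu.1, eventually_box hf] with ε h1 h2 h3 h4 z
    have hε := h2.1
    have hC0 : 0 ≤ C * ε ^ r := le_trans (by positivity) (h1 z)
    by_cases hz : u ε z = 0
    · simp only [hz, mul_zero, norm_zero, zero_mul]
      rw [show D * 2 ^ n * C * ε ^ (r + 4 * j + 3 * n) =
        D * 2 ^ n * ε ^ (4 * j + 3 * n) * (C * ε ^ r) by ring]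
      positivity
    have hbox := h3 z hz
    set T := 1 + |z 1| / ε ^ 4 with hT
    have hT0 : 0 ≤ T := by positivity
    have e1 : |z 1| ≤ ε ^ 4 * T := by
      rw [hT, mul_add, mul_div_cancel₀ _ (by positivity)]
      have : 0 < ε ^ 4 := by positivity
      linarith
    have e2 : |f z| ≤ D * ((ε ^ 4 * T) ^ j * (2 * ε ^ 3) ^ n) := by
      refine (h4 z hbox).trans ?_
      gcongr
      exact norm_le_of_box hbox
    rw [norm_mul, Complex.norm_real, Real.norm_eq_abs]
    calc |f z| * ‖u ε z‖ * T ^ m ≤ D * ((ε ^ 4 * T) ^ j * (2 * ε ^ 3) ^ n) * ‖u ε z‖ * T ^ m := by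
          gcongr
      _ = D * 2 ^ n * ε ^ (4 * j + 3 * n) * (‖u ε z‖ * T ^ (m + j)) := by ring_nf
      _ ≤ D * 2 ^ n * ε ^ (4 * j + 3 * n) * (C * ε ^ r) :=
          mul_le_mul_of_nonneg_left (h1 z) (by positivity)
      _ = D * 2 ^ n * C * ε ^ (r + 4 * j + 3 * n) := by ring

/-- A family which vanishes at distances smaller than `ε³ / 2` from the first axis is of size
`ε^∞`. -/
lemma of_far {u : ℝ → E2 → ℂ} (hu : Bd 0 u)
    (h : ∀ᶠ ε in 𝓝[>] (0 : ℝ), ∀ z, u ε z ≠ 0 → ε ^ 3 ≤ 2 * |z 1|) (r : ℕ) : Bd r u := by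
  refine ⟨hu.1, fun m ↦ ?_⟩
  obtain ⟨C, hC⟩ := hu.2 (m + r)
  refine ⟨2 ^ r * C, ?_⟩
  filter_upwards [hC, eventually_pos_lt one_pos, h] with ε h1 h2 h3 z
  have hε := h2.1
  have hC0 : 0 ≤ C * ε ^ 0 := le_trans (by positivity) (h1 z)
  rw [pow_zero, mul_one] at hC0
  by_cases hz : u ε z = 0
  · simp only [hz, norm_zero, zero_mul]
    positivity
  set T := 1 + |z 1| / ε ^ 4 with hT
  have hT0 : 0 ≤ T := by positivity
  -- Where u does not vanish the weight T is at least 1/(2ε), so r spare powers of T are worth a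
  -- factor ε^r.
  have e1 : 1 ≤ 2 * ε * T := by
    have h4 := h3 z hz
    have : 2 * ε * T = 2 * ε + 2 * |z 1| / ε ^ 3 := by
      rw [hT]; field_simp
    rw [this]
    have h5 : 1 ≤ 2 * |z 1| / ε ^ 3 := by rw [le_div_iff₀ (by positivity)]; linarith
    linarith
  calc ‖u ε z‖ * T ^ m ≤ ‖u ε z‖ * T ^ m * (2 * ε * T) ^ r :=
        le_mul_of_one_le_right (by positivity) (one_le_pow₀ e1)
    _ = 2 ^ r * ε ^ r * (‖u ε z‖ * T ^ (m + r)) := by ring_nf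
    _ ≤ 2 ^ r * ε ^ r * (C * ε ^ 0) := mul_le_mul_of_nonneg_left (h1 z) (by positivity)
    _ = 2 ^ r * C * ε ^ r := by ring

end Bd

/-- Smooth functions of one variable supported in the unit interval. -/
structure IsCut (φ : ℝ → ℝ) : Prop where
  smooth : ContDiff ℝ ∞ φ
  eq_zero : ∀ x, 1 < |x| → φ x = 0

namespace IsCut

lemma deriv {φ : ℝ → ℝ} (h : IsCut φ) : IsCut (deriv φ) := by
  refine ⟨(contDiff_infty_iff_deriv.1 h.smooth).2, fun x hx ↦ ?_⟩
  have : φ =ᶠ[𝓝 x] fun _ ↦ 0 := by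
    filter_upwards [continuous_abs.continuousAt.eventually (lt_mem_nhds hx)] with y hy
    exact h.eq_zero y hy
  rw [this.deriv_eq]; simp

lemma iteratedDeriv {φ : ℝ → ℝ} (h : IsCut φ) (n : ℕ) : IsCut (iteratedDeriv n φ) := by
  induction n with
  | zero => simpa using h
  | succ n ih => rw [iteratedDeriv_succ]; exact ih.deriv

lemma bound {φ : ℝ → ℝ} (h : IsCut φ) : ∃ C, ∀ x, |φ x| ≤ C := by
  have hc : HasCompactSupport φ := HasCompactSupport.intro (isCompact_Icc (a := (-1 : ℝ)) (b := 1))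
    fun x hx ↦ h.eq_zero x (by
      by_contra hn
      exact hx (abs_le.1 (not_lt.1 hn)))
  exact hc.exists_bound_of_continuous h.smooth.continuous

end IsCut

-- The exponential series gives e^x ≥ x^n/n!, so the Gaussian absorbs every power of τ; powers of 1
-- + |τ| and polynomials follow by linearity.
open Polynomial in
lemma gaussian_bound {b : ℝ} (hb : 0 < b) (P : ℝ[X]) (m : ℕ) :
    ∃ C, ∀ τ : ℝ, |P.eval τ * Real.exp (-(b * τ ^ 2 / 2))| * (1 + |τ|) ^ m ≤ C := by
  have mono (n : ℕ) : ∃ C, ∀ τ : ℝ, |τ| ^ n * Real.exp (-(b * τ ^ 2 / 2)) ≤ C := by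
    refine ⟨1 + n.factorial * (2 / b) ^ n, fun τ ↦ ?_⟩
    have h1 : |τ| ^ n ≤ 1 + (τ ^ 2) ^ n := by
      rw [← sq_abs, ← pow_mul, mul_comm, pow_mul]
      nlinarith [sq_nonneg (|τ| ^ n - 1), pow_nonneg (abs_nonneg τ) n]
    have h2 := Real.pow_div_factorial_le_exp (b * τ ^ 2 / 2) (by positivity) n
    have h3 : (τ ^ 2) ^ n ≤ n.factorial * (2 / b) ^ n * Real.exp (b * τ ^ 2 / 2) := by
      have e : (τ ^ 2) ^ n = n.factorial * (2 / b) ^ n * ((b * τ ^ 2 / 2) ^ n / n.factorial) := by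
        have h7 : (n.factorial : ℝ) ≠ 0 := by positivity
        have h8 : τ ^ 2 = 2 / b * (b * τ ^ 2 / 2) := by field_simp
        rw [mul_div_assoc', mul_assoc, ← mul_pow, ← h8, mul_div_cancel_left₀ _ h7]
      rw [e]; gcongr
    have h4 : Real.exp (-(b * τ ^ 2 / 2)) ≤ 1 := Real.exp_le_one_iff.2 (by
      have : 0 ≤ b * τ ^ 2 / 2 := by positivity
      linarith)
    have h5 : Real.exp (b * τ ^ 2 / 2) * Real.exp (-(b * τ ^ 2 / 2)) = 1 := by
      rw [← Real.exp_add]; simp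
    have h6 := Real.exp_pos (-(b * τ ^ 2 / 2))
    calc |τ| ^ n * Real.exp (-(b * τ ^ 2 / 2))
        ≤ (1 + n.factorial * (2 / b) ^ n * Real.exp (b * τ ^ 2 / 2)) *
            Real.exp (-(b * τ ^ 2 / 2)) := by gcongr; linarith
      _ = Real.exp (-(b * τ ^ 2 / 2)) + n.factorial * (2 / b) ^ n *
            (Real.exp (b * τ ^ 2 / 2) * Real.exp (-(b * τ ^ 2 / 2))) := by ring
      _ ≤ _ := by rw [h5, mul_one]; linarith
  have step (n m : ℕ) : ∃ C, ∀ τ : ℝ, |τ| ^ n * Real.exp (-(b * τ ^ 2 / 2)) * (1 + |τ|) ^ m ≤ C := by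
    induction m generalizing n with
    | zero => simpa using mono n
    | succ m ih =>
      obtain ⟨C, hC⟩ := ih n
      obtain ⟨C', hC'⟩ := ih (n + 1)
      refine ⟨C + C', fun τ ↦ le_trans (le_of_eq ?_) (add_le_add (hC τ) (hC' τ))⟩
      ring
  induction P using Polynomial.induction_on' with
  | add p q hp hq =>
    obtain ⟨C, hC⟩ := hp
    obtain ⟨C', hC'⟩ := hq
    refine ⟨C + C', fun τ ↦ le_trans ?_ (add_le_add (hC τ) (hC' τ))⟩
    rw [← add_mul, eval_add, add_mul]
    gcongr
    exact abs_add_le _ _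
  | monomial n a =>
    obtain ⟨C, hC⟩ := step n m
    refine ⟨|a| * C, fun τ ↦ le_trans (le_of_eq ?_) (mul_le_mul_of_nonneg_left (hC τ) (abs_nonneg a))⟩
    rw [eval_monomial, abs_mul, abs_mul, abs_pow, abs_of_pos (Real.exp_pos _)]
    ring

end Families

/-! ### Wave packets almost diagonalizing the model operator. -/

section Waves

open Polynomial

/-- The action of the derivative on the polynomial factors of `P e^{-βτ²/2}`. -/
def gaussD (β : ℝ) : ℝ[X] →ₗ[ℝ] ℝ[X] :=
  derivative - LinearMap.mulLeft ℝ (C β * X)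

lemma gaussD_apply (β : ℝ) (P : ℝ[X]) : gaussD β P = derivative P - C β * X * P := rfl

lemma gaussD_X_mul (β : ℝ) (P : ℝ[X]) : gaussD β (X * P) = X * gaussD β P + P := by
  simp only [gaussD_apply, derivative_mul, derivative_X]; ring

/-- `gaussD` is ∂_τ conjugated by the Gaussian, so its commutator with multiplication by X is 1, and
that of its (n+1)-st power is n+1 times the n-th. -/
lemma gaussD_pow_X_mul (β : ℝ) (P : ℝ[X]) (n : ℕ) :
    (gaussD β ^ (n + 1)) (X * P) =
      X * (gaussD β ^ (n + 1)) P + (n + 1 : ℝ) • (gaussD β ^ n) P := by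
  induction n with
  | zero => simp [gaussD_X_mul]
  | succ n ih =>
    rw [pow_succ', Module.End.mul_apply, ih, map_add, gaussD_X_mul, map_smul,
      ← Module.End.mul_apply, ← pow_succ', ← Module.End.mul_apply, ← pow_succ']
    push_cast
    module

/-- A Gaussian wave packet at the scale `(ε³, ε⁴)`, with a cutoff at the scale `ε³` in the second
variable. -/
def packet (β : ℝ) (φ ζ : ℝ → ℝ) (P : ℝ[X]) (ε : ℝ) (z : E2) : ℝ :=
  φ (z 0 / ε ^ 3) * ζ (z 1 / ε ^ 3) *
    (P.eval (z 1 / ε ^ 4) * Real.exp (-(β * (z 1 / ε ^ 4) ^ 2 / 2)))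

variable {β : ℝ} {φ ζ : ℝ → ℝ}

lemma packet_add (P Q : ℝ[X]) (ε : ℝ) (z : E2) :
    packet β φ ζ (P + Q) ε z = packet β φ ζ P ε z + packet β φ ζ Q ε z := by
  simp only [packet, eval_add]; ring

lemma packet_smul (c : ℝ) (P : ℝ[X]) (ε : ℝ) (z : E2) :
    packet β φ ζ (c • P) ε z = c * packet β φ ζ P ε z := by
  simp only [packet, eval_smul, smul_eq_mul]; ring

lemma packet_X_mul (P : ℝ[X]) {ε : ℝ} (hε : ε ≠ 0) (z : E2) :
    z 1 * packet β φ ζ P ε z = ε ^ 4 * packet β φ ζ (X * P) ε z := by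
  simp only [packet, eval_mul, eval_X]; field_simp

lemma packet_contDiff (hφ : ContDiff ℝ ∞ φ) (hζ : ContDiff ℝ ∞ ζ) (P : ℝ[X]) (ε : ℝ) :
    ContDiff ℝ ∞ (packet β φ ζ P ε) := by
  have h0 := (coord_contDiff 0).div_const (ε ^ 3)
  have h1 := (coord_contDiff 1).div_const (ε ^ 3)
  have h2 := (coord_contDiff 1).div_const (ε ^ 4)
  have hP : ContDiff ℝ ∞ (fun x ↦ P.eval x) := P.contDiff_aeval ∞
  exact ((hφ.comp h0).mul (hζ.comp h1)).mul ((hP.comp h2).mul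
    (((contDiff_const.mul (h2.pow 2)).div_const 2).neg.exp))

lemma pd_scaled {f : ℝ → ℝ} (hf : ContDiff ℝ ∞ f) (i j : Fin 2) (c : ℝ) (z : E2) :
    pd i (fun y : E2 ↦ f (y j / c)) z = if i = j then c⁻¹ * deriv f (z j / c) else 0 := by
  have h1 : HasFDerivAt (fun y : E2 ↦ y j / c)
      (c⁻¹ • (EuclideanSpace.proj (𝕜 := ℝ) j : E2 →L[ℝ] ℝ)) z := by
    have := ((EuclideanSpace.proj (𝕜 := ℝ) j : E2 →L[ℝ] ℝ).hasFDerivAt (x := z)).const_mul c⁻¹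
    refine this.congr_of_eventuallyEq (.of_forall fun y ↦ ?_)
    simp [div_eq_inv_mul]
  have h2 := ((hf.differentiable (by simp) (z j / c)).hasDerivAt.comp_hasFDerivAt z h1).fderiv
  change fderiv ℝ (f ∘ fun y : E2 ↦ y j / c) z (stdVec i) = _
  rw [h2]
  by_cases hij : i = j
  · subst hij; simp [stdVec]; ring
  · simp [stdVec, hij, Ne.symm hij]

lemma pd_packet (hφ : ContDiff ℝ ∞ φ) (hζ : ContDiff ℝ ∞ ζ) (P : ℝ[X]) (ε : ℝ) (z : E2) :
    pd 0 (packet β φ ζ P ε) z = (ε ^ 3)⁻¹ * packet β (deriv φ) ζ P ε z ∧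
    pd 1 (packet β φ ζ P ε) z = (ε ^ 4)⁻¹ * packet β φ ζ (gaussD β P) ε z
      + (ε ^ 3)⁻¹ * packet β φ (deriv ζ) P ε z := by
  let g : ℝ → ℝ := fun x ↦ P.eval x * Real.exp (-(β * x ^ 2 / 2))
  have hP : ContDiff ℝ ∞ (fun x ↦ P.eval x) := P.contDiff_aeval ∞
  have hg : ContDiff ℝ ∞ g :=
    hP.mul (((contDiff_const.mul (contDiff_id.pow 2)).div_const 2).neg.exp)
  have dg (x : ℝ) : deriv g x = (gaussD β P).eval x * Real.exp (-(β * x ^ 2 / 2)) := by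
    have h1 : HasDerivAt (fun x : ℝ ↦ -(β * x ^ 2 / 2)) (-(β * x)) x := by
      refine ((((hasDerivAt_pow 2 x).const_mul β).div_const 2).neg).congr_deriv ?_
      push_cast; ring
    have := ((P.hasDerivAt x).mul h1.exp).deriv
    change deriv g x = _ at this
    rw [this]
    simp only [gaussD_apply, eval_sub, eval_mul, eval_C, eval_X]
    ring
  have sm {f : ℝ → ℝ} (hf : ContDiff ℝ ∞ f) (j : Fin 2) (c : ℝ) :
      DifferentiableAt ℝ (fun y : E2 ↦ f (y j / c)) z :=
    (hf.comp ((coord_contDiff j).div_const c)).differentiable (by simp) z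
  have key (i : Fin 2) : pd i (packet β φ ζ P ε) z =
      (pd i (fun y : E2 ↦ φ (y 0 / ε ^ 3)) z * ζ (z 1 / ε ^ 3)
        + φ (z 0 / ε ^ 3) * pd i (fun y : E2 ↦ ζ (y 1 / ε ^ 3)) z) * g (z 1 / ε ^ 4)
      + φ (z 0 / ε ^ 3) * ζ (z 1 / ε ^ 3) * pd i (fun y : E2 ↦ g (y 1 / ε ^ 4)) z := by
    have d1 : DifferentiableAt ℝ (fun y : E2 ↦ φ (y 0 / ε ^ 3) * ζ (y 1 / ε ^ 3)) z :=
      (sm hφ 0 _).mul (sm hζ 1 _)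
    change pd i (fun y : E2 ↦ φ (y 0 / ε ^ 3) * ζ (y 1 / ε ^ 3) * g (y 1 / ε ^ 4)) z = _
    rw [pd_mul d1 (sm hg 1 _), pd_mul (sm hφ 0 _) (sm hζ 1 _)]
  rw [key, key]
  simp only [pd_scaled hφ, pd_scaled hζ, pd_scaled hg, dg]
  simp only [Fin.isValue, if_true, zero_ne_one, one_ne_zero, if_false, packet, g]
  constructor <;> ring

lemma bd_packet (hβ : 0 < β) (hφ : IsCut φ) (hζ : IsCut ζ) (P : ℝ[X]) :
    Bd 0 (fun ε z ↦ (packet β φ ζ P ε z : ℂ)) := by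
  refine ⟨?_, fun m ↦ ?_⟩
  · filter_upwards [eventually_pos_lt one_pos] with ε hε z hz
    have h3 : 0 < ε ^ 3 := pow_pos hε.1 3
    have hz' : packet β φ ζ P ε z ≠ 0 := by exact_mod_cast hz
    constructor
    · by_contra hn
      refine hz' ?_
      rw [packet, hφ.eq_zero _ (by rw [abs_div, abs_of_pos h3, lt_div_iff₀ h3]; linarith)]
      ring
    · by_contra hn
      refine hz' ?_
      rw [packet, hζ.eq_zero _ (by rw [abs_div, abs_of_pos h3, lt_div_iff₀ h3]; linarith)]
      ring
  · obtain ⟨C1, h1⟩ := hφ.bound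
    obtain ⟨C2, h2⟩ := hζ.bound
    obtain ⟨C3, h3⟩ := gaussian_bound hβ P m
    have p1 : 0 ≤ C1 := (abs_nonneg _).trans (h1 0)
    have p2 : 0 ≤ C2 := (abs_nonneg _).trans (h2 0)
    refine ⟨C1 * C2 * C3, ?_⟩
    filter_upwards [eventually_pos_lt one_pos] with ε hε z
    have h4 := h3 (z 1 / ε ^ 4)
    rw [abs_div, abs_of_pos (pow_pos hε.1 4)] at h4
    have hT : 0 ≤ 1 + |z 1| / ε ^ 4 := by have := hε.1; positivity
    rw [Complex.norm_real, packet, norm_mul, norm_mul, pow_zero, mul_one, mul_assoc]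
    exact mul_le_mul (mul_le_mul (h1 _) (h2 _) (abs_nonneg _) p1) h4
      (mul_nonneg (norm_nonneg _) (pow_nonneg hT m)) (mul_nonneg p1 p2)

/-- Packets with a cutoff vanishing near the first axis are negligible. -/
lemma bd_packet_far (hβ : 0 < β) (hφ : IsCut φ) (hζ : IsCut ζ)
    (h0 : ∀ x, |x| < 1 / 2 → ζ x = 0) (P : ℝ[X]) (r : ℕ) :
    Bd r (fun ε z ↦ (packet β φ ζ P ε z : ℂ)) := by
  refine (bd_packet hβ hφ hζ P).of_far ?_ r
  filter_upwards [eventually_pos_lt one_pos] with ε hε z hz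
  have h3 : 0 < ε ^ 3 := pow_pos hε.1 3
  have hz' : packet β φ ζ P ε z ≠ 0 := by exact_mod_cast hz
  by_contra hn
  refine hz' ?_
  rw [packet, h0 _ (by rw [abs_div, abs_of_pos h3, div_lt_iff₀ h3]; linarith)]
  ring

/-- A superposition of wave packets which is almost invariant under the model operator. -/
def wave (β b : ℝ) (φ ζ : ℝ → ℝ) (P : ℝ[X]) (ε : ℝ) (z : E2) : ℂ :=
  ∑ n ∈ Finset.range 9, (Complex.I * ε / b) ^ n / (n.factorial : ℂ) *
    (packet β (iteratedDeriv n φ) ζ ((gaussD β ^ n) P) ε z : ℂ)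

variable {b : ℝ}

lemma wave_add (P Q : ℝ[X]) (ε : ℝ) (z : E2) :
    wave β b φ ζ (P + Q) ε z = wave β b φ ζ P ε z + wave β b φ ζ Q ε z := by
  simp only [wave, map_add, packet_add, Complex.ofReal_add, mul_add, Finset.sum_add_distrib]

lemma wave_smul (c : ℝ) (P : ℝ[X]) (ε : ℝ) (z : E2) :
    wave β b φ ζ (c • P) ε z = c * wave β b φ ζ P ε z := by
  simp only [wave, map_smul, packet_smul, Complex.ofReal_mul, Finset.mul_sum]
  exact Finset.sum_congr rfl fun n _ ↦ by ring

lemma wave_contDiff (hφ : IsCut φ) (hζ : IsCut ζ) (P : ℝ[X]) (ε : ℝ) :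
    ContDiff ℝ ∞ (wave β b φ ζ P ε) :=
  ContDiff.sum fun n _ ↦ contDiff_const.mul (contDiff_iff_contDiffAt.2 fun _ ↦
    contDiffAt_ofReal (packet_contDiff (hφ.iteratedDeriv n).smooth hζ.smooth _ ε).contDiffAt)

lemma pd_wave (hφ : IsCut φ) (hζ : IsCut ζ) (P : ℝ[X]) (ε : ℝ) (z : E2) :
    pd 0 (wave β b φ ζ P ε) z = ((ε : ℂ) ^ 3)⁻¹ * wave β b (deriv φ) ζ P ε z ∧
    pd 1 (wave β b φ ζ P ε) z = ((ε : ℂ) ^ 4)⁻¹ * wave β b φ ζ (gaussD β P) ε z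
      + ((ε : ℂ) ^ 3)⁻¹ * wave β b φ (deriv ζ) P ε z := by
  have hd (n : ℕ) : DifferentiableAt ℝ
      (fun y ↦ (packet β (iteratedDeriv n φ) ζ ((gaussD β ^ n) P) ε y : ℂ)) z :=
    smooth_diffAt (contDiffAt_ofReal
      (packet_contDiff (hφ.iteratedDeriv n).smooth hζ.smooth _ ε).contDiffAt)
  have hr (n : ℕ) := (packet_contDiff (β := β) (hφ.iteratedDeriv n).smooth hζ.smooth
    ((gaussD β ^ n) P) ε).differentiable (by simp) z
  have key (i : Fin 2) : pd i (wave β b φ ζ P ε) z = ∑ n ∈ Finset.range 9,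
      (Complex.I * ε / b) ^ n / (n.factorial : ℂ) *
        (pd i (packet β (iteratedDeriv n φ) ζ ((gaussD β ^ n) P) ε) z : ℝ) := by
    unfold wave
    rw [pd_sum _ fun n _ ↦ (hd n).const_mul _]
    refine Finset.sum_congr rfl fun n _ ↦ ?_
    rw [pd_const_mul _ (hd n), pd_ofReal (hr n)]
  have hp (n : ℕ) := pd_packet (β := β) (hφ.iteratedDeriv n).smooth hζ.smooth
    ((gaussD β ^ n) P) ε z
  rw [key, key]
  simp only [(hp _).1, (hp _).2]
  constructor
  · rw [wave, Finset.mul_sum]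
    refine Finset.sum_congr rfl fun n _ ↦ ?_
    rw [← iteratedDeriv_succ, iteratedDeriv_succ']
    push_cast; ring
  · rw [wave, wave, Finset.mul_sum, Finset.mul_sum, ← Finset.sum_add_distrib]
    refine Finset.sum_congr rfl fun n _ ↦ ?_
    rw [← Module.End.mul_apply (gaussD β), ← pow_succ', pow_succ (gaussD β),
      Module.End.mul_apply]
    push_cast; ring

/-- In scaled variables `wave` is the Taylor polynomial of exp((iε/b)∂_σ∂_τ) applied to cutoff times
Gaussian, and this exponential intertwines bt with ih∂_s + bt. Nine terms leave only the
s-derivative of the last one, of size ε⁸ · ε⁵ = ε¹³; this number is chosen so that applying the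
operator, of size ε⁴, once more leaves ε¹⁷. -/
lemma modelD_wave (hb : b ≠ 0) (hφ : IsCut φ) (hζ : IsCut ζ) (P : ℝ[X]) {ε : ℝ} (hε : ε ≠ 0)
    (z : E2) :
    modelD (ε ^ 8) b (wave β b φ ζ P ε) z = (ε : ℂ) ^ 4 * wave β b φ ζ (b • (X * P)) ε z
      + (ε : ℂ) ^ 13 * ((Complex.I / b) ^ 8 / (Nat.factorial 8 : ℂ) * Complex.I *
        (packet β (iteratedDeriv 9 φ) ζ ((gaussD β ^ 8) P) ε z : ℂ)) := by
  have hd : DifferentiableAt ℝ (wave β b φ ζ P ε) z :=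
    smooth_diffAt (wave_contDiff hφ hζ P ε).contDiffAt
  have hb' : (b : ℂ) ≠ 0 := by exact_mod_cast hb
  have hε' : (ε : ℂ) ≠ 0 := by exact_mod_cast hε
  set c : ℕ → ℂ := fun n ↦ (Complex.I * ε / b) ^ n / (n.factorial : ℂ) with hc
  set a : ℕ → ℂ := fun n ↦
    (packet β (iteratedDeriv n φ) ζ (X * (gaussD β ^ n) P) ε z : ℂ) with ha
  set d : ℕ → ℂ := fun n ↦
    (packet β (iteratedDeriv (n + 1) φ) ζ ((gaussD β ^ n) P) ε z : ℂ) with hdd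
  -- The recursion of exponential coefficients: the s-derivative of term n cancels the commutator
  -- produced by term n+1.
  have hc1 (n : ℕ) : c (n + 1) * (n + 1) * b = c n * (Complex.I * ε) := by
    have : (n.factorial : ℂ) ≠ 0 := by exact_mod_cast n.factorial_ne_zero
    have : (n : ℂ) + 1 ≠ 0 := by exact_mod_cast n.succ_ne_zero
    simp only [hc, Nat.factorial_succ]
    push_cast
    rw [pow_succ]
    field_simp
  have e1 : pd 0 (wave β b φ ζ P ε) z = ((ε : ℂ) ^ 3)⁻¹ * ∑ n ∈ Finset.range 9, c n * d n := by
    rw [(pd_wave hφ hζ P ε z).1, wave]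
    congr 1
    refine Finset.sum_congr rfl fun n _ ↦ ?_
    rw [← iteratedDeriv_succ']
  have e2 : ((b * z 1 : ℝ) : ℂ) * wave β b φ ζ P ε z =
      (ε : ℂ) ^ 4 * (b * ∑ n ∈ Finset.range 9, c n * a n) := by
    rw [wave, Finset.mul_sum, Finset.mul_sum, Finset.mul_sum]
    refine Finset.sum_congr rfl fun n _ ↦ ?_
    have := congrArg (fun x : ℝ ↦ (x : ℂ)) (packet_X_mul (β := β) (φ := iteratedDeriv n φ)
      (ζ := ζ) ((gaussD β ^ n) P) hε z)
    simp only [Complex.ofReal_mul, Complex.ofReal_pow] at this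
    simp only [ha, hc, Complex.ofReal_mul]
    linear_combination (b * ((Complex.I * ε / b) ^ n / (n.factorial : ℂ)) : ℂ) * this
  have e3 : wave β b φ ζ (b • (X * P)) ε z =
      b * (c 0 * a 0 + ∑ n ∈ Finset.range 8, c (n + 1) * (a (n + 1) + (n + 1) * d n)) := by
    have e (n : ℕ) : (Complex.I * ε / b) ^ (n + 1) / ((n + 1).factorial : ℂ) *
        (packet β (iteratedDeriv (n + 1) φ) ζ ((gaussD β ^ (n + 1)) (X * P)) ε z : ℂ) =
        c (n + 1) * (a (n + 1) + (n + 1) * d n) := by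
      rw [gaussD_pow_X_mul, packet_add, packet_smul]
      simp only [ha, hdd, hc]
      push_cast; ring
    rw [wave_smul, wave, Finset.sum_range_succ', add_comm, Finset.sum_congr rfl fun n _ ↦ e n]
    simp [ha, hc]
  have e4 : ∑ n ∈ Finset.range 8, c (n + 1) * (a (n + 1) + (n + 1) * d n) =
      ∑ n ∈ Finset.range 8, c (n + 1) * a (n + 1) +
        (Complex.I * ε / b) * ∑ n ∈ Finset.range 8, c n * d n := by
    rw [Finset.mul_sum, ← Finset.sum_add_distrib]
    refine Finset.sum_congr rfl fun n _ ↦ ?_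
    field_simp
    linear_combination d n * hc1 n
  have e5 : ∑ n ∈ Finset.range 9, c n * a n =
      ∑ n ∈ Finset.range 8, c (n + 1) * a (n + 1) + c 0 * a 0 := Finset.sum_range_succ' _ _
  have e6 : ∑ n ∈ Finset.range 9, c n * d n =
      ∑ n ∈ Finset.range 8, c n * d n + c 8 * d 8 := Finset.sum_range_succ _ _
  have e7 : c 8 * d 8 * (ε : ℂ) ^ 5 * Complex.I = (ε : ℂ) ^ 13 * ((Complex.I / b) ^ 8 /
      (Nat.factorial 8 : ℂ) * Complex.I *
        (packet β (iteratedDeriv 9 φ) ζ ((gaussD β ^ 8) P) ε z : ℂ)) := by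
    simp only [hc, hdd]
    ring
  rw [modelD, e1, e2, e3, e4, e5, e6, ← e7]
  push_cast
  field_simp
  ring

lemma bd_wave_term (hβ : 0 < β) (hφ : IsCut φ) (hζ : IsCut ζ) (P : ℝ[X]) (n : ℕ) :
    Bd n (fun ε z ↦ (Complex.I * ε / b) ^ n / (n.factorial : ℂ) *
      (packet β (iteratedDeriv n φ) ζ ((gaussD β ^ n) P) ε z : ℂ)) := by
  have h := ((bd_packet hβ (hφ.iteratedDeriv n) hζ ((gaussD β ^ n) P)).const_mul
    ((Complex.I / b) ^ n / (n.factorial : ℂ))).pow_mul n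
  rw [zero_add] at h
  refine h.congr (.of_forall fun ε z ↦ ?_)
  rw [mul_div_right_comm, mul_pow]; ring

lemma bd_wave (hβ : 0 < β) (hφ : IsCut φ) (hζ : IsCut ζ) (P : ℝ[X]) :
    Bd 0 (wave β b φ ζ P) :=
  Bd.sum _ fun n _ ↦ (bd_wave_term hβ hφ hζ P n).mono n.zero_le

lemma bd_wave_far (hβ : 0 < β) (hφ : IsCut φ) (hζ : IsCut ζ)
    (h0 : ∀ x, |x| < 1 / 2 → ζ x = 0) (P : ℝ[X]) (r : ℕ) : Bd r (wave β b φ ζ P) := by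
  refine Bd.sum _ fun n _ ↦ ?_
  have h := (((bd_packet_far hβ (hφ.iteratedDeriv n) hζ h0 ((gaussD β ^ n) P) r).const_mul
    ((Complex.I / b) ^ n / (n.factorial : ℂ))).pow_mul n).mono (Nat.le_add_right r n)
  refine h.congr (.of_forall fun ε z ↦ ?_)
  rw [mul_div_right_comm, mul_pow]; ring

/-- To leading order a superposition of wave packets consists of one packet. -/
lemma bd_wave_sub_packet (hβ : 0 < β) (hφ : IsCut φ) (hζ : IsCut ζ) (P : ℝ[X]) :
    Bd 1 (fun ε z ↦ wave β b φ ζ P ε z - packet β φ ζ P ε z) := by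
  have h : Bd 1 (fun ε z ↦ ∑ n ∈ Finset.range 8, (Complex.I * ε / b) ^ (n + 1) /
      ((n + 1).factorial : ℂ) *
      (packet β (iteratedDeriv (n + 1) φ) ζ ((gaussD β ^ (n + 1)) P) ε z : ℂ)) :=
    Bd.sum _ fun n _ ↦ (bd_wave_term hβ hφ hζ P (n + 1)).mono (by omega)
  refine h.congr (.of_forall fun ε z ↦ ?_)
  rw [wave, Finset.sum_range_succ' _ 8]
  simp

end Waves

/-! ### Hermite functions and their first-order perturbation. -/

section Oscillator

open Polynomial

/-- Hermite polynomials for the weight `e^{-βτ²}`. -/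
lemma exists_hermite {β : ℝ} (hβ : 0 < β) (k : ℕ) :
    ∃ p : ℝ[X], p ≠ 0 ∧
      derivative (derivative p) = C (2 * β) * X * derivative p - C (2 * k * β) * p := by
  induction k with
  | zero => exact ⟨1, one_ne_zero, by simp⟩
  | succ k ih =>
    obtain ⟨p, hp, h⟩ := ih
    -- The next Hermite polynomial is the raising operator applied to p. Its derivative is a nonzero
    -- multiple of p, which yields both the differential equation and its not being zero.
    have hd : derivative (C (2 * β) * X * p - derivative p) = C (2 * (k + 1 : ℝ) * β) * p := by
      simp only [derivative_sub, derivative_mul, derivative_C, derivative_X, h]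
      rw [show 2 * (k + 1 : ℝ) * β = 2 * k * β + 2 * β by ring, C_add]
      ring
    refine ⟨C (2 * β) * X * p - derivative p, fun h0 ↦ ?_, ?_⟩
    · rw [h0, derivative_zero] at hd
      have : C (2 * (k + 1 : ℝ) * β) ≠ 0 := C_ne_zero.2 (by positivity)
      exact (mul_ne_zero this hp) hd.symm
    · push_cast
      rw [hd, derivative_C_mul]
      ring

/-- Second order perturbation theory for the harmonic oscillator, in terms of the polynomial
factors of Gaussians. -/
lemma exists_perturbed_hermite {β : ℝ} (hβ : 0 < β) (K κ : ℝ) (k : ℕ) :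
    ∃ p q : ℝ[X], p ≠ 0 ∧
      C (β ^ 2) * X ^ 2 * p - (gaussD β) (gaussD β p) - C ((2 * k + 1) * β) * p = 0 ∧
      C (β ^ 2) * X ^ 2 * q - (gaussD β) (gaussD β q) - C ((2 * k + 1) * β) * q
        + C κ * X ^ 4 * p + C K * X * gaussD β p
        - C (-(K / 2) + 3 * κ / (4 * β ^ 2) * (2 * k ^ 2 + 2 * k + 1)) * p = 0 := by
  obtain ⟨p, hp, h⟩ := exists_hermite hβ k
  -- Conjugation by the Gaussian turns the oscillator into the Hermite operator.
  have red (P : ℝ[X]) : C (β ^ 2) * X ^ 2 * P - (gaussD β) (gaussD β P) -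
      C ((2 * k + 1) * β) * P =
      -derivative (derivative P) + C (2 * β) * X * derivative P - C (2 * k * β) * P := by
    simp only [gaussD_apply, derivative_sub, derivative_mul, derivative_C, derivative_X, C_mul,
      C_add, C_pow, map_ofNat, map_one]
    ring
  -- The corrector is sought as (A₂X² + A₄X⁴)p + (B₁X + B₃X³)p'. After p'' has been eliminated,
  -- `r1`, `r3`, `r5` are the coefficients of X⁴p, X²p, p, and `r2`, `r4` those of X³p', Xp' up to
  -- constants. Equation `r5` forces the energy shift: the mean of κτ⁴ + Kτ∂_τ in the k-th state.
  obtain ⟨A4, hA4⟩ : ∃ A4, A4 = -κ / (8 * β) := ⟨_, rfl⟩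
  obtain ⟨B3, hB3⟩ : ∃ B3, B3 = -A4 / β := ⟨_, rfl⟩
  obtain ⟨A2, hA2⟩ : ∃ A2, A2 = K / 4 + 3 * A4 * (1 + k) / β := ⟨_, rfl⟩
  obtain ⟨B1, hB1⟩ : ∃ B1, B1 = (K - 4 * A2 - 6 * B3) / (4 * β) := ⟨_, rfl⟩
  set l := -(K / 2) + 3 * κ / (4 * β ^ 2) * (2 * k ^ 2 + 2 * k + 1) with hl
  have hβ0 := hβ.ne'
  have r1 : 8 * β * A4 + κ = 0 := by rw [hA4]; field_simp; ring
  have r2 : A4 + β * B3 = 0 := by rw [hB3]; field_simp; ring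
  have r3 : -12 * A4 + 4 * β * A2 + 12 * k * β * B3 - K * β = 0 := by
    rw [hA2, hB3]; field_simp; ring
  have r4 : -4 * A2 - 6 * B3 - 4 * β * B1 + K = 0 := by rw [hB1]; field_simp; ring
  have r5 : -2 * A2 + 4 * k * β * B1 - l = 0 := by
    rw [hB1, hA2, hB3, hA4, hl]; field_simp; ring
  have s1 := congrArg (C : ℝ →+* ℝ[X]) r1
  have s2 := congrArg (C : ℝ →+* ℝ[X]) r2
  have s3 := congrArg (C : ℝ →+* ℝ[X]) r3
  have s4 := congrArg (C : ℝ →+* ℝ[X]) r4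
  have s5 := congrArg (C : ℝ →+* ℝ[X]) r5
  simp only [map_add, map_sub, map_mul, map_neg, map_ofNat, map_zero] at s1 s2 s3 s4 s5
  have h3 := congrArg derivative h
  simp only [derivative_sub, derivative_mul, derivative_C, derivative_X] at h3
  refine ⟨p, (C A2 * (X * X) + C A4 * (X * X * X * X)) * p +
    (C B1 * X + C B3 * (X * X * X)) * derivative p, hp,
    ?_, ?_⟩
  · rw [red, h]; ring
  · rw [red, gaussD_apply]
    simp only [derivative_add, derivative_mul, derivative_C, derivative_X, h3,
      derivative_one, derivative_zero]
    simp only [h]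
    simp only [map_mul, map_ofNat]
    linear_combination p * (X ^ 4 * s1 + X ^ 2 * s3 + s5) +
      derivative p * (X * s4 - 8 * X ^ 3 * s2)

end Oscillator

/-! ### Derivatives of the waves up to negligible errors. -/

section ModelEstimates

open Polynomial

lemma modelD_add {h b : ℝ} {u v : E2 → ℂ} {z : E2} (hu : DifferentiableAt ℝ u z)
    (hv : DifferentiableAt ℝ v z) :
    modelD h b (fun y ↦ u y + v y) z = modelD h b u z + modelD h b v z := by
  simp only [modelD, pd_add hu hv]; ring

lemma modelD_const_mul {h b : ℝ} {u : E2 → ℂ} {z : E2} (c : ℂ) (hu : DifferentiableAt ℝ u z) :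
    modelD h b (fun y ↦ c * u y) z = c * modelD h b u z := by
  simp only [modelD, pd_const_mul c hu]; ring

variable {β b : ℝ} {φ ζ : ℝ → ℝ}

lemma wave_sub (P Q : ℝ[X]) (ε : ℝ) (z : E2) :
    wave β b φ ζ (P - Q) ε z = wave β b φ ζ P ε z - wave β b φ ζ Q ε z := by
  have := wave_add (β := β) (b := b) (φ := φ) (ζ := ζ) (P - Q) Q ε z
  rw [sub_add_cancel] at this
  rw [this]; ring

lemma wave_zero (ε : ℝ) (z : E2) : wave β b φ ζ 0 ε z = 0 := by
  have := wave_smul (β := β) (b := b) (φ := φ) (ζ := ζ) 0 0 ε z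
  simpa using this

lemma packet_sub (P Q : ℝ[X]) (ε : ℝ) (z : E2) :
    packet β φ ζ (P - Q) ε z = packet β φ ζ P ε z - packet β φ ζ Q ε z := by
  have := packet_add (β := β) (φ := φ) (ζ := ζ) (P - Q) Q ε z
  rw [sub_add_cancel] at this
  rw [this]; ring

lemma bd_modelD_wave (hβ : 0 < β) (hb : b ≠ 0) (hφ : IsCut φ) (hζ : IsCut ζ) (P : ℝ[X]) :
    Bd 13 (fun ε z ↦ modelD (ε ^ 8) b (wave β b φ ζ P ε) z
      - (ε : ℂ) ^ 4 * wave β b φ ζ (b • (X * P)) ε z) := by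
  refine (((bd_packet hβ (hφ.iteratedDeriv 9) hζ ((gaussD β ^ 8) P)).const_mul
    ((Complex.I / b) ^ 8 / (Nat.factorial 8 : ℂ) * Complex.I)).pow_mul 13).congr ?_
  filter_upwards [eventually_pos_lt one_pos] with ε hε z
  rw [modelD_wave hb hφ hζ P hε.1.ne']
  ring

/-- A crude bound, without the wave correction, suffices here: it is applied to remainders that
already have size ε¹³. -/
lemma bd_modelD_packet (hβ : 0 < β) (hφ : IsCut φ) (hζ : IsCut ζ) (P : ℝ[X]) :
    Bd 4 (fun ε z ↦ modelD (ε ^ 8) b (fun y ↦ (packet β φ ζ P ε y : ℂ)) z) := by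
  have h1 := (((bd_packet hβ hφ.deriv hζ P).const_mul Complex.I).pow_mul 5).mono
    (show 4 ≤ 0 + 5 by norm_num)
  have h2 := ((bd_packet hβ hφ hζ (X * P)).const_mul b).pow_mul 4
  refine (h1.add h2).congr ?_
  filter_upwards [eventually_pos_lt one_pos] with ε hε z
  have h3 := packet_X_mul (β := β) (φ := φ) (ζ := ζ) P hε.1.ne' z
  have h4 := congrArg (fun x : ℝ ↦ (x : ℂ)) h3
  simp only [Complex.ofReal_mul, Complex.ofReal_pow] at h4
  have hε' : (ε : ℂ) ≠ 0 := by exact_mod_cast hε.1.ne'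
  rw [modelD, pd_ofReal ((packet_contDiff hφ.smooth hζ.smooth P ε).differentiable (by simp) z),
    (pd_packet hφ.smooth hζ.smooth P ε z).1]
  push_cast
  have h5 : (ε : ℂ) ^ 8 * ((ε : ℂ) ^ 3)⁻¹ = ε ^ 5 := by field_simp
  linear_combination -b * h4 - Complex.I * packet β (deriv φ) ζ P ε z * h5

/-- The two applications contribute the errors ε⁴ · ε¹³ and ε¹³ · ε⁴, each exactly at the admissible
size ε¹⁷. -/
lemma bd_modelD_modelD_wave (hβ : 0 < β) (hb : b ≠ 0) (hφ : IsCut φ) (hζ : IsCut ζ) (P : ℝ[X]) :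
    Bd 17 (fun ε z ↦ modelD (ε ^ 8) b (modelD (ε ^ 8) b (wave β b φ ζ P ε)) z
      - (ε : ℂ) ^ 8 * wave β b φ ζ (b ^ 2 • (X * (X * P))) ε z) := by
  have h1 := (bd_modelD_wave hβ hb hφ hζ (b • (X * P))).pow_mul 4
  have h2 := ((bd_modelD_packet (b := b) hβ (hφ.iteratedDeriv 9) hζ
    ((gaussD β ^ 8) P)).const_mul
    ((Complex.I / b) ^ 8 / (Nat.factorial 8 : ℂ) * Complex.I)).pow_mul 13
  refine (h1.add h2).congr ?_
  filter_upwards [eventually_pos_lt one_pos] with ε hε z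
  have e : modelD (ε ^ 8) b (wave β b φ ζ P ε) = fun z ↦
      (ε : ℂ) ^ 4 * wave β b φ ζ (b • (X * P)) ε z
      + ((ε : ℂ) ^ 13 * ((Complex.I / b) ^ 8 / (Nat.factorial 8 : ℂ) * Complex.I)) *
        (packet β (iteratedDeriv 9 φ) ζ ((gaussD β ^ 8) P) ε z : ℂ) := by
    funext z
    rw [modelD_wave hb hφ hζ P hε.1.ne']
    ring
  have d1 : DifferentiableAt ℝ (wave β b φ ζ (b • (X * P)) ε) z :=
    (wave_contDiff hφ hζ _ ε).differentiable (by simp) z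
  have d2 : DifferentiableAt ℝ (fun z ↦
      (packet β (iteratedDeriv 9 φ) ζ ((gaussD β ^ 8) P) ε z : ℂ)) z :=
    smooth_diffAt (contDiffAt_ofReal
      (packet_contDiff (hφ.iteratedDeriv 9).smooth hζ.smooth _ ε).contDiffAt)
  rw [e, modelD_add (d1.const_mul _) (d2.const_mul _), modelD_const_mul _ d1,
    modelD_const_mul _ d2, show b ^ 2 • (X * (X * P)) = b • (X * (b • (X * P))) by
      rw [mul_smul_comm, smul_smul, sq]]
  ring

/-- The term with the derivative of the cutoff lives at |t| ≥ ε³/2, that is |τ| ≥ 1/(2ε), where the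
Gaussian is smaller than any power of ε. -/
lemma bd_pd_wave (hζ0 : ∀ x, |x| < 1 / 2 → deriv ζ x = 0) (hβ : 0 < β) (hφ : IsCut φ) (hζ : IsCut ζ) (P : ℝ[X]) (r : ℕ) :
    Bd r (fun ε z ↦ (ε : ℂ) ^ 8 * pd 1 (wave β b φ ζ P ε) z
      - (ε : ℂ) ^ 4 * wave β b φ ζ (gaussD β P) ε z) := by
  refine (((bd_wave_far (b := b) hβ hφ hζ.deriv hζ0 P r).pow_mul 5).mono (Nat.le_add_right r 5)).congr ?_
  filter_upwards [eventually_pos_lt one_pos] with ε hε z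
  have hε' : (ε : ℂ) ≠ 0 := by exact_mod_cast hε.1.ne'
  rw [(pd_wave hφ hζ P ε z).2]
  field_simp
  ring

lemma bd_pd_pd_wave (hζ0 : ∀ x, |x| < 1 / 2 → deriv ζ x = 0) (hβ : 0 < β) (hφ : IsCut φ) (hζ : IsCut ζ) (P : ℝ[X]) (r : ℕ) :
    Bd r (fun ε z ↦ (ε : ℂ) ^ 16 * pd 1 (pd 1 (wave β b φ ζ P ε)) z
      - (ε : ℂ) ^ 8 * wave β b φ ζ (gaussD β (gaussD β P)) ε z) := by
  have hd0 (x : ℝ) (hx : |x| < 1 / 2) : deriv (deriv ζ) x = 0 := by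
    have : deriv ζ =ᶠ[𝓝 x] fun _ ↦ 0 := by
      filter_upwards [continuous_abs.continuousAt.eventually (gt_mem_nhds hx)] with y hy
      exact hζ0 y hy
    rw [this.deriv_eq]; simp
  have h1 := ((bd_wave_far (b := b) hβ hφ hζ.deriv hζ0 (gaussD β P) r).const_mul 2).pow_mul 9
  have h2 := (bd_wave_far (b := b) hβ hφ hζ.deriv.deriv hd0 P r).pow_mul 10
  refine ((h1.mono (Nat.le_add_right r 9)).add (h2.mono (Nat.le_add_right r 10))).congr ?_
  filter_upwards [eventually_pos_lt one_pos] with ε hε z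
  have hε' : (ε : ℂ) ≠ 0 := by exact_mod_cast hε.1.ne'
  have e : pd 1 (wave β b φ ζ P ε) = fun z ↦ ((ε : ℂ) ^ 4)⁻¹ * wave β b φ ζ (gaussD β P) ε z
      + ((ε : ℂ) ^ 3)⁻¹ * wave β b φ (deriv ζ) P ε z := by
    funext z; rw [(pd_wave hφ hζ P ε z).2]
  have d1 : DifferentiableAt ℝ (wave β b φ ζ (gaussD β P) ε) z :=
    (wave_contDiff hφ hζ _ ε).differentiable (by simp) z
  have d2 : DifferentiableAt ℝ (wave β b φ (deriv ζ) P ε) z :=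
    (wave_contDiff hφ hζ.deriv _ ε).differentiable (by simp) z
  rw [e, pd_add (d1.const_mul _) (d2.const_mul _), pd_const_mul _ d1, pd_const_mul _ d2,
    (pd_wave hφ hζ _ ε z).2, (pd_wave hφ hζ.deriv _ ε z).2]
  field_simp
  ring

/-- The order 9 is 5 + 4: h∂_s on the cutoff has size ε⁵ and h∂_t on the Gaussian has size ε⁴. -/
lemma bd_pd_pd_wave_mixed (hζ0 : ∀ x, |x| < 1 / 2 → deriv ζ x = 0) (hβ : 0 < β) (hφ : IsCut φ) (hζ : IsCut ζ) (P : ℝ[X]) :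
    Bd 9 (fun ε z ↦ (ε : ℂ) ^ 16 * pd 1 (pd 0 (wave β b φ ζ P ε)) z) := by
  have h1 := (bd_pd_wave (b := b) hζ0 hβ hφ.deriv hζ P 9).pow_mul 5
  have h2 := (bd_wave (b := b) hβ hφ.deriv hζ (gaussD β P)).pow_mul 9
  refine ((h1.mono (by norm_num : 9 ≤ 9 + 5)).add (h2.mono (by norm_num : 9 ≤ 0 + 9))).congr ?_
  filter_upwards [eventually_pos_lt one_pos] with ε hε z
  have hε' : (ε : ℂ) ≠ 0 := by exact_mod_cast hε.1.ne'
  have e : pd 0 (wave β b φ ζ P ε) = fun z ↦ ((ε : ℂ) ^ 3)⁻¹ * wave β b (deriv φ) ζ P ε z := by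
    funext z; rw [(pd_wave hφ hζ P ε z).1]
  rw [e, pd_const_mul _ ((wave_contDiff hφ.deriv hζ _ ε).differentiable (by simp) z)]
  field_simp
  ring

end ModelEstimates

/-! ### The trial function and its residual for the truncated operator. -/

section Trial

open Polynomial

variable {β b : ℝ} {φ ζ : ℝ → ℝ}

/-- The trial function with profile `p + ε⁸ q`. -/
def trial (β b : ℝ) (φ ζ : ℝ → ℝ) (p q : ℝ[X]) (ε : ℝ) (z : E2) : ℂ :=
  wave β b φ ζ p ε z + (ε : ℂ) ^ 8 * wave β b φ ζ q ε z

lemma trial_contDiff (hφ : IsCut φ) (hζ : IsCut ζ) (p q : ℝ[X]) (ε : ℝ) :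
    ContDiff ℝ ∞ (trial β b φ ζ p q ε) :=
  (wave_contDiff hφ hζ p ε).add (contDiff_const.mul (wave_contDiff hφ hζ q ε))

lemma pd_trial (hφ : IsCut φ) (hζ : IsCut ζ) (p q : ℝ[X]) (ε : ℝ) (i j : Fin 2) (z : E2) :
    pd i (trial β b φ ζ p q ε) z =
      pd i (wave β b φ ζ p ε) z + (ε : ℂ) ^ 8 * pd i (wave β b φ ζ q ε) z ∧
    pd i (pd j (trial β b φ ζ p q ε)) z =
      pd i (pd j (wave β b φ ζ p ε)) z + (ε : ℂ) ^ 8 * pd i (pd j (wave β b φ ζ q ε)) z := by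
  have d1 (P : ℝ[X]) := (wave_contDiff (β := β) (b := b) hφ hζ P ε).differentiable (by simp)
  have d2 (P : ℝ[X]) (j : Fin 2) := (pd_contDiff
    (wave_contDiff (β := β) (b := b) hφ hζ P ε) j).differentiable (by simp)
  have e (j : Fin 2) : pd j (trial β b φ ζ p q ε) = fun z ↦
      pd j (wave β b φ ζ p ε) z + (ε : ℂ) ^ 8 * pd j (wave β b φ ζ q ε) z := by
    funext z
    change pd j (fun y ↦ wave β b φ ζ p ε y + (ε : ℂ) ^ 8 * wave β b φ ζ q ε y) z = _
    rw [pd_add (d1 p z) ((d1 q z).const_mul _), pd_const_mul _ (d1 q z)]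
  refine ⟨by rw [e], ?_⟩
  rw [e, pd_add (d2 p j z) ((d2 q j z).const_mul _), pd_const_mul _ (d2 q j z)]

lemma modelD_trial (hφ : IsCut φ) (hζ : IsCut ζ) (p q : ℝ[X]) (ε h : ℝ) (z : E2) :
    modelD h b (trial β b φ ζ p q ε) z =
      modelD h b (wave β b φ ζ p ε) z + (ε : ℂ) ^ 8 * modelD h b (wave β b φ ζ q ε) z ∧
    modelD h b (modelD h b (trial β b φ ζ p q ε)) z =
      modelD h b (modelD h b (wave β b φ ζ p ε)) z
        + (ε : ℂ) ^ 8 * modelD h b (modelD h b (wave β b φ ζ q ε)) z := by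
  have d1 (P : ℝ[X]) := (wave_contDiff (β := β) (b := b) hφ hζ P ε).differentiable (by simp)
  have d2 (P : ℝ[X]) := (modelD_contDiff (h := h) (b := b)
    (wave_contDiff (β := β) (b := b) hφ hζ P ε)).differentiable (by simp)
  have e : modelD h b (trial β b φ ζ p q ε) = fun z ↦
      modelD h b (wave β b φ ζ p ε) z + (ε : ℂ) ^ 8 * modelD h b (wave β b φ ζ q ε) z := by
    funext z
    change modelD h b (fun y ↦ wave β b φ ζ p ε y + (ε : ℂ) ^ 8 * wave β b φ ζ q ε y) z = _
    rw [modelD_add (d1 p z) ((d1 q z).const_mul _), modelD_const_mul _ (d1 q z)]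
  refine ⟨by rw [e], ?_⟩
  rw [e, modelD_add (d2 p z) ((d2 q z).const_mul _), modelD_const_mul _ (d2 q z)]

lemma bd_wave_scaled (hβ : 0 < β) (hφ : IsCut φ) (hζ : IsCut ζ) (P : ℝ[X]) (n : ℕ) :
    Bd n (fun ε z ↦ (ε : ℂ) ^ n * wave β b φ ζ P ε z) := by
  simpa using (bd_wave (b := b) hβ hφ hζ P).pow_mul n

lemma bd_trial_self (hβ : 0 < β) (hφ : IsCut φ) (hζ : IsCut ζ) (p q : ℝ[X]) :
    Bd 0 (trial β b φ ζ p q) :=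
  ((bd_wave_scaled (b := b) hβ hφ hζ p 0).add
    ((bd_wave_scaled (b := b) hβ hφ hζ q 8).mono (Nat.zero_le 8))).congr
    (.of_forall fun ε z ↦ by simp [trial])

lemma bd_trial (hβ : 0 < β) (hφ : IsCut φ) (hζ : IsCut ζ) (p q : ℝ[X]) :
    Bd 1 (fun ε z ↦ trial β b φ ζ p q ε z - packet β φ ζ p ε z) := by
  have h1 := bd_wave_sub_packet (b := b) hβ hφ hζ p
  have h2 := (bd_wave_scaled (b := b) hβ hφ hζ q 8).mono (show 1 ≤ 8 by norm_num)
  exact (h1.add h2).congr (.of_forall fun ε z ↦ by simp only [trial]; ring)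

/-- Leading behaviour only, with one factor ε to spare: it is used next to the coefficient t³, worth
ε¹², and 5 + 12 = 17. -/
lemma bd_modelD_trial (hβ : 0 < β) (hb : b ≠ 0) (hφ : IsCut φ) (hζ : IsCut ζ) (p q : ℝ[X]) :
    Bd 5 (fun ε z ↦ modelD (ε ^ 8) b (trial β b φ ζ p q ε) z
      - (ε : ℂ) ^ 4 * packet β φ ζ (b • (X * p)) ε z) := by
  have h1 := (bd_modelD_wave hβ hb hφ hζ p).mono (show 5 ≤ 13 by norm_num)
  have h2 := ((bd_modelD_wave hβ hb hφ hζ q).mono (show 4 ≤ 13 by norm_num)).add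
    (bd_wave_scaled (b := b) hβ hφ hζ (b • (X * q)) 4)
  have h3 := (h2.pow_mul 8).mono (show 5 ≤ 4 + 8 by norm_num)
  have h4 := (bd_wave_sub_packet (b := b) hβ hφ hζ (b • (X * p))).pow_mul 4
  refine ((h1.add h3).add h4).congr (.of_forall fun ε z ↦ ?_)
  rw [(modelD_trial hφ hζ p q ε _ z).1]; ring

lemma bd_modelD_modelD_trial (hβ : 0 < β) (hb : b ≠ 0) (hφ : IsCut φ) (hζ : IsCut ζ)
    (p q : ℝ[X]) :
    Bd 9 (fun ε z ↦ modelD (ε ^ 8) b (modelD (ε ^ 8) b (trial β b φ ζ p q ε)) z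
      - (ε : ℂ) ^ 8 * packet β φ ζ (b ^ 2 • (X * (X * p))) ε z) := by
  have h1 := (bd_modelD_modelD_wave hβ hb hφ hζ p).mono (show 9 ≤ 17 by norm_num)
  have h2 := ((bd_modelD_modelD_wave hβ hb hφ hζ q).mono (show 8 ≤ 17 by norm_num)).add
    (bd_wave_scaled (b := b) hβ hφ hζ (b ^ 2 • (X * (X * q))) 8)
  have h3 := (h2.pow_mul 8).mono (show 9 ≤ 8 + 8 by norm_num)
  have h4 := (bd_wave_sub_packet (b := b) hβ hφ hζ (b ^ 2 • (X * (X * p)))).pow_mul 8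
  refine ((h1.add h3).add h4).congr (.of_forall fun ε z ↦ ?_)
  rw [(modelD_trial hφ hζ p q ε _ z).2]; ring

lemma bd_pd_trial (hζ0 : ∀ x, |x| < 1 / 2 → deriv ζ x = 0) (hβ : 0 < β) (hφ : IsCut φ)
    (hζ : IsCut ζ) (p q : ℝ[X]) :
    Bd 5 (fun ε z ↦ (ε : ℂ) ^ 8 * pd 1 (trial β b φ ζ p q ε) z
      - (ε : ℂ) ^ 4 * packet β φ ζ (gaussD β p) ε z) := by
  have h1 := bd_pd_wave (b := b) hζ0 hβ hφ hζ p 5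
  have h2 := (bd_pd_wave (b := b) hζ0 hβ hφ hζ q 4).add
    (bd_wave_scaled (b := b) hβ hφ hζ (gaussD β q) 4)
  have h3 := (h2.pow_mul 8).mono (show 5 ≤ 4 + 8 by norm_num)
  have h4 := (bd_wave_sub_packet (b := b) hβ hφ hζ (gaussD β p)).pow_mul 4
  refine ((h1.add h3).add h4).congr (.of_forall fun ε z ↦ ?_)
  rw [(pd_trial hφ hζ p q ε 1 1 z).1]; ring

lemma bd_pd_pd_trial (hζ0 : ∀ x, |x| < 1 / 2 → deriv ζ x = 0) (hβ : 0 < β) (hφ : IsCut φ)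
    (hζ : IsCut ζ) (p q : ℝ[X]) :
    Bd 8 (fun ε z ↦ (ε : ℂ) ^ 16 * pd 1 (pd 1 (trial β b φ ζ p q ε)) z) := by
  have h0 (P : ℝ[X]) := (bd_pd_pd_wave (b := b) hζ0 hβ hφ hζ P 8).add
    (bd_wave_scaled (b := b) hβ hφ hζ (gaussD β (gaussD β P)) 8)
  refine ((h0 p).add (((h0 q).pow_mul 8).mono (show 8 ≤ 8 + 8 by norm_num))).congr
    (.of_forall fun ε z ↦ ?_)
  rw [(pd_trial hφ hζ p q ε 1 1 z).2]; ring

lemma bd_pd_pd_trial_mixed (hζ0 : ∀ x, |x| < 1 / 2 → deriv ζ x = 0) (hβ : 0 < β) (hφ : IsCut φ)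
    (hζ : IsCut ζ) (p q : ℝ[X]) :
    Bd 9 (fun ε z ↦ (ε : ℂ) ^ 16 * pd 1 (pd 0 (trial β b φ ζ p q ε)) z) := by
  have h0 (P : ℝ[X]) := bd_pd_pd_wave_mixed (b := b) hζ0 hβ hφ hζ P
  refine ((h0 p).add (((h0 q).pow_mul 8).mono (show 9 ≤ 9 + 8 by norm_num))).congr
    (.of_forall fun ε z ↦ ?_)
  rw [(pd_trial hφ hζ p q ε 1 0 z).2]; ring

lemma Bd.coef {r r' j n : ℕ} {u : ℝ → E2 → ℂ} {f : E2 → ℝ} (hu : Bd r u) (hf : Co j n f)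
    (h : r' ≤ r + 4 * j + 3 * n) : Bd r' (fun ε z ↦ (f z : ℂ) * u ε z) :=
  (hu.coef_mul hf).mono h

/-- The residual of the trial function for the truncated operator. -/
lemma bd_trial_residual (hζ0 : ∀ x, |x| < 1 / 2 → deriv ζ x = 0) (hβ : 0 < β) (hb : b ^ 2 = β ^ 2)
    (hφ : IsCut φ) (hζ : IsCut ζ) {p q : ℝ[X]} {K c l₁ l₂ : ℝ}
    (hp : b ^ 2 • (X * (X * p)) - gaussD β (gaussD β p) - l₁ • p = 0)
    (hq : b ^ 2 • (X * (X * q)) - gaussD β (gaussD β q) - l₁ • q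
      + ((K * b ^ 2 + 2 * b * c) • (X * (X * (X * (X * p)))) + K • (X * gaussD β p) - l₂ • p)
        = 0) :
    Bd 17 (fun ε z ↦
      modelD (ε ^ 8) b (modelD (ε ^ 8) b (trial β b φ ζ p q ε)) z
        - (ε : ℂ) ^ 16 * pd 1 (pd 1 (trial β b φ ζ p q ε)) z
        - l₁ * (ε : ℂ) ^ 8 * trial β b φ ζ p q ε z
      + (K * (z 1 : ℂ) ^ 2 * modelD (ε ^ 8) b (modelD (ε ^ 8) b (trial β b φ ζ p q ε)) z
        + 2 * c * (z 1 : ℂ) ^ 3 * modelD (ε ^ 8) b (trial β b φ ζ p q ε) z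
        + K * z 1 * (ε : ℂ) ^ 8 * ((ε : ℂ) ^ 8 * pd 1 (trial β b φ ζ p q ε) z)
        - l₂ * (ε : ℂ) ^ 16 * trial β b φ ζ p q ε z)) := by
  have hb0 : b ≠ 0 := by
    rintro rfl
    have : 0 < β ^ 2 := by positivity
    simp only [ne_eq, OfNat.ofNat_ne_zero, not_false_eq_true, zero_pow] at hb
    linarith
  have t1 := Co.vertical
  have t2 := t1.mul t1
  have t3 := t2.mul t1
  -- In the oscillator part, `a1` to `a4`, the waves are needed up to ε¹⁷. In the perturbation, `a5`
  -- to `a9`, everything has size ε¹⁶ already, so waves may be replaced by single packets at the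
  -- cost of one ε.
  have a1 := bd_modelD_modelD_wave hβ hb0 hφ hζ p
  have a2 := ((bd_modelD_modelD_wave hβ hb0 hφ hζ q).pow_mul 8).mono
    (show 17 ≤ 17 + 8 by norm_num)
  have a3 := bd_pd_pd_wave (b := b) hζ0 hβ hφ hζ p 17
  have a4 := ((bd_pd_pd_wave (b := b) hζ0 hβ hφ hζ q 17).pow_mul 8).mono
    (show 17 ≤ 17 + 8 by norm_num)
  have a5 := ((bd_modelD_modelD_trial hβ hb0 hφ hζ p q).coef t2
    (show 17 ≤ _ by norm_num)).const_mul K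
  have a6 := ((bd_modelD_trial hβ hb0 hφ hζ p q).coef t3
    (show 17 ≤ _ by norm_num)).const_mul (2 * c)
  have a7 := (((bd_pd_trial (b := b) hζ0 hβ hφ hζ p q).pow_mul 8).coef t1
    (show 17 ≤ _ by norm_num)).const_mul K
  have a8 := ((bd_trial (b := b) hβ hφ hζ p q).pow_mul 16).const_mul l₂
  have a9 := (bd_wave_sub_packet (b := b) hβ hφ hζ ((K * b ^ 2 + 2 * b * c) •
    (X * (X * (X * (X * p)))) + K • (X * gaussD β p) - l₂ • p)).pow_mul 16
  refine ((((a1.add a2).sub (a3.add a4)).add ((a5.add a6).add a7)).sub (a8.add a9)).congr ?_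
  filter_upwards [eventually_pos_lt one_pos] with ε hε z
  -- Since `wave` is linear in its polynomial, the two polynomial identities become identities
  -- between waves at the orders ε⁸ and ε¹⁶.
  have w1 := congrArg (fun P ↦ wave β b φ ζ P ε z) hp
  have w2 := congrArg (fun P ↦ wave β b φ ζ P ε z) hq
  simp only [wave_add, wave_sub, wave_zero] at w1 w2
  have k1 (P : ℝ[X]) : (z 1 : ℂ) * (packet β φ ζ P ε z : ℂ) =
      (ε : ℂ) ^ 4 * (packet β φ ζ (X * P) ε z : ℂ) := by
    exact_mod_cast packet_X_mul (β := β) (φ := φ) (ζ := ζ) P hε.1.ne' z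
  have k2 (P : ℝ[X]) : (z 1 : ℂ) ^ 2 * (packet β φ ζ P ε z : ℂ) =
      (ε : ℂ) ^ 8 * (packet β φ ζ (X * (X * P)) ε z : ℂ) := by
    linear_combination (z 1 : ℂ) * k1 P + (ε : ℂ) ^ 4 * k1 (X * P)
  have k3 (P : ℝ[X]) : (z 1 : ℂ) ^ 3 * (packet β φ ζ P ε z : ℂ) =
      (ε : ℂ) ^ 12 * (packet β φ ζ (X * (X * (X * P))) ε z : ℂ) := by
    linear_combination (z 1 : ℂ) * k2 P + (ε : ℂ) ^ 8 * k1 (X * (X * P))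
  have m1 := k2 (X * (X * p))
  have m2 := k3 (X * p)
  have m3 := k1 (gaussD β p)
  rw [(modelD_trial hφ hζ p q ε _ z).1, (modelD_trial hφ hζ p q ε _ z).2,
    (pd_trial hφ hζ p q ε 1 1 z).1, (pd_trial hφ hζ p q ε 1 1 z).2]
  simp only [packet_add, packet_sub, packet_smul, wave_add, wave_sub, wave_smul, trial] at w1 w2 ⊢
  push_cast at w1 w2 ⊢
  linear_combination -(ε : ℂ) ^ 8 * w1 - (ε : ℂ) ^ 16 * w2 - K * b ^ 2 * (ε : ℂ) ^ 8 * m1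
    - 2 * c * b * (ε : ℂ) ^ 4 * m2 - K * (ε : ℂ) ^ 12 * m3

end Trial

/-! ### The residual for the full operator in normal form. -/

section Residual

open Polynomial

lemma Bd.of_box {r : ℕ} {u v : ℝ → E2 → ℂ} (hu : Bd r u)
    (h1 : ∀ᶠ ε in 𝓝[>] (0 : ℝ), ∀ z : E2, |z 0| ≤ ε ^ 3 ∧ |z 1| ≤ ε ^ 3 → u ε z = v ε z)
    (h2 : ∀ᶠ ε in 𝓝[>] (0 : ℝ), ∀ z : E2, ¬(|z 0| ≤ ε ^ 3 ∧ |z 1| ≤ ε ^ 3) → v ε z = 0) :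
    Bd r v := by
  refine hu.congr ?_
  filter_upwards [hu.1, h1, h2] with ε hu h1 h2 z
  by_cases hz : |z 0| ≤ ε ^ 3 ∧ |z 1| ≤ ε ^ 3
  · exact h1 z hz
  · rw [h2 z hz]
    by_contra hn
    exact hz (hu z hn)

lemma Bd.eventually_eq_zero {r : ℕ} {u : ℝ → E2 → ℂ} (hu : Bd r u) :
    ∀ᶠ ε in 𝓝[>] (0 : ℝ), ∀ z : E2, ¬(|z 0| ≤ ε ^ 3 ∧ |z 1| ≤ ε ^ 3) → u ε =ᶠ[𝓝 z] 0 := by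
  filter_upwards [hu.1] with ε hu z hz
  have ho : IsOpen {y : E2 | ¬(|y 0| ≤ ε ^ 3 ∧ |y 1| ≤ ε ^ 3)} := by
    have hc (i : Fin 2) : Continuous fun y : E2 ↦ |y i| :=
      (coord_contDiff i).continuous.abs
    exact ((isClosed_le (hc 0) continuous_const).inter
      (isClosed_le (hc 1) continuous_const)).isOpen_compl
  filter_upwards [ho.mem_nhds hz] with y hy
  by_contra hn
  exact hy (hu y hn)

/-- Geometric data near the origin of the plane, in normal form: a density `ρ`, an inverse metric
`G` and a magnetic potential `a`. -/
structure NormalForm (ρ : E2 → ℝ) (G : Fin 2 → Fin 2 → E2 → ℝ) (a : Fin 2 → E2 → ℝ)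
    (b c K : ℝ) (γ e : E2 → ℝ) : Prop where
  smooth : ∀ᶠ z in 𝓝 0, ∀ i j, ContDiffAt ℝ ∞ (G i j) z
  symm : G 1 0 = G 0 1
  density : HasJet (fun z ↦ (ρ z)⁻¹) 1 0 0 0 0 K
  metric₀₀ : HasJet (G 0 0) 1 0 0 0 0 K
  metric₀₁ : HasJet (G 0 1) 0 0 0 0 0 0
  metric₁₁ : HasJet (G 1 1) 1 0 0 0 0 (-K)
  field₀ : a 0 =ᶠ[𝓝 0] fun z ↦ b * z 1 + γ z
  field₁ : a 1 =ᶠ[𝓝 0] 0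
  smooth_potential : ∀ᶠ z in 𝓝 0, ContDiffAt ℝ ∞ γ z
  potential : γ =ᶠ[𝓝 0] fun z ↦ c * (z 1 * (z 1 * z 1)) + e z
  smooth_error : ∀ᶠ z in 𝓝 0, ContDiffAt ℝ ∞ e z
  error : Van 3 (pd 1 e)
  error_axis : ∀ᶠ z in 𝓝 0, z 1 = 0 → e z = 0

lemma pd_cube (c : ℝ) (i : Fin 2) (z : E2) :
    DifferentiableAt ℝ (fun y : E2 ↦ c * (y 1 * (y 1 * y 1))) z ∧
    pd i (fun y : E2 ↦ c * (y 1 * (y 1 * y 1))) z = if i = 1 then c * (3 * (z 1 * z 1)) else 0 := by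
  have d : DifferentiableAt ℝ (fun y : E2 ↦ y 1) z := (coord_contDiff 1).differentiable (by simp) z
  refine ⟨by fun_prop, ?_⟩
  rw [pd_const_mul c (by fun_prop), pd_mul d (by fun_prop), pd_mul d d, pd_coord]
  split_ifs <;> ring

namespace NormalForm

variable {ρ : E2 → ℝ} {G : Fin 2 → Fin 2 → E2 → ℝ} {a : Fin 2 → E2 → ℝ} {b c K : ℝ}
  {γ e : E2 → ℝ}

lemma co_error (H : NormalForm ρ G a b c K γ e) : Co 1 3 e :=
  Co.of_vertical H.smooth_error.self_of_nhds H.error H.error_axis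

/-- The potential vanishes on the axis by the choice of gauge and its t-derivative is quadratic;
integrating from the axis keeps the factor |t|, which is worth ε⁴ instead of ε³. -/
lemma co_potential (H : NormalForm ρ G a b c K γ e) : Co 1 2 γ := by
  have h1 : Co 1 2 (fun z ↦ c * (z 1 * (z 1 * z 1)) + e z) := by
    have c1 := (coord_contDiff (1 : Fin 2)).contDiffAt (x := (0 : E2))
    refine Co.of_vertical ((contDiffAt_const.mul (c1.mul (c1.mul c1))).add
      H.smooth_error.self_of_nhds) ?_ ?_
    · have h2 : Van 2 (fun z ↦ c * (3 * (z 1 * z 1)) + pd 1 e z) :=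
        ((((Van.coord 1).mul (Van.coord 1)).const_mul 3).const_mul c).add (H.error.mono (by norm_num))
      refine h2.congr ?_
      filter_upwards [H.smooth_error] with z hz
      rw [pd_add (pd_cube c 1 z).1 (smooth_diffAt hz), (pd_cube c 1 z).2, if_pos rfl]
    · filter_upwards [H.error_axis] with z hz h1
      rw [h1, hz h1]; simp
  exact h1.congr H.potential.symm

/-- The cubic term does not depend on s, so only the error term contributes. Being zero along the
axis, it has zero s-derivative there too, and one may again integrate in t. -/
lemma co_pd_potential (H : NormalForm ρ G a b c K γ e) : Co 1 2 (pd 0 γ) := by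
  have h1 : Co 1 2 (pd 0 e) := by
    refine Co.of_vertical (pd_contDiffAt H.smooth_error.self_of_nhds 0) ?_ ?_
    · refine (H.error.pd 0).congr ?_
      filter_upwards [H.smooth_error] with z hz
      exact pd_comm hz 0 1
    · filter_upwards [H.error_axis.eventually_nhds, H.smooth_error] with z hz hs h1
      have hl := hasDerivAt_horizontal (f := e) (s := z 0) (t := z 1)
        (by rw [plane_eta]; exact smooth_diffAt hs)
      rw [plane_eta] at hl
      have h0 : (fun s ↦ e !₂[s, z 1]) =ᶠ[𝓝 (z 0)] fun _ ↦ 0 := by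
        have hc : ContinuousAt (fun s ↦ (!₂[s, z 1] : E2)) (z 0) := by fun_prop
        have hz' : ∀ᶠ y in 𝓝 (!₂[z 0, z 1] : E2), y 1 = 0 → e y = 0 := by rwa [plane_eta]
        filter_upwards [hc.eventually hz'] with s hs
        exact hs (by simpa using h1)
      exact hl.unique ((hasDerivAt_const _ _).congr_of_eventuallyEq h0)
  refine h1.congr ?_
  filter_upwards [H.potential.eventually_nhds, H.smooth_error] with z hz hs
  rw [pd_congr_at hz, pd_add (pd_cube c 0 z).1 (smooth_diffAt hs), (pd_cube c 0 z).2]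
  simp

lemma contDiffAt_potential (H : NormalForm ρ G a b c K γ e) : ContDiffAt ℝ ∞ γ 0 :=
  H.smooth_potential.self_of_nhds

end NormalForm

lemma HasJet.van_pd {f : E2 → ℝ} {c l0 l1 q00 q01 q11 : ℝ} (h : HasJet f c l0 l1 q00 q01 q11)
    (i : Fin 2) : Van 2 (fun z ↦ pd i f z - pd i (quadPoly c l0 l1 q00 q01 q11) z) := by
  refine (Van.pd h i).congr ?_
  filter_upwards [eventually_differentiableAt h.contDiffAt] with z hz
  exact pd_sub hz ((quadPoly_contDiff _ _ _ _ _ _).differentiable (by simp) z) i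

namespace NormalForm

variable {ρ : E2 → ℝ} {G : Fin 2 → Fin 2 → E2 → ℝ} {a : Fin 2 → E2 → ℝ} {b c K : ℝ}
  {γ e : E2 → ℝ}

lemma co_metric₀₀ (H : NormalForm ρ G a b c K γ e) :
    Co 0 3 (fun z ↦ (ρ z)⁻¹ * G 0 0 z - (1 + K * (z 1 * z 1))) ∧
    Co 0 2 (fun z ↦ (ρ z)⁻¹ * G 0 0 z - 1) ∧ Co 0 0 (fun z ↦ (ρ z)⁻¹ * G 0 0 z) := by
  have h1 : Van 3 (fun z ↦ (ρ z)⁻¹ * G 0 0 z - (1 + K * (z 1 * z 1))) :=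
    Van.congr (H.density.mul H.metric₀₀) (.of_forall fun z ↦ by simp only [quadPoly]; ring)
  refine ⟨.of_van h1, .of_van ((h1.of_succ.add
    (((Van.coord 1).mul (Van.coord 1)).const_mul K)).congr (.of_forall fun z ↦ by ring)), ?_⟩
  exact .of_van (n := 0) (H.density.contDiffAt.mul H.metric₀₀.contDiffAt)

lemma co_metric₀₁ (H : NormalForm ρ G a b c K γ e) : Co 0 3 (fun z ↦ (ρ z)⁻¹ * G 0 1 z) :=
  .of_van (.smooth_mul H.density.contDiffAt
    (Van.congr H.metric₀₁ (.of_forall fun z ↦ by simp [quadPoly])))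

/-- The curvature terms of ρ⁻¹ and of G¹¹ cancel, so ∂_t² receives no quadratic perturbation. -/
lemma co_metric₁₁ (H : NormalForm ρ G a b c K γ e) : Co 0 3 (fun z ↦ (ρ z)⁻¹ * G 1 1 z - 1) :=
  .of_van (Van.congr (H.density.mul H.metric₁₁) (.of_forall fun z ↦ by simp only [quadPoly]; ring))

lemma co_divergence₀ (H : NormalForm ρ G a b c K γ e) :
    Co 0 2 (fun z ↦ (ρ z)⁻¹ * (pd 0 (G 0 0) z + pd 1 (G 0 1) z)) := by
  refine .of_van (.smooth_mul H.density.contDiffAt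
    (((H.metric₀₀.van_pd 0).add (H.metric₀₁.van_pd 1)).congr (.of_forall fun z ↦ ?_)))
  simp [pd_quadPoly]

/-- This is the source of the term h² K t ∂_t of the truncated operator. -/
lemma co_divergence₁ (H : NormalForm ρ G a b c K γ e) :
    Co 0 2 (fun z ↦ (ρ z)⁻¹ * (pd 0 (G 0 1) z + pd 1 (G 1 1) z) + K * z 1) := by
  have h1 : Van 1 (fun z ↦ (ρ z)⁻¹ - 1) :=
    .of_contDiffAt (H.density.contDiffAt.sub contDiffAt_const) (by
      rw [((hasJet_iff H.density.contDiffAt).1 H.density).1, sub_self])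
  have h2 := (h1.mul (Van.coord 1)).const_mul (-K)
  refine .of_van ((h2.add (.smooth_mul H.density.contDiffAt
    ((H.metric₀₁.van_pd 0).add (H.metric₁₁.van_pd 1)))).congr (.of_forall fun z ↦ ?_))
  simp [pd_quadPoly]
  ring

end NormalForm

/-- The trial function is an approximate eigenfunction of the magnetic Laplacian. -/
lemma bd_planeH_residual {ρ : E2 → ℝ} {G : Fin 2 → Fin 2 → E2 → ℝ} {a : Fin 2 → E2 → ℝ}
    {b c K : ℝ} {γ e : E2 → ℝ} (H : NormalForm ρ G a b c K γ e) {β : ℝ} {φ ζ : ℝ → ℝ}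
    (hζ0 : ∀ x, |x| < 1 / 2 → deriv ζ x = 0) (hβ : 0 < β) (hb : b ^ 2 = β ^ 2)
    (hφ : IsCut φ) (hζ : IsCut ζ) {p q : ℝ[X]} {l₁ l₂ : ℝ}
    (hp : b ^ 2 • (X * (X * p)) - gaussD β (gaussD β p) - l₁ • p = 0)
    (hq : b ^ 2 • (X * (X * q)) - gaussD β (gaussD β q) - l₁ • q
      + ((K * b ^ 2 + 2 * b * c) • (X * (X * (X * (X * p)))) + K • (X * gaussD β p) - l₂ • p)
        = 0) :
    Bd 17 (fun ε z ↦ planeH (ε ^ 8) ρ G a (trial β b φ ζ p q ε) z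
      - ((l₁ * ε ^ 8 + l₂ * ε ^ 16 : ℝ) : ℂ) * trial β b φ ζ p q ε z) := by
  have hb0 : b ≠ 0 := by
    rintro rfl
    have : 0 < β ^ 2 := by positivity
    simp only [ne_eq, OfNat.ofNat_ne_zero, not_false_eq_true, zero_pow] at hb
    linarith
  have hW := bd_trial_self (b := b) hβ hφ hζ p q
  have bp (P : ℝ[X]) (n : ℕ) := (bd_packet hβ hφ hζ P).pow_mul n
  have hU1 : Bd 4 (fun ε z ↦ modelD (ε ^ 8) b (trial β b φ ζ p q ε) z) :=
    (((bd_modelD_trial hβ hb0 hφ hζ p q).mono (by norm_num)).add (bp _ 4)).congr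
      (.of_forall fun ε z ↦ by ring)
  have hU2 : Bd 8 (fun ε z ↦ modelD (ε ^ 8) b (modelD (ε ^ 8) b (trial β b φ ζ p q ε)) z) :=
    (((bd_modelD_modelD_trial hβ hb0 hφ hζ p q).mono (by norm_num)).add (bp _ 8)).congr
      (.of_forall fun ε z ↦ by ring)
  have hT1 : Bd 4 (fun ε z ↦ (ε : ℂ) ^ 8 * pd 1 (trial β b φ ζ p q ε) z) :=
    (((bd_pd_trial hζ0 hβ hφ hζ p q).mono (by norm_num)).add (bp _ 4)).congr
      (.of_forall fun ε z ↦ by ring)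
  have hT2 := bd_pd_pd_trial (b := b) hζ0 hβ hφ hζ p q
  have hS := bd_pd_pd_trial_mixed (b := b) hζ0 hβ hφ hζ p q
  obtain ⟨cA, cA2, cA0⟩ := H.co_metric₀₀
  have cB := H.co_divergence₀
  have cC := H.co_metric₀₁
  have cD := H.co_divergence₁
  have cE := H.co_metric₁₁
  have cγ := H.co_potential
  have cγs := H.co_pd_potential
  have cbγ : Co 0 0 (fun z ↦ b + pd 1 γ z) :=
    .of_van (n := 0) (contDiffAt_const.add (pd_contDiffAt H.contDiffAt_potential 1))
  have E1 := bd_trial_residual hζ0 hβ hb hφ hζ hp hq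
  -- Each remainder is a coefficient times a quantity of known size, with budget 17. A cubic metric
  -- remainder times the squared model operator gives 9 + 8, and the potential error times the model
  -- operator 4 + 9 + 4; several others also meet the budget exactly, which fixes the width ε³.
  have E2 := hU2.coef cA (show 17 ≤ _ by norm_num)
  have E3 := (hU1.coef H.co_error (show 17 ≤ _ by norm_num)).const_mul 2
  have E4 := (hU1.coef (cA2.mul cγ) (show 17 ≤ _ by norm_num)).const_mul 2
  have E5 := ((hW.pow_mul 8).coef (cA0.mul cγs) (show 17 ≤ _ by norm_num)).const_mul Complex.I
  have E6 := hW.coef (cA0.mul (cγ.mul cγ)) (show 17 ≤ _ by norm_num)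
  have E7 := ((hU1.pow_mul 8).coef cB (show 17 ≤ _ by norm_num)).const_mul Complex.I
  have E8 := ((hW.pow_mul 8).coef (cB.mul cγ) (show 17 ≤ _ by norm_num)).const_mul Complex.I
  have E9 := (hS.coef cC (show 17 ≤ _ by norm_num)).const_mul (-2)
  have E10 := (hT1.coef (cC.mul .vertical) (show 17 ≤ _ by norm_num)).const_mul
    (2 * b * Complex.I)
  have E11 := (hT1.coef (cC.mul cγ) (show 17 ≤ _ by norm_num)).const_mul (2 * Complex.I)
  have E12 := ((hW.pow_mul 8).coef (cC.mul cbγ) (show 17 ≤ _ by norm_num)).const_mul Complex.I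
  have E13 := (hT1.pow_mul 8).coef cD (show 17 ≤ _ by norm_num)
  have E14 := hT2.coef cE (show 17 ≤ _ by norm_num)
  have F := ((((E1.add E2).add (E3.add E4)).add ((E5.add E6).add (E7.add E8))).add
    ((E9.add E10).add (E11.add E12))).sub (E13.add E14)
  -- The normal form holds only near the origin; outside the shrinking box the trial function and
  -- its image vanish identically.
  refine F.of_box ?_ ?_
  · filter_upwards [Bd.eventually_box H.smooth, Bd.eventually_box H.smooth_potential,
      Bd.eventually_box H.field₀.eventually_nhds, Bd.eventually_box H.field₁.eventually_nhds,
      Bd.eventually_box H.potential] with ε h1 h2 h3 h4 h5 z hz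
    rw [planeH_expand (h1 z hz) H.symm (h2 z hz) (h3 z hz) (h4 z hz)
      (trial_contDiff hφ hζ p q ε)]
    have h6 := congrArg (fun x : ℝ ↦ (x : ℂ)) (h5 z hz)
    push_cast at h6 ⊢
    linear_combination (-2 * modelD (ε ^ 8) b (trial β b φ ζ p q ε) z) * h6
  · filter_upwards [hW.eventually_eq_zero] with ε h z hz
    rw [(planeH_eq_zero (h z hz)).eq_of_nhds, (h z hz).eq_of_nhds]
    simp

end Residual

/-! ### Passage from pointwise bounds to relative L² bounds. -/

section Norms

open Polynomial

/-- The anisotropic dilation `(s, τ) ↦ (x s, y τ)`. -/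
def dilation {x y : ℝ} (hx : x ≠ 0) (hy : y ≠ 0) : E2 ≃ₗ[ℝ] E2 where
  toFun z := !₂[x * z 0, y * z 1]
  invFun z := !₂[x⁻¹ * z 0, y⁻¹ * z 1]
  map_add' z w := by ext i; fin_cases i <;> simp [mul_add]
  map_smul' c z := by ext i; fin_cases i <;> simp [mul_left_comm]
  left_inv z := by ext i; fin_cases i <;> simp [hx, hy]
  right_inv z := by ext i; fin_cases i <;> simp [hx, hy]

lemma dilation_apply {x y : ℝ} (hx : x ≠ 0) (hy : y ≠ 0) (z : E2) :
    dilation hx hy z 0 = x * z 0 ∧ dilation hx hy z 1 = y * z 1 := by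
  constructor <;> simp [dilation]

/-- The factor depends on the map alone, so a dilation does not affect quotients of norms and all
families can be compared at unit scale. -/
lemma eLpNorm_comp_linearEquiv (L : E2 ≃ₗ[ℝ] E2) :
    ∃ D : ENNReal, D ≠ 0 ∧ D ≠ ⊤ ∧ ∀ f : E2 → ℂ,
      eLpNorm (f ∘ L) 2 volume = D * eLpNorm f 2 volume := by
  have hd : LinearMap.det (L : E2 →ₗ[ℝ] E2) ≠ 0 := L.isUnit_det'.ne_zero
  have hm := Measure.map_linearMap_addHaar_eq_smul_addHaar (volume : Measure E2) hd
  set c := ENNReal.ofReal |(LinearMap.det (L : E2 →ₗ[ℝ] E2))⁻¹| with hc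
  have hc0 : c ≠ 0 := by
    rw [hc, Ne, ENNReal.ofReal_eq_zero, not_le]
    exact abs_pos.2 (inv_ne_zero hd)
  refine ⟨c ^ (1 / (2 : ENNReal)).toReal, ?_, ?_, fun f ↦ ?_⟩
  · exact (ENNReal.rpow_pos (pos_iff_ne_zero.2 hc0) ENNReal.ofReal_ne_top).ne'
  · exact ENNReal.rpow_ne_top_of_nonneg (by simp) ENNReal.ofReal_ne_top
  · have he : MeasurableEmbedding (L : E2 → E2) :=
      L.toContinuousLinearEquiv.toHomeomorph.measurableEmbedding
    have h1 := he.eLpNorm_map_measure (p := 2) (μ := (volume : Measure E2)) (g := f)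
    rw [← h1, show Measure.map (L : E2 → E2) volume = c • volume from hm,
      eLpNorm_smul_measure_of_ne_zero hc0]
    simp

/-- After dilation the support lies in the strip |x₀| ≤ 1, where decay in x₁ is decay in ‖x‖. The
exponent 2 is enough, since (1 + ‖x‖)⁻⁴ is integrable in the plane. -/
lemma Bd.eLpNorm_dilation_le {r : ℕ} {u : ℝ → E2 → ℂ} (hu : Bd r u) :
    ∃ C : ℝ, 0 ≤ C ∧ ∀ᶠ ε in 𝓝[>] (0 : ℝ), ∀ (h3 : ε ^ 3 ≠ 0) (h4 : ε ^ 4 ≠ 0),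
      eLpNorm (u ε ∘ dilation h3 h4) 2 volume ≤ ENNReal.ofReal (C * ε ^ r) := by
  obtain ⟨C, hC⟩ := hu.2 2
  let g : E2 → ℝ := fun x ↦ (1 + ‖x‖) ^ (-2 : ℝ)
  have hg : MemLp g 2 volume := by
    have hcont : Continuous g :=
      (continuous_const.add continuous_norm).rpow_const fun x ↦
        Or.inl (by positivity : (0 : ℝ) < 1 + ‖x‖).ne'
    rw [memLp_two_iff_integrable_sq hcont.aestronglyMeasurable]
    have := integrable_one_add_norm (E := E2) (μ := volume) (r := 4) (by simp; norm_num)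
    refine this.congr (.of_forall fun x ↦ ?_)
    change (1 + ‖x‖) ^ (-4 : ℝ) = ((1 + ‖x‖) ^ (-2 : ℝ)) ^ 2
    rw [← Real.rpow_mul_natCast (by positivity)]
    norm_num
  refine ⟨4 * |C| * (eLpNorm g 2 volume).toReal, by positivity, ?_⟩
  filter_upwards [hC, hu.1, eventually_pos_lt one_pos] with ε h1 h2 hε h3 h4
  have hε0 := hε.1
  have key (x : E2) : ‖(u ε ∘ dilation h3 h4) x‖ ≤ 4 * |C| * ε ^ r * ‖g x‖ := by
    set z := dilation h3 h4 x with hz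
    have z0 : z 0 = ε ^ 3 * x 0 := (dilation_apply h3 h4 x).1
    have z1 : z 1 = ε ^ 4 * x 1 := (dilation_apply h3 h4 x).2
    have hgx : ‖g x‖ = ((1 + ‖x‖) ^ 2)⁻¹ := by
      rw [Real.norm_of_nonneg (by positivity), ← Real.rpow_natCast, ← Real.rpow_neg (by positivity)]
      norm_num [g]
    change ‖u ε z‖ ≤ _
    by_cases h0 : u ε z = 0
    · rw [h0, norm_zero]; positivity
    have hb := (h2 z h0).1
    rw [z0, abs_mul, abs_of_pos (pow_pos hε0 3)] at hb
    have hx0 : |x 0| ≤ 1 := by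
      by_contra hn
      nlinarith [pow_pos hε0 3]
    have ht : |z 1| / ε ^ 4 = |x 1| := by
      rw [z1, abs_mul, abs_of_pos (pow_pos hε0 4)]; field_simp
    have h5 := h1 z
    rw [ht] at h5
    have h6 : 1 + ‖x‖ ≤ 2 * (1 + |x 1|) := by
      have := norm_plane_le (x 0) (x 1)
      rw [plane_eta] at this
      linarith [abs_nonneg (x 1)]
    have h7 : (1 + ‖x‖) ^ 2 ≤ 4 * (1 + |x 1|) ^ 2 := by
      calc (1 + ‖x‖) ^ 2 ≤ (2 * (1 + |x 1|)) ^ 2 := by gcongr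
        _ = _ := by ring
    rw [hgx, ← div_eq_mul_inv, le_div_iff₀ (by positivity)]
    calc ‖u ε z‖ * (1 + ‖x‖) ^ 2 ≤ ‖u ε z‖ * (4 * (1 + |x 1|) ^ 2) := by gcongr
      _ = 4 * (‖u ε z‖ * (1 + |x 1|) ^ 2) := by ring
      _ ≤ 4 * (C * ε ^ r) := by linarith
      _ ≤ 4 * (|C| * ε ^ r) := by gcongr; exact le_abs_self C
      _ = _ := by ring
  refine (eLpNorm_le_mul_eLpNorm_of_ae_le_mul (.of_forall key) 2).trans (le_of_eq ?_)
  rw [← ENNReal.ofReal_toReal hg.2.ne, ← ENNReal.ofReal_mul (by positivity)]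
  simp only [ENNReal.toReal_ofReal ENNReal.toReal_nonneg]
  congr 1; ring

/-- After dilation the trial function is within O(ε) of φ(x₀)φ(εx₁)p(x₁)e^{-βx₁²/2}. On a small ball
around (0, t) with p(t) ≠ 0 both cutoffs are 1 and this limit stays away from zero. -/
lemma trial_lower_bound {β b : ℝ} (hβ : 0 < β) {φ : ℝ → ℝ} (hφ : IsCut φ)
    (hφ1 : ∀ x, |x| ≤ 1 / 2 → φ x = 1) {p : ℝ[X]} (hp : p ≠ 0) (q : ℝ[X]) :
    ∃ c : ENNReal, c ≠ 0 ∧ ∀ᶠ ε in 𝓝[>] (0 : ℝ), ∀ (h3 : ε ^ 3 ≠ 0) (h4 : ε ^ 4 ≠ 0),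
      c ≤ eLpNorm (trial β b φ φ p q ε ∘ dilation h3 h4) 2 volume := by
  obtain ⟨t, ht⟩ : ∃ t, p.eval t ≠ 0 := by
    by_contra! hn
    exact hp (Polynomial.funext fun t ↦ by simpa using hn t)
  let f : E2 → ℝ := fun x ↦ p.eval (x 1) * Real.exp (-(β * (x 1) ^ 2 / 2))
  have cc (i : Fin 2) : Continuous fun x : E2 ↦ x i := (coord_contDiff i).continuous
  have hf : Continuous f := (p.continuous.comp (cc 1)).mul
    (((continuous_const.mul ((cc 1).pow 2)).div_const 2).neg.rexp)
  have hft : 0 < |f !₂[0, t]| := abs_pos.2 (mul_ne_zero (by simpa using ht) (Real.exp_pos _).ne')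
  set δ := |f !₂[0, t]| / 2 with hδ
  have hδ0 : 0 < δ := by positivity
  have hn : ∀ᶠ x in 𝓝 (!₂[0, t] : E2), δ < |f x| ∧ |x 0| < 1 / 2 ∧ |x 1| < |t| + 1 := by
    refine (hf.abs.continuousAt.eventually (lt_mem_nhds (by rw [hδ]; linarith))).and
      (((cc 0).abs.continuousAt.eventually (gt_mem_nhds (by norm_num))).and
      ((cc 1).abs.continuousAt.eventually (gt_mem_nhds (by simp))))
  obtain ⟨r, hr, hball⟩ := Metric.eventually_nhds_iff_ball.1 hn
  set B := Metric.ball (!₂[0, t] : E2) r with hB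
  obtain ⟨C, hC⟩ := (bd_trial (b := b) hβ hφ hφ p q).2 0
  have hBm : MeasurableSet B := Metric.isOpen_ball.measurableSet
  refine ⟨eLpNorm (B.indicator fun _ ↦ δ / 2) 2 volume, ?_, ?_⟩
  · rw [eLpNorm_indicator_const hBm two_ne_zero ENNReal.ofNat_ne_top]
    refine mul_ne_zero (by simpa using hδ0.ne') ?_
    exact (ENNReal.rpow_pos (Metric.isOpen_ball.measure_pos volume ⟨_, Metric.mem_ball_self hr⟩)
      measure_ball_lt_top.ne).ne'
  · filter_upwards [hC, eventually_pos_lt one_pos,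
      eventually_pos_lt (show 0 < δ / (2 * (|C| + 1)) by positivity),
      eventually_pos_lt (show 0 < 1 / (2 * (|t| + 1)) by positivity)] with ε h1 hε h5 h6 h3 h4
    have hε0 := hε.1
    refine eLpNorm_mono fun x ↦ ?_
    by_cases hx : x ∈ B
    swap
    · rw [Set.indicator_of_notMem hx, norm_zero]; exact norm_nonneg _
    rw [Set.indicator_of_mem hx, Real.norm_of_nonneg (by positivity)]
    obtain ⟨b1, b2, b3⟩ := hball x hx
    set z := dilation h3 h4 x with hz
    have z0 : z 0 = ε ^ 3 * x 0 := (dilation_apply h3 h4 x).1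
    have z1 : z 1 = ε ^ 4 * x 1 := (dilation_apply h3 h4 x).2
    change δ / 2 ≤ ‖trial β b φ φ p q ε z‖
    have e1 : packet β φ φ p ε z = f x := by
      have a0 : z 0 / ε ^ 3 = x 0 := by rw [z0]; field_simp
      have a1 : z 1 / ε ^ 4 = x 1 := by rw [z1]; field_simp
      have a2 : z 1 / ε ^ 3 = ε * x 1 := by rw [z1]; field_simp
      rw [packet, a0, a1, a2, hφ1 _ b2.le, hφ1, one_mul, one_mul]
      rw [abs_mul, abs_of_pos hε0]
      have := h6.2
      rw [lt_div_iff₀ (by positivity)] at this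
      nlinarith [abs_nonneg (x 1), abs_nonneg t]
    have e2 := h1 z
    rw [pow_zero, mul_one, pow_one, e1] at e2
    have e3 : C * ε ≤ δ / 2 := by
      have := h5.2
      rw [lt_div_iff₀ (by positivity)] at this
      nlinarith [le_abs_self C]
    have e4 : ‖((f x : ℝ) : ℂ)‖ = |f x| := by rw [Complex.norm_real, Real.norm_eq_abs]
    have e5 := norm_sub_norm_le ((f x : ℝ) : ℂ) (trial β b φ φ p q ε z)
    rw [norm_sub_rev] at e5
    linarith

lemma eLpNorm_le_of_restrict_le {μ ν : Measure E2} {V : Set E2}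
    (h : μ.restrict V ≤ (2 : ENNReal) • ν) {f : E2 → ℂ} (hf : Function.support f ⊆ V) :
    eLpNorm f 2 μ ≤ 2 * eLpNorm f 2 ν := by
  rw [← eLpNorm_restrict_eq_of_support_subset hf]
  refine (eLpNorm_mono_measure f h).trans ?_
  rw [eLpNorm_smul_measure_of_ne_zero two_ne_zero, smul_eq_mul]
  gcongr
  calc (2 : ENNReal) ^ (1 / (2 : ENNReal)).toReal ≤ 2 ^ (1 : ℝ) :=
        ENNReal.rpow_le_rpow_of_exponent_le (by norm_num) (by norm_num)
    _ = 2 := by simp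

/-- A residual of order `r`, relative to the trial function, in `L²` for measures comparable to
Lebesgue measure near the origin. -/
lemma Bd.eLpNorm_le_trial {r : ℕ} {u : ℝ → E2 → ℂ} (hu : Bd r u) {β b : ℝ} (hβ : 0 < β)
    {φ : ℝ → ℝ} (hφ : IsCut φ) (hφ1 : ∀ x, |x| ≤ 1 / 2 → φ x = 1) {p : ℝ[X]} (hp : p ≠ 0)
    (q : ℝ[X]) {μ : Measure E2} {V : Set E2} (hV : V ∈ 𝓝 (0 : E2))
    (h1 : μ.restrict V ≤ (2 : ENNReal) • volume)
    (h2 : (volume : Measure E2).restrict V ≤ (2 : ENNReal) • μ) :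
    ∃ C : ℝ, ∀ᶠ ε in 𝓝[>] (0 : ℝ), eLpNorm (u ε) 2 μ ≤
      ENNReal.ofReal (C * ε ^ r) * eLpNorm (trial β b φ φ p q ε) 2 μ := by
  obtain ⟨C, hC0, hC⟩ := hu.eLpNorm_dilation_le
  obtain ⟨c, hc0, hc⟩ := trial_lower_bound (b := b) hβ hφ hφ1 hp q
  -- Truncation at 1 keeps the constant finite, so that it may be inverted; the final factor 4 comes
  -- from two comparisons of μ with Lebesgue measure.
  set c' := min c 1 with hc'
  have hc0' : c' ≠ 0 := (lt_min (pos_iff_ne_zero.2 hc0) one_pos).ne'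
  have hc1' : c' ≠ ⊤ := (min_le_right _ _).trans_lt ENNReal.one_lt_top |>.ne
  refine ⟨4 * (C * (c'⁻¹).toReal), ?_⟩
  have hbox : ∀ᶠ z : E2 in 𝓝 0, z ∈ V := hV
  filter_upwards [hC, hc, hu.1, (bd_trial_self (b := b) hβ hφ hφ p q).1, Bd.eventually_box hbox,
    eventually_pos_lt one_pos] with ε k1 k2 k3 k4 k5 hε
  have hε0 := hε.1
  obtain ⟨D, hD0, hD1, hD⟩ := eLpNorm_comp_linearEquiv
    (dilation (pow_ne_zero 3 hε0.ne') (pow_ne_zero 4 hε0.ne'))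
  have k1 := k1 (pow_ne_zero 3 hε0.ne') (pow_ne_zero 4 hε0.ne')
  have k2 := k2 (pow_ne_zero 3 hε0.ne') (pow_ne_zero 4 hε0.ne')
  rw [hD] at k1 k2
  set N := eLpNorm (trial β b φ φ p q ε) 2 volume with hN
  have m1 : eLpNorm (u ε) 2 volume ≤ ENNReal.ofReal (C * (c'⁻¹).toReal * ε ^ r) * N := by
    rw [← ENNReal.mul_le_mul_iff_right hD0 hD1]
    calc D * eLpNorm (u ε) 2 volume ≤ ENNReal.ofReal (C * ε ^ r) * (c'⁻¹ * c') := by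
          rw [ENNReal.inv_mul_cancel hc0' hc1', mul_one]; exact k1
      _ ≤ ENNReal.ofReal (C * ε ^ r) * (c'⁻¹ * (D * N)) := by
          gcongr; exact (min_le_left _ _).trans k2
      _ = D * (ENNReal.ofReal (C * (c'⁻¹).toReal * ε ^ r) * N) := by
          rw [show C * (c'⁻¹).toReal * ε ^ r = C * ε ^ r * (c'⁻¹).toReal by ring,
            ENNReal.ofReal_mul (p := C * ε ^ r) (by positivity),
            ENNReal.ofReal_toReal (ENNReal.inv_ne_top.2 hc0')]
          ring
  calc eLpNorm (u ε) 2 μ ≤ 2 * eLpNorm (u ε) 2 volume :=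
        eLpNorm_le_of_restrict_le h1 fun z hz ↦ k5 z (k3 z hz)
    _ ≤ 2 * (ENNReal.ofReal (C * (c'⁻¹).toReal * ε ^ r) *
          (2 * eLpNorm (trial β b φ φ p q ε) 2 μ)) := by
        gcongr
        exact m1.trans (mul_le_mul_right
          (eLpNorm_le_of_restrict_le h2 fun z hz ↦ k5 z (k4 z hz)) _)
    _ = _ := by
        rw [show 4 * (C * (c'⁻¹).toReal) * ε ^ r = 2 * 2 * (C * (c'⁻¹).toReal * ε ^ r) by ring,
          ENNReal.ofReal_mul (p := 2 * 2) (by norm_num), ENNReal.ofReal_mul (p := 2) (by norm_num),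
          ENNReal.ofReal_ofNat]
        ring

end Norms

/-! ### Reaching the normal form around a point, and comparing measures there. -/

section Localization

variable {M : Type*} [TopologicalSpace M] [T2Space M] [MeasurableSpace M] [BorelSpace M]
  [ChartedSpace (EuclideanHalfSpace 2) M]
  [IsManifold (𝓡∂ 2) ∞ M] [RiemannianBundle (fun p : M ↦ TangentSpace (𝓡∂ 2) p)]
  [IsContMDiffRiemannianBundle (𝓡∂ 2) ∞ E2 (fun p : M ↦ TangentSpace (𝓡∂ 2) p)]
  {A : ∀ p : M, TangentSpace (𝓡∂ 2) p →L[ℝ] ℝ} {ψ : E2 → M}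

/-- In suitable coordinates, and after a gauge transformation, the data are in normal form. -/
lemma exists_normalForm (hA : IsSmoothForm A) (h : IsLocalDiffeomorphAt 𝓘(ℝ, E2) (𝓡∂ 2) ∞ ψ 0)
    {K b₀ b₂ : ℝ} (h00 : HasJet (met ψ 0 0) 1 0 0 0 0 (-(2 * K)))
    (h01 : HasJet (met ψ 0 1) 0 0 0 0 0 0) (h11 : HasJet (met ψ 1 1) 1 0 0 0 0 0)
    (hb : HasJet (fun z ↦ |fieldStrength A (ψ z)|) b₀ 0 0 0 0 b₂) (hb₀ : 0 < b₀) :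
    ∃ σ : ℝ, (σ = 1 ∨ σ = -1) ∧ ∃ θ γ e : E2 → ℝ, ContDiff ℝ ∞ θ ∧
      NormalForm (dens ψ) (coMet ψ) (fun i y ↦ cof A ψ i y - pd i θ y)
        (σ * b₀) (σ * (b₂ - b₀ * K) / 6) K γ e := by
  have hdens := dens_hasJet h h00 h01 h11
  obtain ⟨c00, c01, c11⟩ := coMet_hasJet h h00 h01 h11
  have hval : |fieldStrength A (ψ 0)| = b₀ := ((hasJet_iff hb.contDiffAt).1 hb).1
  obtain ⟨σ, hσ, hcurl, -⟩ := exists_sign_curl hA h (by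
    intro h0; rw [h0, abs_zero] at hval; exact hb₀.ne hval)
  have hσ2 : σ * σ = 1 := by rcases hσ with rfl | rfl <;> norm_num
  have hloc := eventually_isLocalDiffeomorphAt h
  have hcof (i : Fin 2) : ∀ᶠ z in 𝓝 0, ContDiffAt ℝ ∞ (cof A ψ i) z :=
    hloc.mono fun z hz ↦ cof_contDiffAt hA hz.contMDiffAt i
  obtain ⟨θ, hθ, hθ1, hθ0⟩ := exists_gauge (hcof 0) (hcof 1)
  have hα : ∀ᶠ z in 𝓝 0, ContDiffAt ℝ ∞ (fun y ↦ cof A ψ 0 y - pd 0 θ y) z :=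
    (hcof 0).mono fun z hz ↦ hz.sub (pd_contDiff hθ 0).contDiffAt
  have s1 (z : E2) : ContDiffAt ℝ ∞ (fun y : E2 ↦ y 1) z := (coord_contDiff 1).contDiffAt
  have s3 (c : ℝ) (z : E2) : ContDiffAt ℝ ∞ (fun y : E2 ↦ c * (y 1 * (y 1 * y 1))) z :=
    contDiffAt_const.mul ((s1 z).mul ((s1 z).mul (s1 z)))
  -- The curl is, up to sign, |b| times the area density, so its second t-derivative is β₂ corrected
  -- by the curvature term -b₀K.
  have hcurl' : HasJet (curl A ψ) (σ * b₀) 0 0 0 0 (σ * (b₂ - b₀ * K)) := by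
    have h1 := ((hasJet_quadPoly σ 0 0 0 0 0).mul (hb.mul hdens)).of_eq (c' := σ * b₀)
      (l0' := 0) (l1' := 0) (q00' := 0) (q01' := 0) (q11' := σ * (b₂ - b₀ * K))
      (by ring) (by ring) (by ring) (by ring) (by ring) (by ring)
    refine h1.congr ?_
    filter_upwards [hcurl] with z hz
    rw [hz, show quadPoly σ 0 0 0 0 0 z = σ by simp [quadPoly], ← mul_assoc, hσ2, one_mul]
  -- The second component of the potential is gone, so ∂_t a₀ = -curl: hence the minus signs, and
  -- the 1/6 from integrating a quadratic Taylor term.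
  set b := -σ * b₀ with hbdef
  set c := -σ * (b₂ - b₀ * K) / 6 with hcdef
  let γ : E2 → ℝ := fun z ↦ cof A ψ 0 z - pd 0 θ z - b * z 1
  let e : E2 → ℝ := fun z ↦ γ z - c * (z 1 * (z 1 * z 1))
  have hγ : ∀ᶠ z in 𝓝 0, ContDiffAt ℝ ∞ γ z :=
    hα.mono fun z hz ↦ hz.sub (contDiffAt_const.mul (s1 z))
  have he : ∀ᶠ z in 𝓝 0, ContDiffAt ℝ ∞ e z := hγ.mono fun z hz ↦ hz.sub (s3 c z)
  refine ⟨-σ, by rcases hσ with rfl | rfl <;> simp, θ, γ, e, hθ, ?_⟩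
  refine { smooth := ?_, symm := coMet_symm ψ 1 0, density := inv_dens_hasJet h hdens,
           metric₀₀ := c00, metric₀₁ := c01, metric₁₁ := c11, field₀ := ?_, field₁ := ?_,
           smooth_potential := hγ, potential := ?_, smooth_error := he, error := ?_,
           error_axis := ?_ }
  · exact hloc.mono fun z hz i j ↦ coMet_contDiffAt hz i j
  · exact .of_forall fun z ↦ by simp only [γ]; ring
  · filter_upwards [hθ1] with z hz
    simp [hz]
  · exact .of_forall fun z ↦ by simp only [e]; ring
  · refine (Van.neg hcurl').congr ?_
    filter_upwards [hα, hcof 0, hγ, hθ1.eventually_nhds] with z h1 h2 h3 h4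
    have d1 : DifferentiableAt ℝ (fun y : E2 ↦ y 1) z := smooth_diffAt (s1 z)
    have d2 := smooth_diffAt (pd_contDiff hθ 0).contDiffAt (z := z)
    rw [pd_sub (smooth_diffAt h3) (pd_cube c 1 z).1, (pd_cube c 1 z).2,
      pd_sub (smooth_diffAt h1) (d1.const_mul b), pd_sub (smooth_diffAt h2) d2,
      pd_const_mul b d1, pd_coord, pd_comm hθ.contDiffAt 1 0, pd_congr_at h4]
    simp only [curl, quadPoly, hbdef, hcdef, if_pos]
    ring
  · filter_upwards [hθ0] with z hz h1
    simp [e, γ, h1, hz h1]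

/-- A partial diffeomorphism, restricted to an open set. -/
def restrictOpen (Φ : PartialDiffeomorph 𝓘(ℝ, E2) (𝓡∂ 2) E2 M ∞) (U : Set M) (hU : IsOpen U) :
    PartialDiffeomorph 𝓘(ℝ, E2) (𝓡∂ 2) E2 M ∞ where
  toPartialEquiv := Φ.toPartialEquiv.restr (Φ ⁻¹' U)
  open_source := Φ.contMDiffOn_toFun.continuousOn.isOpen_inter_preimage Φ.open_source hU
  open_target := by
    have : (Φ.toPartialEquiv.restr (Φ ⁻¹' U)).target = Φ.target ∩ U := by
      ext p
      simp only [PartialEquiv.restr_target, Set.mem_inter_iff, Set.mem_preimage]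
      refine and_congr_right fun hp ↦ ?_
      rw [show Φ.toFun (Φ.toPartialEquiv.symm p) = p from Φ.right_inv hp]
    rw [this]
    exact Φ.open_target.inter hU
  contMDiffOn_toFun := Φ.contMDiffOn_toFun.mono Set.inter_subset_left
  contMDiffOn_invFun := Φ.contMDiffOn_invFun.mono Set.inter_subset_left

/-- The prescribed set will be the domain of one chart, as the formula for the area measure
requires. -/
lemma exists_partialDiffeomorph (h : IsLocalDiffeomorphAt 𝓘(ℝ, E2) (𝓡∂ 2) ∞ ψ 0) {U : Set M}
    (hU : IsOpen U) (h0 : ψ 0 ∈ U) :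
    ∃ Φ : PartialDiffeomorph 𝓘(ℝ, E2) (𝓡∂ 2) E2 M ∞, 0 ∈ Φ.source ∧ Φ.target ⊆ U ∧
      ψ =ᶠ[𝓝 0] Φ := by
  obtain ⟨Φ, hΦ, he⟩ := h
  have h0' : (0 : E2) ∈ (restrictOpen Φ U hU).source := ⟨hΦ, by
    change Φ 0 ∈ U
    rw [← he hΦ]; exact h0⟩
  refine ⟨restrictOpen Φ U hU, h0', fun p hp ↦ ?_, ?_⟩
  · have h1 : Φ.toFun (Φ.toPartialEquiv.symm p) ∈ U := hp.2
    rwa [show Φ.toFun (Φ.toPartialEquiv.symm p) = p from Φ.right_inv hp.1] at h1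
  · filter_upwards [Φ.open_source.mem_nhds hΦ] with z hz using he hz

/-- Near a point where the density is one, the volume is comparable to Lebesgue measure. -/
lemma exists_paramVolume_comparable (Φ : PartialDiffeomorph 𝓘(ℝ, E2) (𝓡∂ 2) E2 M ∞)
    (h0 : 0 ∈ Φ.source) (hd : dens Φ 0 = 1) :
    ∃ V ∈ 𝓝 (0 : E2), (paramVolume Φ).restrict V ≤ (2 : ENNReal) • volume ∧
      (volume : Measure E2).restrict V ≤ (2 : ENNReal) • paramVolume Φ := by
  have hc : ContinuousAt (dens Φ) 0 :=
    (dens_contDiffAt (Φ.isLocalDiffeomorphAt _ _ _ h0)).continuousAt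
  have hev : ∀ᶠ z in 𝓝 (0 : E2), z ∈ Φ.source ∧ 1 / 2 < dens Φ z ∧ dens Φ z < 2 :=
    (Φ.open_source.eventually_mem h0).and
      ((hc.eventually (lt_mem_nhds (by rw [hd]; norm_num))).and
        (hc.eventually (gt_mem_nhds (by rw [hd]; norm_num))))
  obtain ⟨V, hV, hVo, hV0⟩ := eventually_nhds_iff.1 hev
  refine ⟨V, hVo.mem_nhds hV0, ?_, ?_⟩
  all_goals
    have e : (paramVolume Φ).restrict V =
        ((volume : Measure E2).restrict V).withDensity fun z ↦ ENNReal.ofReal (dens Φ z) := by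
      rw [paramVolume, restrict_withDensity hVo.measurableSet,
        Measure.restrict_restrict_of_subset fun z hz ↦ (hV z hz).1]
      rfl
  · rw [e]
    calc _ ≤ ((volume : Measure E2).restrict V).withDensity fun _ ↦ (2 : ENNReal) := by
          refine withDensity_mono ((ae_restrict_iff' hVo.measurableSet).2 (.of_forall fun z hz ↦ ?_))
          exact (ENNReal.ofReal_le_ofReal (hV z hz).2.2.le).trans (by simp)
      _ = (2 : ENNReal) • (volume : Measure E2).restrict V := withDensity_const 2
      _ ≤ _ := by gcongr; exact Measure.restrict_le_self
  · calc (volume : Measure E2).restrict V =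
          (2 : ENNReal) • ((2 : ENNReal)⁻¹ • (volume : Measure E2).restrict V) := by
          rw [smul_smul, ENNReal.mul_inv_cancel two_ne_zero ENNReal.ofNat_ne_top, one_smul]
      _ = (2 : ENNReal) • ((volume : Measure E2).restrict V).withDensity
            fun _ ↦ (2 : ENNReal)⁻¹ := by rw [withDensity_const]
      _ ≤ (2 : ENNReal) • (paramVolume Φ).restrict V := by
          rw [e]
          gcongr
          refine withDensity_mono ((ae_restrict_iff' hVo.measurableSet).2 (.of_forall fun z hz ↦ ?_))
          have h2 : (2 : ENNReal)⁻¹ = ENNReal.ofReal 2⁻¹ := by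
            rw [ENNReal.ofReal_inv_of_pos two_pos, ENNReal.ofReal_ofNat]
          exact h2.trans_le (ENNReal.ofReal_le_ofReal (by have := (hV z hz).2.1; linarith))
      _ ≤ _ := by gcongr; exact Measure.restrict_le_self

end Localization

/-! ### Assembly of the quasimodes. -/

section Quasimodes

open Polynomial

lemma exists_isCut : ∃ φ : ℝ → ℝ, IsCut φ ∧ ∀ x, |x| ≤ 1 / 2 → φ x = 1 := by
  let f : ContDiffBump (0 : ℝ) := ⟨1 / 2, 1, by norm_num, by norm_num⟩
  refine ⟨f, ⟨f.contDiff, fun x hx ↦ f.zero_of_le_dist ?_⟩, fun x hx ↦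
    f.one_of_mem_closedBall ?_⟩
  · rw [dist_zero_right, Real.norm_eq_abs]; exact hx.le
  · rw [mem_closedBall_zero_iff, Real.norm_eq_abs]; exact hx

/-- Quasimodes in the plane. -/
lemma exists_planar_quasimode {ρ : E2 → ℝ} {G : Fin 2 → Fin 2 → E2 → ℝ} {a : Fin 2 → E2 → ℝ}
    {K b₀ b₂ σ : ℝ} {γ e : E2 → ℝ} (hσ : σ = 1 ∨ σ = -1) (hb₀ : 0 < b₀)
    (H : NormalForm ρ G a (σ * b₀) (σ * (b₂ - b₀ * K) / 6) K γ e) (k : ℕ)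
    {μ : Measure E2} {V : Set E2} (hV : V ∈ 𝓝 (0 : E2))
    (h1 : μ.restrict V ≤ (2 : ENNReal) • volume)
    (h2 : (volume : Measure E2).restrict V ≤ (2 : ENNReal) • μ) :
    ∃ W : ℝ → E2 → ℂ, Bd 0 W ∧ (∀ ε, ContDiff ℝ ∞ (W ε)) ∧
      (∀ᶠ ε in 𝓝[>] (0 : ℝ), W ε ≠ 0) ∧ ∃ C : ℝ, ∀ᶠ ε in 𝓝[>] (0 : ℝ),
        eLpNorm (fun z ↦ planeH (ε ^ 8) ρ G a (W ε) z - (((2 * k + 1) * b₀ * ε ^ 8 +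
          ((2 * k ^ 2 + 2 * k + 1) * (b₂ / (4 * b₀)) + K * (k ^ 2 + k)) * ε ^ 16 : ℝ) : ℂ)
            * W ε z) 2 μ ≤ ENNReal.ofReal (C * ε ^ 17) * eLpNorm (W ε) 2 μ := by
  obtain ⟨φ, hφ, hφ1⟩ := exists_isCut
  have hφ0 (x : ℝ) (hx : |x| < 1 / 2) : deriv φ x = 0 := by
    have : φ =ᶠ[𝓝 x] fun _ ↦ 1 := by
      filter_upwards [continuous_abs.continuousAt.eventually (gt_mem_nhds hx)] with y hy
      exact hφ1 y hy.le
    rw [this.deriv_eq]; simp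
  set b := σ * b₀ with hb
  set c := σ * (b₂ - b₀ * K) / 6 with hc
  have hσ2 : σ ^ 2 = 1 := by rcases hσ with rfl | rfl <;> norm_num
  have hb2 : b ^ 2 = b₀ ^ 2 := by rw [hb, mul_pow, hσ2, one_mul]
  have hbc : 2 * b * c = b₀ * (b₂ - b₀ * K) / 3 := by
    rw [hb, hc]; linear_combination (b₀ * (b₂ - b₀ * K) / 3) * hσ2
  obtain ⟨p, q, hp0, hp, hq⟩ := exists_perturbed_hermite hb₀ K (K * b ^ 2 + 2 * b * c) k
  -- The energy shift with κ = (2Kb₀² + b₀b₂)/3: the multiples of K add up to -K/2 + K(2k²+2k+1)/2 =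
  -- K(k²+k).
  have hl : -(K / 2) + 3 * (K * b ^ 2 + 2 * b * c) / (4 * b₀ ^ 2) * (2 * k ^ 2 + 2 * k + 1) =
      (2 * k ^ 2 + 2 * k + 1) * (b₂ / (4 * b₀)) + K * (k ^ 2 + k) := by
    rw [hb2, hbc]; field_simp; ring
  rw [hl] at hq
  set l₂ := (2 * k ^ 2 + 2 * k + 1) * (b₂ / (4 * b₀)) + K * (k ^ 2 + k) with hl₂
  have hR := bd_planeH_residual H hφ0 hb₀ hb2 hφ hφ (p := p) (q := q) (l₁ := (2 * k + 1) * b₀)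
    (l₂ := l₂) (by rw [hb2, ← hp]; simp only [smul_eq_C_mul]; ring)
    (by rw [← hq, hb2]; simp only [smul_eq_C_mul]; ring)
  refine ⟨trial b₀ b φ φ p q, bd_trial_self hb₀ hφ hφ p q, trial_contDiff hφ hφ p q, ?_,
    hR.eLpNorm_le_trial hb₀ hφ hφ1 hp0 q hV h1 h2⟩
  obtain ⟨m, hm, hlow⟩ := trial_lower_bound (b := b) hb₀ hφ hφ1 hp0 q
  filter_upwards [hlow, eventually_pos_lt one_pos] with ε hlow hε h0
  have := hlow (pow_ne_zero 3 hε.1.ne') (pow_ne_zero 4 hε.1.ne')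
  rw [h0, Pi.zero_comp, eLpNorm_zero] at this
  exact hm (le_zero_iff.1 this)

lemma Bd.eventually_suppIn {r : ℕ} {u : ℝ → E2 → ℂ} (hu : Bd r u)
    (hs : ∀ ε, ContDiff ℝ ∞ (u ε)) {V : Set E2} (hV : V ∈ 𝓝 (0 : E2)) :
    ∀ᶠ ε in 𝓝[>] (0 : ℝ), SuppIn V (u ε) := by
  obtain ⟨r, hr, hrV⟩ := Metric.nhds_basis_closedBall.mem_iff.1 hV
  have hball : ∀ᶠ z : E2 in 𝓝 0, z ∈ Metric.closedBall (0 : E2) r :=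
    Metric.closedBall_mem_nhds 0 hr
  filter_upwards [hu.1, Bd.eventually_box hball] with ε h1 h2
  have hsub : Function.support (u ε) ⊆ Metric.closedBall 0 r := fun z hz ↦ h2 z (h1 z hz)
  exact ⟨hs ε, HasCompactSupport.of_support_subset_isCompact (isCompact_closedBall 0 r) hsub,
    (closure_minimal hsub Metric.isClosed_closedBall).trans hrV⟩

lemma SuppIn.mul_left {V : Set E2} {w f : E2 → ℂ} (hw : SuppIn V w) (hf : ContDiff ℝ ∞ f) :
    SuppIn V (fun z ↦ f z * w z) :=
  hw.of_local (fun _ _ ↦ (hf.mul hw.smooth).contDiffAt) fun z hz ↦ by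
    filter_upwards [hz] with y hy
    rw [hy]; simp

variable {M : Type*} [TopologicalSpace M] [T2Space M] [MeasurableSpace M] [BorelSpace M]
  [ChartedSpace (EuclideanHalfSpace 2) M]
  [IsManifold (𝓡∂ 2) ∞ M] [RiemannianBundle (fun p : M ↦ TangentSpace (𝓡∂ 2) p)]
  [IsContMDiffRiemannianBundle (𝓡∂ 2) ∞ E2 (fun p : M ↦ TangentSpace (𝓡∂ 2) p)]
  {A : ∀ p : M, TangentSpace (𝓡∂ 2) p →L[ℝ] ℝ}

/-- Transplantation of a function on the plane to the surface. -/
lemma eLpNorm_magneticLaplacian_push (Φ : PartialDiffeomorph 𝓘(ℝ, E2) (𝓡∂ 2) E2 M ∞) {x : M}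
    (hx : Φ.target ⊆ (extChartAt (𝓡∂ 2) x).source) (hA : IsSmoothForm A) {h : ℝ} (hh : h ≠ 0)
    {θ : E2 → ℝ} (hθ : ContDiff ℝ ∞ θ) {w : E2 → ℂ} (hw : SuppIn Φ.source w) (l : ℂ) :
    eLpNorm (push Φ fun z ↦ phase h θ z * w z) 2 (riemannianVolume M) =
      eLpNorm w 2 (paramVolume Φ) ∧
    eLpNorm (fun p ↦ push Φ (planeH h (dens Φ) (coMet Φ) (cof A Φ) fun z ↦ phase h θ z * w z) p
      - l * push Φ (fun z ↦ phase h θ z * w z) p) 2 (riemannianVolume M) =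
    eLpNorm (fun z ↦ planeH h (dens Φ) (coMet Φ) (fun i y ↦ cof A Φ i y - pd i θ y) w z - l * w z)
      2 (paramVolume Φ) := by
  have hv := hw.mul_left (phase_contDiff hθ (h := h))
  have hH := (isMagneticLaplacian_push Φ hx hA h hv).1
  constructor
  · rw [eLpNorm_push Φ hx hv.smooth.continuous]
    refine eLpNorm_congr_norm_ae (.of_forall fun z ↦ ?_)
    rw [norm_mul, norm_phase, one_mul]
  · have e : (fun p ↦ push Φ (planeH h (dens Φ) (coMet Φ) (cof A Φ) fun z ↦ phase h θ z * w z) p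
        - l * push Φ (fun z ↦ phase h θ z * w z) p) =
        push Φ (fun z ↦ planeH h (dens Φ) (coMet Φ) (cof A Φ) (fun z ↦ phase h θ z * w z) z
          - l * (phase h θ z * w z)) := by
      funext p
      by_cases hp : p ∈ Φ.target <;> simp [push, hp]
    have hc : Continuous fun z ↦ planeH h (dens Φ) (coMet Φ) (cof A Φ)
        (fun z ↦ phase h θ z * w z) z - l * (phase h θ z * w z) :=
      hH.smooth.continuous.sub (continuous_const.mul hv.smooth.continuous)
    rw [e, eLpNorm_push Φ hx hc]
    refine eLpNorm_congr_norm_ae (.of_forall fun z ↦ ?_)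
    -- Gauge covariance needs smooth coefficients, known inside `Φ.source` only; off the support of
    -- w both sides vanish by locality.
    by_cases hz : z ∈ tsupport w
    · have hl : IsLocalDiffeomorphAt 𝓘(ℝ, E2) (𝓡∂ 2) ∞ Φ z :=
        Φ.isLocalDiffeomorphAt _ _ _ (hw.subset hz)
      rw [planeH_phase hh hθ _ (fun i j ↦ coMet_contDiffAt hl i j)
        (fun i ↦ cof_contDiffAt hA hl.contMDiffAt i) hw.smooth, mul_left_comm, ← mul_sub, norm_mul,
        norm_phase, one_mul]
    · have h0 := eventuallyEq_zero_of_notMem hz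
      have h1 : (fun z ↦ phase h θ z * w z) =ᶠ[𝓝 z] 0 := by
        filter_upwards [h0] with y hy
        rw [hy]; simp
      have h2 := h0.eq_of_nhds
      rw [(planeH_eq_zero h0).eq_of_nhds, (planeH_eq_zero h1).eq_of_nhds, h2]
      simp

/-- Quasimodes concentrated near a point of the well. -/
theorem exists_quasimode (hA : IsSmoothForm A) (hb₀ : 0 < minField A)
    (hcurve : IsSmoothCurve (well A)) (hinterior : well A ⊆ (𝓡∂ 2).interior M)
    {N : ∀ p : M, TangentSpace (𝓡∂ 2) p} (hN : IsNormalGeodesicField (well A) N)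
    {x : M} (hx : x ∈ well A) (k : ℕ) :
    ∃ C h₀ : ℝ, 0 < h₀ ∧ ∀ h ∈ Set.Ioc (0 : ℝ) h₀,
      ∃ Φ HΦ : M → ℂ, IsTestFunction Φ ∧ Φ ≠ 0 ∧ IsMagneticLaplacian h A Φ HΦ ∧
        eLpNorm (fun p ↦ HΦ p - (quasiEigenvalue A N h k x : ℂ) * Φ p) 2 (riemannianVolume M)
          ≤ ENNReal.ofReal (C * h ^ (17 / 8 : ℝ)) * eLpNorm Φ 2 (riemannianVolume M) := by
  obtain ⟨U, hU, hSU, -, hN1, -, -⟩ := id hN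
  obtain ⟨χ, hχ, hχ0, hv, h00, h01, h11⟩ := exists_normal_param (hinterior hx) (hN1 x (hSU hx))
  have hj := fieldStrength_hasJet hA hχ hb₀ (hχ0 ▸ hx) hcurve hN hv
    ((hasJet_iff h01.contDiffAt).1 h01).1 ((hasJet_iff h11.contDiffAt).1 h11).1
  rw [hχ0] at hj
  obtain ⟨Ψ, hΨ0, hΨt, hΨ⟩ := exists_partialDiffeomorph hχ (isOpen_extChartAt_source (I := 𝓡∂ 2) x)
    (by rw [hχ0]; exact mem_extChartAt_source x)
  have hmet (i j : Fin 2) : met χ i j =ᶠ[𝓝 0] met Ψ i j :=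
    hΨ.eventually_nhds.mono fun z hz ↦ met_congr hz i j
  set K := scalarCurvature x / 2 with hK
  have hl : IsLocalDiffeomorphAt 𝓘(ℝ, E2) (𝓡∂ 2) ∞ Ψ 0 := Ψ.isLocalDiffeomorphAt _ _ _ hΨ0
  have g00 : HasJet (met Ψ 0 0) 1 0 0 0 0 (-(2 * K)) := by
    rw [hK, mul_div_cancel₀ _ two_ne_zero]; exact h00.congr (hmet 0 0)
  have g01 := h01.congr (hmet 0 1)
  have g11 := h11.congr (hmet 1 1)
  have gj : HasJet (fun z ↦ |fieldStrength A (Ψ z)|) (minField A) 0 0 0 0 (beta2 A N x) :=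
    hj.congr (hΨ.mono fun z hz ↦ by simp only [hz])
  obtain ⟨σ, hσ, θ, γ, e, hθ, H⟩ := exists_normalForm hA hl g00 g01 g11 gj hb₀
  have hd := dens_hasJet hl g00 g01 g11
  obtain ⟨V, hV, hV1, hV2⟩ := exists_paramVolume_comparable Ψ hΨ0
    ((hasJet_iff hd.contDiffAt).1 hd).1
  obtain ⟨W, hW, hWs, hW0, C, hC⟩ := exists_planar_quasimode hσ hb₀ H k hV hV1 hV2
  -- All planar assertions hold for small ε > 0; the bound on h is the eighth power of δ/2, so that
  -- ε = h^{1/8} stays strictly inside the interval.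
  obtain ⟨δ, hδ, hall⟩ := mem_nhdsGT_iff_exists_Ioo_subset.1
    ((hC.and hW0).and (hW.eventually_suppIn hWs (Ψ.open_source.mem_nhds hΨ0)))
  rw [Set.mem_Ioi] at hδ
  refine ⟨C, (δ / 2) ^ 8, by positivity, fun h hh ↦ ?_⟩
  set ε := h ^ (1 / 8 : ℝ) with hε
  have hε0 : 0 < ε := Real.rpow_pos_of_pos hh.1 _
  have hε8 : ε ^ 8 = h := by
    rw [hε, ← Real.rpow_mul_natCast hh.1.le]; norm_num
  have hε17 : ε ^ 17 = h ^ (17 / 8 : ℝ) := by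
    rw [hε, ← Real.rpow_mul_natCast hh.1.le]; norm_num
  have hεδ : ε < δ := by
    have : ε ≤ δ / 2 := by
      refine le_of_pow_le_pow_left₀ (n := 8) (by norm_num) (by positivity) ?_
      rw [hε8]; exact hh.2
    linarith
  obtain ⟨⟨hle, hne⟩, hsupp⟩ := hall ⟨hε0, hεδ⟩
  have hlam : quasiEigenvalue A N h k x = (2 * k + 1) * minField A * ε ^ 8 +
      ((2 * k ^ 2 + 2 * k + 1) * (beta2 A N x / (4 * minField A)) + K * (k ^ 2 + k)) * ε ^ 16 := by
    rw [show ε ^ 16 = (ε ^ 8) ^ 2 by ring, hε8, quasiEigenvalue, hK]; ring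
  obtain ⟨e1, e2⟩ := eLpNorm_magneticLaplacian_push Ψ hΨt hA hh.1.ne' hθ hsupp
    (quasiEigenvalue A N h k x : ℂ)
  have hv' := hsupp.mul_left (phase_contDiff hθ (h := h))
  refine ⟨push Ψ fun z ↦ phase h θ z * W ε z, _, isTestFunction_push Ψ hv', fun h0 ↦ hne ?_,
    (isMagneticLaplacian_push Ψ hΨt hA h hv').2, ?_⟩
  · funext z
    by_cases hz : z ∈ Ψ.source
    · have h1 := push_apply Ψ (fun z ↦ phase h θ z * W ε z) hz
      rw [h0, Pi.zero_apply] at h1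
      refine (mul_eq_zero.1 h1.symm).resolve_left fun h2 ↦ ?_
      have := norm_phase h θ z
      rw [h2] at this; simp at this
    · exact image_eq_zero_of_notMem_tsupport fun hn ↦ hz (hsupp.subset hn)
  · rw [e1, e2, ← hε17, hlam]
    rw [hε8] at hle
    rw [hε8]
    exact hle

end Quasimodes

end MagneticWell

end

theorem theorem2p1 {M : Type*} [TopologicalSpace M] [T2Space M] [CompactSpace M]
    [ConnectedSpace M] [MeasurableSpace M] [BorelSpace M]
    [ChartedSpace (EuclideanHalfSpace 2) M] [IsManifold (𝓡∂ 2) ∞ M]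
    [RiemannianBundle (fun p : M ↦ TangentSpace (𝓡∂ 2) p)]
    [IsContMDiffRiemannianBundle (𝓡∂ 2) ∞ (EuclideanSpace ℝ (Fin 2))
      (fun p : M ↦ TangentSpace (𝓡∂ 2) p)]
    (horient : MagneticWell.IsOrientedAtlas M)
    (A : ∀ p : M, TangentSpace (𝓡∂ 2) p →L[ℝ] ℝ) (hA : MagneticWell.IsSmoothForm A)
    (hb₀ : 0 < MagneticWell.minField A)
    (hcurve : MagneticWell.IsSmoothCurve (MagneticWell.well A))
    (hinterior : MagneticWell.well A ⊆ (𝓡∂ 2).interior M)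
    (hwell : ∃ C : ℝ, 0 < C ∧ ∃ U : Set M, IsOpen U ∧ MagneticWell.well A ⊆ U ∧ ∀ p ∈ U,
      C⁻¹ * MagneticWell.distTo (MagneticWell.well A) p ^ 2
          ≤ |MagneticWell.fieldStrength A p| - MagneticWell.minField A ∧
        |MagneticWell.fieldStrength A p| - MagneticWell.minField A
          ≤ C * MagneticWell.distTo (MagneticWell.well A) p ^ 2)
    (N : ∀ p : M, TangentSpace (𝓡∂ 2) p)
    (hN : MagneticWell.IsNormalGeodesicField (MagneticWell.well A) N) :
    ∀ x ∈ MagneticWell.well A, ∀ k : ℕ, ∃ C h₀ : ℝ, 0 < h₀ ∧ ∀ h ∈ Set.Ioc (0 : ℝ) h₀,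
      ∃ Φ HΦ : M → ℂ, MagneticWell.IsTestFunction Φ ∧ Φ ≠ 0 ∧
        MagneticWell.IsMagneticLaplacian h A Φ HΦ ∧
        eLpNorm (fun p ↦ HΦ p - (MagneticWell.quasiEigenvalue A N h k x : ℂ) * Φ p) 2
            (MagneticWell.riemannianVolume M)
          ≤ ENNReal.ofReal (C * h ^ (17 / 8 : ℝ))
            * eLpNorm Φ 2 (MagneticWell.riemannianVolume M) := by
  intro x hx k
  exact MagneticWell.exists_quasimode hA hb₀ hcurve hinterior hN hx k
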